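/- Work over $\mathbb{C}$ and let $N\ge 3$, $d\ge 3$. A hypersurface $C$ of degree $d$ in a projective space is a *good $P$-cone* if it is a cone with vertex $P$ and is smooth outside $P$. Let $\mathcal{P}_d$ be the space of triples $(\Pi,P,C)$ with $\Pi\subset\mathbb{P}^N$ a hyperplane, $P\in\Pi$ a point and $C$ a good $P$-cone of degree $d$ in $\Pi$. Let $\mathcal{S}$ be the set of pairs $\mathcal{L}=(\Pi_i,P_i,C_i)_{i=1,2}\in(\mathcal{P}_d)^2$ with $P_1\ne P_2$ that are *suited for degree $d$*, i.e. such that there is a hypersurface $X\subset\mathbb{P}^N$ of degree $d$ with $X\cap\Pi_i=C_i$ as schemes for $i=1,2$ (in particular $\Pi_i\not\subset X$); we say that such an $X$ realizes $\mathcal{L}$. Let $\mathcal{P}_d^{2,0}\subset(\mathcal{P}_d)^2$ be the set of pairs with $P_1\notin\Pi_2$ and $P_2\notin\Pi_1$, and let $\mathcal{V}_{d,2}$ be the set of pairs in $\mathcal{P}_d^{2,0}$ that are realized by an irreducible hypersurface of degree $d$. Put $\mathcal{W}=\mathcal{S}\setminus\mathcal{P}_d^{2,0}$. All these sets carry the Zariski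 topology. Then $\mathcal{S}$ has exactly two irreducible components, $\mathcal{V}_{d,2}$ and $\mathcal{W}$. (a) $\mathcal{V}_{d,2}$ has the expected dimension $$\Big(2\dim\mathcal{P}_d\Big)-\Big[\tbinom{N+d-1}{N-1}-\tbinom{N+d-2}{N-1}-1\Big]=2N+2(N-1)+\tbinom{N+d-2}{N-2}-1,\qquad \dim\mathcal{P}_d=2N+\tbinom{N+d-2}{N-2}-2 .$$ (b) $\dim\mathcal{W}=2(d+3)$ if $N=3$, and $\dim\mathcal{W}=2N+2(N-2)+\binom{N+d-4}{N-4}+2\binom{N+d-3}{N-2}-1$ if $N\ge4$. One has $\dim\mathcal{W}>\dim\mathcal{V}_{d,2}$ if and only if $N\ge4$ or $d\ge5$. (c) $\mathcal{W}$ corresponds to the line through the two star points lying on $X$. Call $P$ a *star point* of a hypersurface $X$ of degree $d$ if $P$ is a smooth point of $X$ and $T_P(X)\cap X$ has multiplicity $d$ at $P$. Every $\mathcal{L}\in\mathcal{S}$ is realized by some hypersurface $X$ of degree $d$ having $P_1$ and $P_2$ as star points, and for every such $X$ one has $\mathcal{L}\in\mathcal{W}$ if and only if the line $\langle P_1,P_2\rangle$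 lies on $X$. -/

import Mathlib

noncomputable section

namespace StarPoints

open Module
open scoped LinearAlgebra.Projectivization

/-- The space `Γ(ℙ^N, 𝒪(d))` of forms of degree `d` in `X_0, …, X_N` over `ℂ`. -/
abbrev Form (N d : ℕ) : Type :=
  MvPolynomial.homogeneousSubmodule (Fin (N + 1)) ℂ d

/-- Restriction of a form to (the linear cone over) a linear subspace, as a polynomial function. -/
def restrict {N : ℕ} (d : ℕ) (H : Submodule ℂ (Fin (N + 1) → ℂ)) : Form N d →ₗ[ℂ] (H → ℂ) where
  toFun F x := MvPolynomial.eval (x : Fin (N + 1) → ℂ) (F : MvPolynomial (Fin (N + 1)) ℂ)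
  map_add' F G := by ext x; simp
  map_smul' c F := by ext x; simp

/-- The space `Γ(Π, 𝒪(d))` of forms of degree `d` on the linear subspace `Π = ℙ(H)`. -/
abbrev FormsOn {N : ℕ} (d : ℕ) (H : Submodule ℂ (Fin (N + 1) → ℂ)) : Type :=
  LinearMap.range (restrict d H)

/-- The restriction of a form to `Π = ℙ(H)`, as an element of `Γ(Π, 𝒪(d))`. -/
def restrictTo {N d : ℕ} (F : Form N d) (H : Submodule ℂ (Fin (N + 1) → ℂ)) : FormsOn d H :=
  ⟨restrict d H F, LinearMap.mem_range_self _ _⟩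

/-- Triples `(Π, P, C)`: a hyperplane `Π = ℙ(hyp)` of `ℙ^N`, a point `P` on `Π`, and a
hypersurface `C` of degree `d` in `Π` (a nonzero form of degree `d` on `Π`, up to scalars). -/
structure Triple (N d : ℕ) where
  hyp : Submodule ℂ (Fin (N + 1) → ℂ)
  finrank_hyp : finrank ℂ hyp = N
  pt : ℙ ℂ (Fin (N + 1) → ℂ)
  pt_le : pt.submodule ≤ hyp
  cone : ℙ ℂ (FormsOn d hyp)

/-- `X ∩ Π = C` as schemes, where `X = Z(F)`: the restriction of `F` to `Π` is nonzero and is an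
equation of `C`. In particular `Π ⊄ X`. -/
def CutsOut {N d : ℕ} (F : Form N d) (T : Triple N d) : Prop :=
  T.cone.submodule = Submodule.span ℂ {restrictTo F T.hyp}

/-- The derivative at `x` of a polynomial in the direction `v`. -/
def dirDeriv {N : ℕ} (F : MvPolynomial (Fin (N + 1)) ℂ) (x v : Fin (N + 1) → ℂ) : ℂ :=
  ∑ i, v i * MvPolynomial.eval x (MvPolynomial.pderiv i F)

/-- `C` is a good `P`-cone in `Π`: an equation of `C` is invariant under translation along the
line in `ℂ^(N+1)` given by `P` (so `C` is a cone with vertex `P`), and `C` is smooth at each of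
its points other than `P`. -/
def Triple.IsGood {N d : ℕ} (T : Triple N d) : Prop :=
  ∃ F : Form N d, CutsOut F T ∧
    (∀ x ∈ T.hyp, ∀ p ∈ T.pt.submodule,
      MvPolynomial.eval (x + p) F.1 = MvPolynomial.eval x F.1) ∧
    (∀ x ∈ T.hyp, x ∉ T.pt.submodule → MvPolynomial.eval x F.1 = 0 →
      ∃ v ∈ T.hyp, dirDeriv F.1 x v ≠ 0)

/-- `e`-tuples of triples `(Π_i, P_i, C_i)`. -/
def Config (N d e : ℕ) : Type := Fin e → Triple N d

/-- The linear form with coefficient vector `a`. -/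
def linForm {N : ℕ} (a : Fin (N + 1) → ℂ) : Module.Dual ℂ (Fin (N + 1) → ℂ) :=
  ∑ i, a i • LinearMap.proj i

theorem linForm_ne_zero {N : ℕ} {a : Fin (N + 1) → ℂ} (ha : a ≠ 0) : linForm a ≠ 0 := by
  intro h
  apply ha
  ext i
  have := congrArg (fun f => f (Pi.single i 1)) h
  simpa [linForm, Pi.single_apply] using this

/-- Homogeneous coordinates for an `e`-tuple of triples: for each `i` a linear equation of `Π_i`,
a vector representing `P_i`, and a form of degree `d` whose restriction to `Π_i` defines `C_i`. -/
structure RawConfig (N d e : ℕ) where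
  eqn : Fin e → Fin (N + 1) → ℂ
  vec : Fin e → Fin (N + 1) → ℂ
  form : Fin e → Form N d
  eqn_ne : ∀ i, eqn i ≠ 0
  vec_ne : ∀ i, vec i ≠ 0
  incident : ∀ i, linForm (eqn i) (vec i) = 0
  restrict_ne : ∀ i, restrictTo (form i) (LinearMap.ker (linForm (eqn i))) ≠ 0

/-- The index set of the coordinates: the coefficients of the linear equations, the coordinates of
the points, and the coefficients of the forms of degree `d`. -/
abbrev CoordIndex (N d e : ℕ) : Type :=
  Fin e × (Fin (N + 1) ⊕ Fin (N + 1) ⊕ {m : Fin (N + 1) →₀ ℕ // m.degree = d})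

/-- The coordinates of a `RawConfig`, as a point of an affine space. -/
def RawConfig.coord {N d e : ℕ} (R : RawConfig N d e) : CoordIndex N d e → ℂ
  | (i, .inl j) => R.eqn i j
  | (i, .inr (.inl j)) => R.vec i j
  | (i, .inr (.inr m)) => MvPolynomial.coeff m.1 (R.form i).1

/-- The tuple of triples with the given homogeneous coordinates. -/
def RawConfig.toConfig {N d e : ℕ} (R : RawConfig N d e) : Config N d e := fun i =>
  { hyp := LinearMap.ker (linForm (R.eqn i))
    finrank_hyp := by
      have h := Module.Dual.finrank_ker_add_one_of_ne_zero (linForm_ne_zero (R.eqn_ne i))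
      rw [Module.finrank_fin_fun] at h
      omega
    pt := Projectivization.mk ℂ (R.vec i) (R.vec_ne i)
    pt_le := by
      rw [Projectivization.submodule_mk, Submodule.span_singleton_le_iff_mem]
      exact R.incident i
    cone := Projectivization.mk ℂ _ (R.restrict_ne i) }

/-- The Zariski topology on a locally closed subset of affine space (closed sets are the zero loci
of sets of polynomials in the coordinates). -/
@[reducible] def RawConfig.zariski (N d e : ℕ) : TopologicalSpace (RawConfig N d e) :=
  TopologicalSpace.induced
    (fun R => (MvPolynomial.pointToPoint R.coord :
      PrimeSpectrum (MvPolynomial (CoordIndex N d e) ℂ)))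
    inferInstance

/-- The Zariski topology on `e`-tuples of triples: a set is closed iff it is given by polynomial
equations in the homogeneous coordinates of the `Π_i`, `P_i` and `C_i`. -/
instance (N d e : ℕ) : TopologicalSpace (Config N d e) :=
  TopologicalSpace.coinduced RawConfig.toConfig (RawConfig.zariski N d e)

/-- `(𝒫_d)^e`: `e`-tuples of triples `(Π, P, C)` with `C` a good `P`-cone of degree `d` in `Π`. -/
def goodConfigs (N d e : ℕ) : Set (Config N d e) :=
  {L | ∀ i, (L i).IsGood}

/-- `𝒫_d^{e,0}`: those tuples of `(𝒫_d)^e` with `P_i ∉ Π_j` for `i ≠ j`. -/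
def generalConfigs (N d e : ℕ) : Set (Config N d e) :=
  {L | L ∈ goodConfigs N d e ∧ ∀ i j, i ≠ j → ¬ (L i).pt.submodule ≤ (L j).hyp}

/-- `X ∩ Π_i = C_i` for all `i`, where `X = Z(F)`. -/
def Realizes {N d e : ℕ} (F : Form N d) (L : Config N d e) : Prop :=
  ∀ i, CutsOut F (L i)

/-- The set `𝒮` of tuples in `(𝒫_d)^e`, with pairwise distinct points `P_i`, that are suited for
degree `d`: some hypersurface `X` of degree `d` satisfies `X ∩ Π_i = C_i` for all `i`. -/
def suitedConfigs (N d e : ℕ) : Set (Config N d e) :=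
  {L | L ∈ goodConfigs N d e ∧ (∀ i j, i ≠ j → (L i).pt ≠ (L j).pt) ∧
    ∃ F : Form N d, Realizes F L}

/-- `𝒱_{d,e}`: those tuples in `𝒫_d^{e,0}` for which some irreducible hypersurface `X` of degree
`d` satisfies `X ∩ Π_i = C_i` for all `i`. -/
def V (N d e : ℕ) : Set (Config N d e) :=
  {L | L ∈ generalConfigs N d e ∧ ∃ F : Form N d, Irreducible F.1 ∧ Realizes F L}

/-- The suited pairs outside `𝒫_d^{2,0}`, i.e. with `P_1 ∈ Π_2` or `P_2 ∈ Π_1`. -/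
def W (N d : ℕ) : Set (Config N d 2) :=
  {L | L ∈ suitedConfigs N d 2 ∧ L ∉ generalConfigs N d 2}

/-- `P` is a star point of `X = Z(F)`: `P` is a smooth point of `X`, and `T_P(X) ∩ X` is a
hypersurface of `T_P(X)` of multiplicity `d` at `P` (on every line through `P` in `T_P(X)`, the
equation vanishes to order at least `d` at `P`). -/
def IsStarPoint {N d : ℕ} (F : Form N d) (P : ℙ ℂ (Fin (N + 1) → ℂ)) : Prop :=
  MvPolynomial.eval P.rep F.1 = 0 ∧
  (∃ v, dirDeriv F.1 P.rep v ≠ 0) ∧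
  (∃ v, dirDeriv F.1 P.rep v = 0 ∧ MvPolynomial.eval v F.1 ≠ 0) ∧
  ∀ v, dirDeriv F.1 P.rep v = 0 →
    (Polynomial.X : Polynomial ℂ) ^ d ∣
      MvPolynomial.aeval
        (fun i => Polynomial.C (P.rep i) + Polynomial.C (v i) * Polynomial.X) F.1

/-- The line through `P` and `Q` lies on `X = Z(F)`. -/
def LineOn {N d : ℕ} (F : Form N d) (P Q : ℙ ℂ (Fin (N + 1) → ℂ)) : Prop :=
  ∀ x ∈ P.submodule ⊔ Q.submodule, MvPolynomial.eval x F.1 = 0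

/-- The dimension `2N + binom(N+d-2, N-2) - 2` of `𝒫_d`. -/
def dimTriples (N d : ℕ) : ℤ := 2 * N + (N + d - 2).choose (N - 2) - 2

/-- The expected dimension of `𝒱_{d,e}`: the dimension of `𝒫_d^{e,0}` minus the expected
codimension `f`. -/
def expectedDim (N d e : ℕ) : ℤ :=
  e * dimTriples N d -
    ∑ i ∈ Finset.Icc 2 e,
      (((N + d - 1).choose (N - 1) : ℤ)
        - (if i ≤ d + 1 then ((N + d - i).choose (N - 1) : ℤ) else 0) - 1)

/-- The dimension of the component in which the line through the two points lies on `X`. -/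
def dimW (N d : ℕ) : ℕ :=
  if N = 3 then 2 * (d + 3)
  else 2 * N + 2 * (N - 2) + (N + d - 4).choose (N - 4) + 2 * (N + d - 3).choose (N - 2) - 1

end StarPoints

end

noncomputable section

namespace StarPoints

open Module MvPolynomial Topology

/-! ### Zariski topologies given by coordinates -/

section Zariski

variable {X Y ι κ : Type*}

/-! Number the two triples by 0 and 1, and let `F` realize a suited pair. Because `C_i` is a cone of
degree at least 2, `dF` vanishes along `Π_i` at `P_i`. If `P_0` lay on `Π_1` while `P_1` did not lie
on `Π_0`, then `dF` at `P_0` would vanish along `Π_0` and in the direction of `P_1`, hence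
everywhere, contradicting smoothness of `C_1` at `P_0`. So the two incidences hold or fail together
(`dot_eq_zero_of_dot_eq_zero`), and a similar argument gives `Π_0 ≠ Π_1` (`eqn_ne_smul`). Linear
algebra leaves two normal forms: `Π_i` is `x_i = 0`, and `P_0, P_1` are the coordinate points with
indices 1, 0 (`posV`) or 2, 3 (`posW`). In normal form the cone conditions, together with discarding
monomials that vanish on both hyperplanes, leave only "allowed" monomials. Hence `V` and `W` are
exactly the configurations given by a coordinate change and an adapted form with smooth cones
(`V_eq_frameConfigs`, `W_eq_frameConfigs`). In the first case irreducibility of a realization costs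
nothing, since a suitable monomial vanishing on both hyperplanes can be added.

Irreducibility: having smooth cones is an open condition on adapted forms, by the Nullstellensatz
(`eventually_no_common_zero`, `eventually_stdGood`), and Fermat-like forms satisfy it. So `V` and
`W` are images of irreducible subsets of affine spaces (`isIrreducible_frameConfigs`).

Dimension: the map from homogeneous coordinates to configurations is open (`isOpenMap_toConfig`). A
slice of matrices, together with adapted forms having normalized pivot coefficients, therefore gives
open embeddings of subsets of affine space, and their translates cover the family. The dimension is
the number of slice coordinates (`topologicalKrullDim_frameConfigs`). Usually the equations of the
two cones share one scalar. For `W` with `N = 3`, however, `Π_0 ∩ Π_1` is the line through the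
points, no allowed monomial of degree `d` is visible on both cones, and two independent scalars are
normalized; this is why that case has its own formula.

Components: neither family may meet the closure of the other. Near `V` the inequality `P_0 ∉ Π_1`
persists. Near a point of `W` one needs a polynomial in the coordinates that vanishes on `V` but not
at that point. On `V`, both cones restrict to the same form on `Π_0 ∩ Π_1`, up to scalars. Comparing
the linear and the colinear coefficients of that form along a line gives such a relation,
`separator`; at the given point of `W` the incidence factors vanish and only a product of nonzero
derivatives remains.

Star points: the vertex of a good cone is a star point of `X` as soon as `X` is smooth there. The
tangent space is then `Π_0` at `P_0`, so in case `V` the line through the points is transversal to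
`X` there, and in case `W` the cone property puts it on `X`. -/

/-- The topology of `X` is the Zariski topology for the coordinates `c : X → ℂ^ι`. -/
def IsCoord [TopologicalSpace X] (c : X → ι → ℂ) : Prop :=
  IsInducing (fun x => (pointToPoint (c x) : PrimeSpectrum (MvPolynomial ι ℂ)))

/-- Affine space `ℂ^ι`, with the Zariski topology. -/
@[ext]
structure Aff (ι : Type*) where
  coord : ι → ℂ

instance : TopologicalSpace (Aff ι) :=
  TopologicalSpace.induced
    (fun x : Aff ι => (pointToPoint x.coord : PrimeSpectrum (MvPolynomial ι ℂ))) inferInstance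

theorem isCoord_aff : IsCoord (Aff.coord : Aff ι → ι → ℂ) := ⟨rfl⟩

theorem IsCoord.comp [TopologicalSpace X] [TopologicalSpace Y] {c : X → ι → ℂ} (hc : IsCoord c)
    {f : Y → X} (hf : IsInducing f) : IsCoord (c ∘ f) :=
  IsInducing.comp hc hf

theorem IsCoord.isClosed_iff [TopologicalSpace X] {c : X → ι → ℂ} (hc : IsCoord c) {Z : Set X} :
    IsClosed Z ↔ ∃ s : Set (MvPolynomial ι ℂ), Z = {x | ∀ p ∈ s, eval (c x) p = 0} := by
  have key : ∀ s : Set (MvPolynomial ι ℂ),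
      (fun x => (pointToPoint (c x) : PrimeSpectrum (MvPolynomial ι ℂ))) ⁻¹'
        PrimeSpectrum.zeroLocus s = {x | ∀ p ∈ s, eval (c x) p = 0} := by
    intro s
    ext x
    simp only [Set.mem_preimage, PrimeSpectrum.mem_zeroLocus, Set.mem_ofPred_eq, pointToPoint]
    refine forall₂_congr fun p _ => ?_
    change p ∈ vanishingIdeal ℂ {c x} ↔ _
    rw [mem_vanishingIdeal_singleton_iff]
    rfl
  rw [IsInducing.isClosed_iff hc]
  constructor
  · rintro ⟨t, ht, rfl⟩
    obtain ⟨s, rfl⟩ := (PrimeSpectrum.isClosed_iff_zeroLocus t).1 ht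
    exact ⟨s, key s⟩
  · rintro ⟨s, rfl⟩
    exact ⟨_, PrimeSpectrum.isClosed_zeroLocus s, key s⟩

theorem IsCoord.exists_basic [TopologicalSpace X] {c : X → ι → ℂ} (hc : IsCoord c) {U : Set X}
    (hU : IsOpen U) {x : X} (hx : x ∈ U) :
    ∃ p : MvPolynomial ι ℂ, eval (c x) p ≠ 0 ∧ ∀ y, eval (c y) p ≠ 0 → y ∈ U := by
  obtain ⟨s, hs⟩ := hc.isClosed_iff.1 hU.isClosed_compl
  have hx' : x ∉ Uᶜ := fun h => h hx
  rw [hs] at hx'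
  simp only [Set.mem_ofPred_eq, not_forall] at hx'
  obtain ⟨p, hp, hpx⟩ := hx'
  refine ⟨p, hpx, fun y hy => ?_⟩
  by_contra hyU
  have : y ∈ Uᶜ := hyU
  rw [hs] at this
  exact hy (this p hp)

theorem IsCoord.isOpen_ne [TopologicalSpace X] {c : X → ι → ℂ} (hc : IsCoord c)
    (p : MvPolynomial ι ℂ) : IsOpen {x | eval (c x) p ≠ 0} := by
  rw [← isClosed_compl_iff, hc.isClosed_iff]
  exact ⟨{p}, by ext; simp⟩

/-- Functions on `X` that on `D` are quotients of polynomials in the coordinates, with a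
denominator that does not vanish on `D`. -/
def Reg (c : X → ι → ℂ) (D : Set X) : Subalgebra ℂ (X → ℂ) where
  carrier := {f | ∃ g h : MvPolynomial ι ℂ, ∀ x ∈ D, eval (c x) h ≠ 0 ∧
    f x * eval (c x) h = eval (c x) g}
  mul_mem' := by
    rintro f f' ⟨g, h, H⟩ ⟨g', h', H'⟩
    refine ⟨g * g', h * h', fun x hx => ⟨?_, ?_⟩⟩
    · simpa using ⟨(H x hx).1, (H' x hx).1⟩
    · simp only [map_mul, Pi.mul_apply, ← (H x hx).2, ← (H' x hx).2]; ring
  add_mem' := by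
    rintro f f' ⟨g, h, H⟩ ⟨g', h', H'⟩
    refine ⟨g * h' + g' * h, h * h', fun x hx => ⟨?_, ?_⟩⟩
    · simpa using ⟨(H x hx).1, (H' x hx).1⟩
    · simp only [map_mul, map_add, Pi.add_apply, ← (H x hx).2, ← (H' x hx).2]; ring
  algebraMap_mem' r := ⟨MvPolynomial.C r, 1, fun x _ => by simp⟩

theorem coord_mem_reg (c : X → ι → ℂ) (D : Set X) (j : ι) : (fun x => c x j) ∈ Reg c D :=
  ⟨MvPolynomial.X j, 1, fun x _ => by simp⟩

theorem const_mem_reg (c : X → ι → ℂ) (D : Set X) (a : ℂ) : (fun _ => a) ∈ Reg c D :=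
  (Reg c D).algebraMap_mem a

theorem inv_mem_reg {c : X → ι → ℂ} {D : Set X} {f : X → ℂ} (hf : f ∈ Reg c D)
    (h0 : ∀ x ∈ D, f x ≠ 0) : (fun x => (f x)⁻¹) ∈ Reg c D := by
  obtain ⟨g, h, H⟩ := hf
  refine ⟨h, g, fun x hx => ⟨?_, ?_⟩⟩
  · rw [← (H x hx).2]; exact mul_ne_zero (h0 x hx) (H x hx).1
  · rw [← (H x hx).2, inv_mul_cancel_left₀ (h0 x hx)]

theorem div_mem_reg {c : X → ι → ℂ} {D : Set X} {f g : X → ℂ} (hf : f ∈ Reg c D)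
    (hg : g ∈ Reg c D) (h0 : ∀ x ∈ D, g x ≠ 0) : (fun x => f x / g x) ∈ Reg c D := by
  simp only [div_eq_mul_inv]
  exact (Reg c D).mul_mem hf (inv_mem_reg hg h0)

theorem reg_comp {c : X → ι → ℂ} {D : Set X} {f : X → ℂ} (hf : f ∈ Reg c D) {φ : Y → X}
    {D' : Set Y} (h : ∀ y ∈ D', φ y ∈ D) : f ∘ φ ∈ Reg (c ∘ φ) D' := by
  obtain ⟨p, k, H⟩ := hf
  exact ⟨p, k, fun y hy => H _ (h y hy)⟩

theorem eval_mem_reg {c : X → ι → ℂ} {D : Set X} {b : X → κ → ℂ}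
    (hb : ∀ j, (fun x => b x j) ∈ Reg c D) (p : MvPolynomial κ ℂ) :
    (fun x => eval (b x) p) ∈ Reg c D := by
  induction p using MvPolynomial.induction_on with
  | C a => simpa using const_mem_reg c D a
  | add p q hp hq => simp only [map_add]; exact (Reg c D).add_mem hp hq
  | mul_X p j hp => simp only [map_mul, eval_X]; exact (Reg c D).mul_mem hp (hb j)

theorem IsCoord.isOpen_reg [TopologicalSpace X] {c : X → ι → ℂ} (hc : IsCoord c) {D : Set X}
    (hD : IsOpen D) {f : X → ℂ} (hf : f ∈ Reg c D) : IsOpen {x | x ∈ D ∧ f x ≠ 0} := by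
  obtain ⟨g, h, H⟩ := hf
  convert hD.inter (hc.isOpen_ne g) using 1
  ext x
  refine and_congr_right fun hx => ?_
  change _ ↔ eval (c x) g ≠ 0
  rw [← (H x hx).2]
  simp [(H x hx).1]

/-- A polynomial in regular functions is regular, so its zero set pulls back to the zero set of a
numerator. -/
theorem IsCoord.continuous_of_reg [TopologicalSpace X] [TopologicalSpace Y] {c : X → ι → ℂ}
    (hc : IsCoord c) {b : Y → κ → ℂ} (hb : IsCoord b) {φ : X → Y}
    (h : ∀ j, (fun x => b (φ x) j) ∈ Reg c Set.univ) : Continuous φ := by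
  rw [continuous_iff_isClosed]
  intro Z hZ
  obtain ⟨s, rfl⟩ := hb.isClosed_iff.1 hZ
  have : φ ⁻¹' {x | ∀ p ∈ s, eval (b x) p = 0} = ⋂ p ∈ s, {x | eval (b (φ x)) p = 0} := by
    ext; simp
  rw [this]
  refine isClosed_biInter fun p _ => ?_
  rw [← isOpen_compl_iff]
  convert hc.isOpen_reg isOpen_univ (eval_mem_reg h p) using 1
  ext; simp

/-- Evaluation of regular functions at a point. -/
def regEval (c : X → ι → ℂ) (D : Set X) (x : X) : Reg c D →+* ℂ :=
  (Pi.evalRingHom (fun _ : X => ℂ) x).comp (Reg c D).val.toRingHom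

@[simp]
theorem regEval_apply (c : X → ι → ℂ) (D : Set X) (x : X) (f : Reg c D) :
    regEval c D x f = f.1 x := rfl

/-- A family of polynomials whose coefficients are regular functions of the parameter. -/
def RegPoly (c : X → ι → ℂ) (D : Set X) (Φ : X → MvPolynomial κ ℂ) : Prop :=
  ∃ Ψ : MvPolynomial κ (Reg c D), ∀ x, map (regEval c D x) Ψ = Φ x

theorem RegPoly.coeff {c : X → ι → ℂ} {D : Set X} {Φ : X → MvPolynomial κ ℂ}
    (h : RegPoly c D Φ) (m : κ →₀ ℕ) : (fun x => MvPolynomial.coeff m (Φ x)) ∈ Reg c D := by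
  obtain ⟨Ψ, hΨ⟩ := h
  have : (fun x => MvPolynomial.coeff m (Φ x)) = (MvPolynomial.coeff m Ψ).1 := by
    funext x
    rw [← hΨ, coeff_map, regEval_apply]
  rw [this]
  exact (MvPolynomial.coeff m Ψ).2

/-- A single finite set must contain all the supports, because the family has to come from one
polynomial over the ring of regular functions. -/
theorem regPoly_of_coeff {c : X → ι → ℂ} {D : Set X} {Φ : X → MvPolynomial κ ℂ}
    (s : Finset (κ →₀ ℕ)) (hs : ∀ x, (Φ x).support ⊆ s)
    (h : ∀ m, (fun x => MvPolynomial.coeff m (Φ x)) ∈ Reg c D) : RegPoly c D Φ := by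
  refine ⟨∑ m ∈ s, monomial m ⟨_, h m⟩, fun x => ?_⟩
  rw [map_sum]
  simp only [map_monomial, regEval_apply]
  conv_rhs => rw [(Φ x).as_sum]
  refine (Finset.sum_subset (hs x) fun m _ hm => ?_).symm
  rw [notMem_support_iff.1 hm, monomial_zero]

theorem RegPoly.mul {c : X → ι → ℂ} {D : Set X} {Φ Φ' : X → MvPolynomial κ ℂ}
    (h : RegPoly c D Φ) (h' : RegPoly c D Φ') : RegPoly c D (fun x => Φ x * Φ' x) := by
  obtain ⟨Ψ, hΨ⟩ := h
  obtain ⟨Ψ', hΨ'⟩ := h'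
  exact ⟨Ψ * Ψ', fun x => by simp [hΨ, hΨ']⟩

theorem RegPoly.sum {α : Type*} {c : X → ι → ℂ} {D : Set X} {s : Finset α}
    {Φ : α → X → MvPolynomial κ ℂ} (h : ∀ a, RegPoly c D (Φ a)) :
    RegPoly c D (fun x => ∑ a ∈ s, Φ a x) := by
  choose Ψ hΨ using h
  exact ⟨∑ a ∈ s, Ψ a, fun x => by simp [hΨ]⟩

theorem regPoly_const (c : X → ι → ℂ) (D : Set X) (p : MvPolynomial κ ℂ) :
    RegPoly c D (fun _ => p) :=
  regPoly_of_coeff p.support (fun _ => subset_rfl) fun _ => const_mem_reg c D _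

theorem regPoly_C {c : X → ι → ℂ} {D : Set X} {f : X → ℂ} (hf : f ∈ Reg c D) :
    RegPoly c D (fun x => (MvPolynomial.C (f x) : MvPolynomial κ ℂ)) :=
  ⟨MvPolynomial.C ⟨f, hf⟩, fun x => by simp⟩

theorem RegPoly.pderiv {c : X → ι → ℂ} {D : Set X} {Φ : X → MvPolynomial κ ℂ}
    (h : RegPoly c D Φ) (i : κ) : RegPoly c D (fun x => MvPolynomial.pderiv i (Φ x)) := by
  obtain ⟨Ψ, hΨ⟩ := h
  exact ⟨MvPolynomial.pderiv i Ψ, fun x => by simp only [← hΨ, MvPolynomial.pderiv_map]⟩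

theorem RegPoly.aeval {κ' : Type*} {c : X → ι → ℂ} {D : Set X} {Φ : X → MvPolynomial κ ℂ}
    (h : RegPoly c D Φ) {g : X → κ → MvPolynomial κ' ℂ}
    (hg : ∀ i, RegPoly c D (fun x => g x i)) :
    RegPoly c D (fun x => MvPolynomial.aeval (g x) (Φ x)) := by
  obtain ⟨Ψ, hΨ⟩ := h
  choose G hG using hg
  refine ⟨MvPolynomial.bind₁ G Ψ, fun x => ?_⟩
  rw [map_bind₁, hΨ]
  simp only [hG]
  rfl

theorem det_mem_reg {n : Type*} [Fintype n] [DecidableEq n] {c : X → ι → ℂ} {D : Set X}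
    {A : X → Matrix n n ℂ} (hA : ∀ i j, (fun x => A x i j) ∈ Reg c D) :
    (fun x => (A x).det) ∈ Reg c D := by
  have : (fun x => (A x).det) = ((Matrix.of fun i j => (⟨_, hA i j⟩ : Reg c D)).det).1 := by
    funext x
    rw [← regEval_apply, RingHom.map_det]
    rfl
  rw [this]
  exact Subtype.property _

theorem adjugate_mem_reg {n : Type*} [Fintype n] [DecidableEq n] {c : X → ι → ℂ} {D : Set X}
    {A : X → Matrix n n ℂ} (hA : ∀ i j, (fun x => A x i j) ∈ Reg c D) (i j : n) :
    (fun x => (A x).adjugate i j) ∈ Reg c D := by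
  have : (fun x => (A x).adjugate i j) =
      ((Matrix.of fun i j => (⟨_, hA i j⟩ : Reg c D)).adjugate i j).1 := by
    funext x
    rw [← regEval_apply]
    have := RingHom.map_adjugate (regEval c D x) (Matrix.of fun i j => (⟨_, hA i j⟩ : Reg c D))
    exact (congrFun (congrFun this i) j).symm
  rw [this]
  exact Subtype.property _

theorem matInv_mem_reg {n : Type*} [Fintype n] [DecidableEq n] {c : X → ι → ℂ} {D : Set X}
    {A : X → Matrix n n ℂ} (hA : ∀ i j, (fun x => A x i j) ∈ Reg c D)
    (h0 : ∀ x ∈ D, (A x).det ≠ 0) (i j : n) :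
    (fun x => (A x)⁻¹ i j) ∈ Reg c D := by
  have := (Reg c D).mul_mem (inv_mem_reg (det_mem_reg hA) h0) (adjugate_mem_reg hA i j)
  convert this using 2 with x
  simp [Matrix.inv_def]

end Zariski

/-! ### Irreducibility and dimension of dense subsets of affine space -/

section Dim

variable {X ι : Type*}

theorem exists_eval_ne_zero {p : MvPolynomial ι ℂ} (hp : p ≠ 0) : ∃ x, eval x p ≠ 0 := by
  by_contra! h
  exact hp (MvPolynomial.funext fun x => by simpa using h x)

/-- Nonempty relatively open sets contain basic ones given by nonzero `p` and `p'`. The product `Δ *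
p * p'` is nonzero, hence has a nonzero value over the infinite field `ℂ`, and that point lies in
both sets. -/
theorem irreducibleSpace_of_basic {Q : Set (Aff ι)} {Δ : MvPolynomial ι ℂ} (hΔ : Δ ≠ 0)
    (hQ : ∀ x : Aff ι, eval x.coord Δ ≠ 0 → x ∈ Q) : IrreducibleSpace Q := by
  have hc : IsCoord (fun x : Q => x.1.coord) := isCoord_aff.comp IsInducing.subtypeVal
  obtain ⟨x₀, hx₀⟩ := exists_eval_ne_zero hΔ
  refine { isPreirreducible_univ := ?_, toNonempty := ⟨⟨⟨x₀⟩, hQ _ hx₀⟩⟩ }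
  rintro U U' hU hU' ⟨x, -, hx⟩ ⟨x', -, hx'⟩
  obtain ⟨p, hp, hpU⟩ := hc.exists_basic hU hx
  obtain ⟨p', hp', hpU'⟩ := hc.exists_basic hU' hx'
  have hne : ∀ {q : MvPolynomial ι ℂ} {z : ι → ℂ}, eval z q ≠ 0 → q ≠ 0 := by
    rintro q z h rfl; simp at h
  obtain ⟨y, hy⟩ := exists_eval_ne_zero (mul_ne_zero hΔ (mul_ne_zero (hne hp) (hne hp')))
  simp only [map_mul, ne_eq, mul_eq_zero, not_or] at hy
  exact ⟨⟨⟨y⟩, hQ _ hy.1⟩, trivial, hpU _ hy.2.1, hpU' _ hy.2.2⟩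

theorem irreducibleSpace_of_mem_nhds {Q : Set (Aff ι)} {x : Aff ι} (hQ : Q ∈ 𝓝 x) :
    IrreducibleSpace Q := by
  obtain ⟨U, hUQ, hU, hx⟩ := mem_nhds_iff.1 hQ
  obtain ⟨p, hp, hpU⟩ := isCoord_aff.exists_basic hU hx
  exact irreducibleSpace_of_basic (Δ := p) (by rintro rfl; simp at hp) fun y hy => hUQ (hpU y hy)

/-- The coordinates induce the topology from the spectrum of a polynomial ring, whose dimension is
the number of variables. -/
theorem topologicalKrullDim_le_of_isCoord [TopologicalSpace X] [Finite ι] {c : X → ι → ℂ}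
    (hc : IsCoord c) : topologicalKrullDim X ≤ Nat.card ι := by
  refine (IsInducing.topologicalKrullDim_le hc).trans ?_
  rw [PrimeSpectrum.topologicalKrullDim_eq_ringKrullDim,
    MvPolynomial.ringKrullDim_of_isNoetherianRing, ringKrullDim_eq_zero_of_field, zero_add]

/-- A dense subset of `ℂ^n` containing a neighbourhood of a point has dimension at least `n`. -/
theorem le_topologicalKrullDim_of_mem_nhds [Finite ι] {Q : Set (Aff ι)} {a : Aff ι}
    (hQ : Q ∈ 𝓝 a) : (Nat.card ι : WithBot ℕ∞) ≤ topologicalKrullDim Q := by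
  classical
  obtain ⟨U, hUQ, hU, ha⟩ := mem_nhds_iff.1 hQ
  obtain ⟨p, hp, hpU⟩ := isCoord_aff.exists_basic hU ha
  have hc : IsCoord (fun x : Q => x.1.coord) := isCoord_aff.comp IsInducing.subtypeVal
  obtain ⟨n, ⟨e⟩⟩ := Finite.exists_equiv_fin ι
  have hn : Nat.card ι = n := by rw [Nat.card_congr e, Nat.card_fin]
  -- the retraction onto the `k`-th member of the flag through `a`
  let r (k : ℕ) (y : Aff ι) : Aff ι := ⟨fun j => if (e j : ℕ) < k then y.coord j else a.coord j⟩
  let rp (k : ℕ) (j : ι) : MvPolynomial ι ℂ :=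
    if (e j : ℕ) < k then MvPolynomial.X j else MvPolynomial.C (a.coord j)
  have hr : ∀ k (y : Aff ι) (q : MvPolynomial ι ℂ), eval y.coord (bind₁ (rp k) q) = eval (r k y).coord q := by
    intro k y q
    change aeval y.coord (bind₁ (rp k) q) = aeval (r k y).coord q
    rw [aeval_bind₁]
    congr 2
    funext j
    by_cases h : (e j : ℕ) < k <;> simp [rp, r, h]
  have hra : ∀ k, r k a = a := fun k => by ext j; simp [r]
  have hpne : ∀ k, bind₁ (rp k) p ≠ 0 := fun k h => by
    have := hr k a p
    rw [h, hra] at this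
    exact hp (by simpa using this.symm)
  let S (k : ℕ) : Set Q := {x | ∀ j, k ≤ (e j : ℕ) → x.1.coord j = a.coord j}
  have hSclosed : ∀ k, IsClosed (S k) := fun k => by
    refine hc.isClosed_iff.2
      ⟨{q | ∃ j, k ≤ (e j : ℕ) ∧ q = MvPolynomial.X j - MvPolynomial.C (a.coord j)}, ?_⟩
    ext x
    constructor
    · rintro hx q ⟨j, hj, rfl⟩
      simpa [sub_eq_zero] using hx j hj
    · intro hx j hj
      simpa [sub_eq_zero] using hx _ ⟨j, hj, rfl⟩
  have hSirr : ∀ k, IsIrreducible (S k) := fun k => by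
    -- The flag member is the image of `Q'` under the retraction. `Q'` contains the basic open set
    -- of the pullback of `p`, which is nonzero because it does not vanish at `a`.
    let Q' : Set (Aff ι) := {y | r k y ∈ Q}
    have : IrreducibleSpace Q' := irreducibleSpace_of_basic (hpne k) fun y hy =>
      hUQ (hpU _ (by simpa only [hr] using hy))
    let φ : Q' → Q := fun y => ⟨r k y.1, y.2⟩
    have hφ : Continuous φ := by
      have hc' : IsCoord (fun y : Q' => y.1.coord) := isCoord_aff.comp IsInducing.subtypeVal
      refine hc'.continuous_of_reg hc fun j => ?_
      by_cases h : (e j : ℕ) < k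
      · simpa [φ, r, h] using coord_mem_reg (fun y : Q' => y.1.coord) Set.univ j
      · simpa [φ, r, h] using const_mem_reg (fun y : Q' => y.1.coord) Set.univ (a.coord j)
    have himg : S k = φ '' Set.univ := by
      ext x
      constructor
      · intro hx
        have hxr : r k x.1 = x.1 := by
          ext j
          by_cases h : (e j : ℕ) < k
          · simp [r, h]
          · simp [r, h, hx j (not_lt.1 h)]
        exact ⟨⟨x.1, by change r k x.1 ∈ Q; rw [hxr]; exact x.2⟩, trivial, Subtype.ext hxr⟩
      · rintro ⟨y, -, rfl⟩ j hj
        simp [φ, r, not_lt.2 hj]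
    rw [himg]
    exact (IrreducibleSpace.isIrreducible_univ _).image _ hφ.continuousOn
  let f (k : Fin (n + 1)) : TopologicalSpace.IrreducibleCloseds Q :=
    ⟨S k, hSirr k, hSclosed k⟩
  have hf : StrictMono f := by
    refine Fin.strictMono_iff_lt_succ.2 fun k => ?_
    refine lt_of_le_of_ne (fun x hx j hj => hx j ?_) fun h => ?_
    · simp only [Fin.val_succ] at hj
      simp only [Fin.val_castSucc]
      omega
    · obtain ⟨j, hj⟩ := e.surjective k
      have hX : (MvPolynomial.X j - MvPolynomial.C (a.coord j) : MvPolynomial ι ℂ) ≠ 0 := by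
        intro h0
        have := congrArg (eval (fun _ => a.coord j + 1)) h0
        simp at this
      -- Strictness needs a point of the larger flag member that stays in the neighbourhood of `a`
      -- and whose new coordinate differs from that of `a`.
      obtain ⟨y, hy⟩ := exists_eval_ne_zero (mul_ne_zero (hpne ((k : ℕ) + 1)) hX)
      rw [map_mul, mul_ne_zero_iff, hr _ ⟨y⟩] at hy
      let z : Q := ⟨r ((k : ℕ) + 1) ⟨y⟩, hUQ (hpU _ hy.1)⟩
      have hz : z ∈ S ((k : ℕ) + 1) := fun i hi => by simp [z, r, not_lt.2 hi]
      have hz' : z ∈ S (k : ℕ) := by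
        have h2 : S (k : ℕ) = S ((k : ℕ) + 1) :=
          congrArg (fun T : TopologicalSpace.IrreducibleCloseds Q => (T : Set Q)) h
        rw [h2]; exact hz
      have := hz' j (by rw [hj])
      apply hy.2
      simp only [z, r, hj] at this
      simpa [sub_eq_zero] using this
  rw [hn]
  exact Order.LTSeries.length_le_krullDim (⟨n, f, fun i => hf (Fin.castSucc_lt_succ)⟩ :
    LTSeries (TopologicalSpace.IrreducibleCloseds Q))

/-- The dimension of a space is bounded by the dimensions of the members of an open cover. -/
theorem topologicalKrullDim_le_of_cover [TopologicalSpace X] {n : WithBot ℕ∞}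
    (h : ∀ x : X, ∃ U : Set X, IsOpen U ∧ x ∈ U ∧ topologicalKrullDim U ≤ n) :
    topologicalKrullDim X ≤ n := by
  refine iSup_le fun s => ?_
  obtain ⟨x, hx⟩ := (s 0).isIrreducible.nonempty
  obtain ⟨U, hU, hxU, hUn⟩ := h x
  refine le_trans ?_ hUn
  -- The smallest member of the chain meets `U`, so all members do, and intersecting with `U` keeps
  -- the inclusions strict.
  have hne : ∀ i, ((Subtype.val : U → X) ⁻¹' (s i : Set X)).Nonempty := fun i =>
    ⟨⟨x, hxU⟩, s.monotone (Fin.zero_le i) hx⟩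
  let E := (TopologicalSpace.IrreducibleCloseds.orderIsoOfIsOpenEmbedding
    (Subtype.val : U → X) hU.isOpenEmbedding_subtypeVal).symm
  exact Order.LTSeries.length_le_krullDim (⟨s.length, fun i => E ⟨s i, hne i⟩, fun i =>
    E.strictMono (s.step i)⟩ : LTSeries (TopologicalSpace.IrreducibleCloseds U))

end Dim

end StarPoints

end

noncomputable section

namespace StarPoints

open Module MvPolynomial Topology
open scoped LinearAlgebra.Projectivization

/-! ### Forms, linear substitutions and directional derivatives -/

section Forms

variable {N d : ℕ}

theorem Form.ext_eval {F G : Form N d} (h : ∀ x, eval x F.1 = eval x G.1) : F = G :=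
  Subtype.ext (MvPolynomial.funext h)

theorem degree_eq_of_mem_support (F : Form N d) {m : Fin (N + 1) →₀ ℕ} (hm : m ∈ F.1.support) :
    m.degree = d := by
  have hF : F.1.IsHomogeneous d := F.2
  by_contra h
  exact mem_support_iff.1 hm (hF.coeff_eq_zero h)

theorem eval_smul_form (F : Form N d) (s : ℂ) (x : Fin (N + 1) → ℂ) :
    eval (s • x) F.1 = s ^ d * eval x F.1 := by
  rw [eval_eq', eval_eq', Finset.mul_sum]
  refine Finset.sum_congr rfl fun m hm => ?_
  have hm' : ∑ i, m i = d := by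
    rw [← Finsupp.degree_eq_sum]
    exact degree_eq_of_mem_support F hm
  simp only [Pi.smul_apply, smul_eq_mul, mul_pow, Finset.prod_mul_distrib]
  have h : ∏ i, s ^ m i = s ^ d := by rw [Finset.prod_pow_eq_pow_sum, hm']
  rw [h]
  ring

/-- The form `x ↦ F (A x)`. -/
def comp (F : Form N d) (A : Matrix (Fin (N + 1)) (Fin (N + 1)) ℂ) : Form N d :=
  ⟨aeval (fun i => ∑ j, MvPolynomial.C (A i j) * MvPolynomial.X j) F.1, by
    have hF : F.1.IsHomogeneous d := F.2
    have := hF.aeval (fun i => ∑ j, (MvPolynomial.C (A i j) * MvPolynomial.X j :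
      MvPolynomial (Fin (N + 1)) ℂ)) (n := 1) fun i =>
        IsHomogeneous.sum _ _ _ fun j _ => by
          simpa using (isHomogeneous_C _ (A i j)).mul (isHomogeneous_X ℂ j)
    simpa using this⟩

@[simp]
theorem eval_comp (F : Form N d) (A : Matrix (Fin (N + 1)) (Fin (N + 1)) ℂ)
    (x : Fin (N + 1) → ℂ) : eval x (comp F A).1 = eval (A.mulVec x) F.1 := by
  change aeval x (aeval _ F.1) = aeval _ F.1
  rw [← AlgHom.comp_apply, comp_aeval]
  congr 2
  funext i
  simp [Matrix.mulVec, dotProduct]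

theorem comp_comp (F : Form N d) (A B : Matrix (Fin (N + 1)) (Fin (N + 1)) ℂ) :
    comp (comp F A) B = comp F (A * B) :=
  Form.ext_eval fun x => by simp

theorem comp_one (F : Form N d) : comp F 1 = F :=
  Form.ext_eval fun x => by simp

theorem comp_cancel_inv (F : Form N d) {A : Matrix (Fin (N + 1)) (Fin (N + 1)) ℂ}
    (hA : IsUnit A.det) : comp (comp F A) A⁻¹ = F := by
  rw [comp_comp, Matrix.mul_nonsing_inv _ hA, comp_one]

theorem regPoly_form {X ι : Type*} {c : X → ι → ℂ} {D : Set X} {F : X → Form N d}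
    (hF : ∀ m : {m : Fin (N + 1) →₀ ℕ // m.degree = d}, (fun x => coeff m.1 (F x).1) ∈ Reg c D) :
    RegPoly c D (fun x => (F x).1) := by
  refine regPoly_of_coeff (Finset.univ.finsuppAntidiag d) (fun x m hm => ?_) fun m => ?_
  · rw [Finset.mem_finsuppAntidiag]
    refine ⟨?_, Finset.subset_univ _⟩
    rw [← degree_eq_of_mem_support _ hm, Finsupp.degree_eq_sum]
  · by_cases hm : m.degree = d
    · exact hF ⟨m, hm⟩
    · convert const_mem_reg c D 0 using 2 with x
      by_contra h
      exact hm (degree_eq_of_mem_support (F x) (mem_support_iff.2 h))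

theorem coeff_comp_mem_reg {X ι : Type*} {c : X → ι → ℂ} {D : Set X} {F : X → Form N d}
    {A : X → Matrix (Fin (N + 1)) (Fin (N + 1)) ℂ}
    (hF : ∀ m : {m : Fin (N + 1) →₀ ℕ // m.degree = d}, (fun x => coeff m.1 (F x).1) ∈ Reg c D)
    (hA : ∀ i j, (fun x => A x i j) ∈ Reg c D) (m : Fin (N + 1) →₀ ℕ) :
    (fun x => coeff m (comp (F x) (A x)).1) ∈ Reg c D := by
  refine RegPoly.coeff ((regPoly_form hF).aeval fun i => RegPoly.sum fun j => ?_) m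
  exact (regPoly_C (hA i j)).mul (regPoly_const c D _)

theorem hasDerivAt_eval_line (F : MvPolynomial (Fin (N + 1)) ℂ) (x v : Fin (N + 1) → ℂ) :
    HasDerivAt (fun s : ℂ => eval (x + s • v) F) (dirDeriv F x v) 0 := by
  induction F using MvPolynomial.induction_on with
  | C a => simpa [dirDeriv] using hasDerivAt_const (0 : ℂ) a
  | add p q hp hq =>
    have h := hp.add hq
    have h1 : dirDeriv (p + q) x v = dirDeriv p x v + dirDeriv q x v := by
      simp [dirDeriv, mul_add, Finset.sum_add_distrib]
    rw [← h1] at h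
    exact h.congr_of_eventuallyEq (Filter.Eventually.of_forall fun s => by simp)
  | mul_X p j hp =>
    have h1 : HasDerivAt (fun s : ℂ => x j + s * v j) (v j) 0 := by
      simpa using ((hasDerivAt_id (0 : ℂ)).mul_const (v j)).const_add (x j)
    have h := hp.mul h1
    have h2 : dirDeriv (p * MvPolynomial.X j) x v =
        dirDeriv p x v * (x j + 0 * v j) + eval (x + (0 : ℂ) • v) p * v j := by
      simp only [dirDeriv, Derivation.leibniz, pderiv_X, smul_eq_mul, map_add, map_mul, eval_X,
        mul_add, Finset.sum_add_distrib, Finset.sum_mul, zero_smul, add_zero, zero_mul]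
      rw [add_comm]
      congr 1
      · exact Finset.sum_congr rfl fun i _ => by ring
      · rw [Finset.sum_eq_single j]
        · simp [mul_comm]
        · intro i _ hi; simp [hi.symm]
        · simp
    rw [← h2] at h
    exact h.congr_of_eventuallyEq (Filter.Eventually.of_forall fun s => by simp)

/-- Comparing derivatives analytically requires agreement only along one line. This applies to forms
that agree merely on a hyperplane. -/
theorem dirDeriv_eq_of_eval_line {F G : MvPolynomial (Fin (N + 1)) ℂ}
    {x v y w : Fin (N + 1) → ℂ} {k : ℂ}
    (h : ∀ s : ℂ, eval (x + s • v) F = k * eval (y + s • w) G) :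
    dirDeriv F x v = k * dirDeriv G y w := by
  have h1 := hasDerivAt_eval_line F x v
  have h2 := (hasDerivAt_eval_line G y w).const_mul k
  rw [← funext h] at h2
  exact h1.unique h2

theorem dirDeriv_comp (F : Form N d) (A : Matrix (Fin (N + 1)) (Fin (N + 1)) ℂ)
    (x v : Fin (N + 1) → ℂ) :
    dirDeriv (comp F A).1 x v = dirDeriv F.1 (A.mulVec x) (A.mulVec v) := by
  rw [← one_mul (dirDeriv F.1 _ _)]
  refine dirDeriv_eq_of_eval_line fun s => ?_
  rw [eval_comp, one_mul, Matrix.mulVec_add, Matrix.mulVec_smul]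

theorem dirDeriv_add (F : MvPolynomial (Fin (N + 1)) ℂ) (x v w : Fin (N + 1) → ℂ) :
    dirDeriv F x (v + w) = dirDeriv F x v + dirDeriv F x w := by
  simp [dirDeriv, add_mul, Finset.sum_add_distrib]

theorem dirDeriv_smul (F : MvPolynomial (Fin (N + 1)) ℂ) (x v : Fin (N + 1) → ℂ) (s : ℂ) :
    dirDeriv F x (s • v) = s * dirDeriv F x v := by
  simp [dirDeriv, Finset.mul_sum, mul_assoc]

/-- Along the line the function is `s ^ d` times a constant, with zero derivative at `0` because `d
≥ 2`. -/
theorem dirDeriv_eq_zero_of_cone (F : Form N d) (hd : 2 ≤ d) {x v : Fin (N + 1) → ℂ}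
    (h : ∀ s : ℂ, eval (x + s • v) F.1 = eval (s • v) F.1) : dirDeriv F.1 x v = 0 := by
  have h1 := hasDerivAt_eval_line F.1 x v
  have h2 : HasDerivAt (fun s : ℂ => s ^ d * eval v F.1) 0 0 := by
    have := (hasDerivAt_pow d (0 : ℂ)).mul_const (eval v F.1)
    simpa [show d - 1 ≠ 0 by omega] using this
  refine h1.unique (h2.congr_of_eventuallyEq (Filter.Eventually.of_forall fun s => ?_))
  simp only [h, eval_smul_form]

theorem dirDeriv_eq_zero_of_const (F : MvPolynomial (Fin (N + 1)) ℂ) {x v : Fin (N + 1) → ℂ}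
    (h : ∀ s : ℂ, eval (x + s • v) F = eval x F) : dirDeriv F x v = 0 := by
  have h1 := hasDerivAt_eval_line F x v
  simp only [h] at h1
  exact h1.unique (hasDerivAt_const _ _)

theorem linForm_apply (a x : Fin (N + 1) → ℂ) : linForm a x = a ⬝ᵥ x := by
  simp [linForm, dotProduct]

theorem linForm_coeff (f : Module.Dual ℂ (Fin (N + 1) → ℂ)) :
    linForm (fun i => f (Pi.single i 1)) = f := by
  refine LinearMap.pi_ext' fun i => LinearMap.ext_ring ?_
  simp [linForm, Pi.single_apply]

theorem exists_smul_eq_of_ker_eq {a b : Fin (N + 1) → ℂ} (hb : b ≠ 0)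
    (h : LinearMap.ker (linForm a) = LinearMap.ker (linForm b)) : ∃ k : ℂ, k ≠ 0 ∧ b = k • a := by
  have := mem_span_of_iInf_ker_le_ker (L := fun _ : Unit => linForm a) (K := linForm b)
    (by simp [h])
  rw [Set.range_const, Submodule.mem_span_singleton] at this
  obtain ⟨k, hk⟩ := this
  have hk' : b = k • a := by
    ext i
    have := LinearMap.congr_fun hk (Pi.single i 1)
    simpa [linForm_apply] using this.symm
  refine ⟨k, ?_, hk'⟩
  rintro rfl
  exact hb (by simpa using hk')

theorem exists_ker_linForm_eq {H : Submodule ℂ (Fin (N + 1) → ℂ)} (hH : finrank ℂ H = N) :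
    ∃ a : Fin (N + 1) → ℂ, a ≠ 0 ∧ LinearMap.ker (linForm a) = H := by
  have hlt : H < ⊤ := by
    refine lt_top_iff_ne_top.2 fun h => ?_
    rw [h, finrank_top, finrank_fin_fun] at hH
    omega
  obtain ⟨f, hf, hle⟩ := Submodule.exists_le_ker_of_lt_top H hlt
  refine ⟨fun i => f (Pi.single i 1), fun h => hf ?_, ?_⟩
  · rw [← linForm_coeff f, h]; simp [linForm]
  · rw [linForm_coeff]
    refine (Submodule.eq_of_le_of_finrank_eq hle ?_).symm
    have := Module.Dual.finrank_ker_add_one_of_ne_zero hf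
    rw [finrank_fin_fun] at this
    omega

end Forms

/-! ### Configurations in homogeneous coordinates -/

section RawPredicates

variable {N d e : ℕ}

theorem mem_hyp_iff (R : RawConfig N d e) (i : Fin e) (x : Fin (N + 1) → ℂ) :
    x ∈ (R.toConfig i).hyp ↔ R.eqn i ⬝ᵥ x = 0 := by
  rw [← linForm_apply]; rfl

theorem mem_pt_iff (R : RawConfig N d e) (i : Fin e) (x : Fin (N + 1) → ℂ) :
    x ∈ (R.toConfig i).pt.submodule ↔ ∃ s : ℂ, x = s • R.vec i := by
  change x ∈ (Projectivization.mk ℂ (R.vec i) (R.vec_ne i)).submodule ↔ _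
  rw [Projectivization.submodule_mk, Submodule.mem_span_singleton]
  simp [eq_comm]

theorem cutsOut_iff (R : RawConfig N d e) (i : Fin e) (F : Form N d) :
    CutsOut F (R.toConfig i) ↔
      ∃ k : ℂ, k ≠ 0 ∧ ∀ x, R.eqn i ⬝ᵥ x = 0 → eval x F.1 = k * eval x (R.form i).1 := by
  change (Projectivization.mk ℂ _ (R.restrict_ne i)).submodule = _ ↔ _
  rw [Projectivization.submodule_mk]
  change Submodule.span ℂ {_} =
    Submodule.span ℂ {restrictTo F (LinearMap.ker (linForm (R.eqn i)))} ↔ _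
  rw [Submodule.span_singleton_eq_span_singleton]
  constructor
  · rintro ⟨z, hz⟩
    refine ⟨z, z.ne_zero, fun x hx => ?_⟩
    rw [← linForm_apply] at hx
    have := congrFun (congrArg Subtype.val hz) ⟨x, hx⟩
    exact this.symm
  · rintro ⟨k, hk, h⟩
    refine ⟨Units.mk0 k hk, Subtype.ext (funext fun x => ?_)⟩
    have hx : linForm (R.eqn i) x.1 = 0 := x.2
    rw [linForm_apply] at hx
    exact (h _ hx).symm

/-- The conditions for `Z(f) ∩ {a = 0}` to be a good cone with vertex `p`. -/
def GoodAt (a p : Fin (N + 1) → ℂ) (f : Form N d) : Prop :=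
  (∀ x, a ⬝ᵥ x = 0 → ∀ s : ℂ, eval (x + s • p) f.1 = eval x f.1) ∧
  ∀ x, a ⬝ᵥ x = 0 → (∀ s : ℂ, x ≠ s • p) → eval x f.1 = 0 →
    ∃ v, a ⬝ᵥ v = 0 ∧ dirDeriv f.1 x v ≠ 0

/-- Both conditions test the form only at points and in directions of the hyperplane, so its values
there, up to a scalar, are all that matters. -/
theorem GoodAt.congr {a p : Fin (N + 1) → ℂ} {f g : Form N d} (h : GoodAt a p f)
    (hp : a ⬝ᵥ p = 0) {k : ℂ} (hk : k ≠ 0)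
    (hg : ∀ x, a ⬝ᵥ x = 0 → eval x g.1 = k * eval x f.1) : GoodAt a p g := by
  refine ⟨fun x hx s => ?_, fun x hx hxp h0 => ?_⟩
  · rw [hg x hx, hg _ (by simp [dotProduct_add, hx, hp]), h.1 x hx]
  · rw [hg x hx] at h0
    obtain ⟨v, hv, hne⟩ := h.2 x hx hxp ((mul_eq_zero.1 h0).resolve_left hk)
    refine ⟨v, hv, ?_⟩
    rw [dirDeriv_eq_of_eval_line (k := k) (G := f.1) (y := x) (w := v)
      fun s => hg _ (by simp [dotProduct_add, hx, hv])]
    exact mul_ne_zero hk hne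

theorem isGood_iff (R : RawConfig N d e) (i : Fin e) :
    (R.toConfig i).IsGood ↔ GoodAt (R.eqn i) (R.vec i) (R.form i) := by
  have hp : R.eqn i ⬝ᵥ R.vec i = 0 := by rw [← linForm_apply]; exact R.incident i
  have key : ∀ F : Form N d, ((∀ x ∈ (R.toConfig i).hyp, ∀ p ∈ (R.toConfig i).pt.submodule,
      MvPolynomial.eval (x + p) F.1 = MvPolynomial.eval x F.1) ∧
    (∀ x ∈ (R.toConfig i).hyp, x ∉ (R.toConfig i).pt.submodule → MvPolynomial.eval x F.1 = 0 →
      ∃ v ∈ (R.toConfig i).hyp, dirDeriv F.1 x v ≠ 0)) ↔ GoodAt (R.eqn i) (R.vec i) F := by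
    intro F
    simp only [mem_hyp_iff, mem_pt_iff, GoodAt, not_exists]
    refine and_congr (forall₂_congr fun x _ => ?_) Iff.rfl
    constructor
    · intro h s
      exact h _ ⟨s, rfl⟩
    · rintro h _ ⟨s, rfl⟩
      exact h s
  constructor
  · rintro ⟨F, hF, h⟩
    obtain ⟨k, hk, hkF⟩ := (cutsOut_iff R i F).1 hF
    refine ((key F).1 h).congr hp (inv_ne_zero hk) fun x hx => ?_
    rw [hkF x hx, inv_mul_cancel_left₀ hk]
  · intro h
    exact ⟨R.form i, (cutsOut_iff R i _).2 ⟨1, one_ne_zero, fun x _ => (one_mul _).symm⟩,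
      (key _).2 h⟩

theorem Triple.ext_of_cutsOut {T T' : Triple N d} (h : T.hyp = T'.hyp) (hp : T.pt = T'.pt)
    {F : Form N d} (hF : CutsOut F T) (hF' : CutsOut F T') : T = T' := by
  obtain ⟨H, hH, P, hP, C⟩ := T
  obtain ⟨H', hH', P', hP', C'⟩ := T'
  obtain rfl : H = H' := h
  obtain rfl : P = P' := hp
  have : C = C' := Projectivization.submodule_injective (hF.trans hF'.symm)
  rw [this]

/-- The fibres of the passage to configurations are larger than orbits under rescaling: a form may
also be changed by anything vanishing on its hyperplane. -/
theorem toConfig_eq_iff (R R' : RawConfig N d e) :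
    R.toConfig = R'.toConfig ↔ ∀ i,
      (∃ k : ℂ, k ≠ 0 ∧ R'.eqn i = k • R.eqn i) ∧ (∃ k : ℂ, k ≠ 0 ∧ R'.vec i = k • R.vec i) ∧
      ∃ k : ℂ, k ≠ 0 ∧ ∀ x, R.eqn i ⬝ᵥ x = 0 → eval x (R'.form i).1 = k * eval x (R.form i).1 := by
  have self : ∀ (R : RawConfig N d e) i, CutsOut (R.form i) (R.toConfig i) := fun R i =>
    (cutsOut_iff R i _).2 ⟨1, one_ne_zero, fun x _ => (one_mul _).symm⟩
  constructor
  · intro h i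
    have hi : R.toConfig i = R'.toConfig i := congrFun h i
    refine ⟨?_, ?_, ?_⟩
    · have hker : LinearMap.ker (linForm (R.eqn i)) = LinearMap.ker (linForm (R'.eqn i)) :=
        congrArg Triple.hyp hi
      exact exists_smul_eq_of_ker_eq (R'.eqn_ne i) hker
    · have := congrArg Triple.pt hi
      change Projectivization.mk ℂ (R.vec i) (R.vec_ne i) =
        Projectivization.mk ℂ (R'.vec i) (R'.vec_ne i) at this
      obtain ⟨k, hk⟩ := (Projectivization.mk_eq_mk_iff ℂ _ _ _ _).1 this.symm
      exact ⟨k, k.ne_zero, hk.symm⟩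
    · exact (cutsOut_iff R i _).1 (hi ▸ self R' i)
  · intro h
    funext i
    obtain ⟨⟨k, hk, hk'⟩, ⟨l, hl, hl'⟩, hF⟩ := h i
    refine Triple.ext_of_cutsOut ?_ ?_ ((cutsOut_iff R i _).2 hF) (self R' i)
    · ext x
      rw [mem_hyp_iff, mem_hyp_iff, hk', smul_dotProduct, smul_eq_mul, mul_eq_zero]
      simp [hk]
    · change Projectivization.mk ℂ (R.vec i) (R.vec_ne i) =
        Projectivization.mk ℂ (R'.vec i) (R'.vec_ne i)
      exact ((Projectivization.mk_eq_mk_iff ℂ _ _ _ _).2 ⟨Units.mk0 l hl, hl'.symm⟩).symm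

theorem rep_mem_submodule {K E : Type*} [Field K] [AddCommGroup E] [Module K E] (P : ℙ K E) :
    P.rep ∈ P.submodule := by
  rw [Projectivization.submodule_eq]
  exact Submodule.mem_span_singleton_self _

theorem toConfig_surjective : Function.Surjective (RawConfig.toConfig (N := N) (d := d) (e := e)) := by
  intro L
  have h1 : ∀ i, ∃ a : Fin (N + 1) → ℂ, a ≠ 0 ∧ LinearMap.ker (linForm a) = (L i).hyp := by
    intro i
    exact exists_ker_linForm_eq (L i).finrank_hyp
  choose a ha hker using h1
  have h2 : ∀ i, ∃ F : Form N d, restrictTo F (L i).hyp = (L i).cone.rep := by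
    intro i
    obtain ⟨F, hF⟩ := (L i).cone.rep.2
    exact ⟨F, Subtype.ext hF⟩
  choose F hF using h2
  have hne : ∀ i, restrictTo (F i) (LinearMap.ker (linForm (a i))) ≠ 0 := by
    intro i
    rw [hker, hF]
    exact (L i).cone.rep_nonzero
  let R : RawConfig N d e := ⟨a, fun i => (L i).pt.rep, F, ha, fun i => (L i).pt.rep_nonzero, by
    intro i
    have : (L i).pt.rep ∈ (L i).hyp := (L i).pt_le (rep_mem_submodule _)
    rw [← hker] at this
    exact this, hne⟩
  refine ⟨R, funext fun i => ?_⟩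
  refine Triple.ext_of_cutsOut (F := F i) (hker i) (Projectivization.mk_rep _)
    ((cutsOut_iff R i _).2 ⟨1, one_ne_zero, fun x _ => (one_mul _).symm⟩) ?_
  rw [CutsOut, hF, Projectivization.submodule_eq]

end RawPredicates

end StarPoints

end

noncomputable section

namespace StarPoints

open Module MvPolynomial Topology
open scoped LinearAlgebra.Projectivization

/-! ### The quotient map from homogeneous coordinates to configurations is open -/

section Quotient

variable {N d e : ℕ}

instance : TopologicalSpace (RawConfig N d e) := RawConfig.zariski N d e

theorem isCoord_raw : IsCoord (RawConfig.coord (N := N) (d := d) (e := e)) := ⟨rfl⟩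

theorem continuous_toConfig : Continuous (RawConfig.toConfig (N := N) (d := d) (e := e)) :=
  continuous_coinduced_rng

theorem RawConfig.ext_fields {R R' : RawConfig N d e} (h1 : ∀ i, R.eqn i = R'.eqn i)
    (h2 : ∀ i, R.vec i = R'.vec i) (h3 : ∀ i, R.form i = R'.form i) : R = R' := by
  obtain ⟨a, p, f, _, _, _, _⟩ := R
  obtain ⟨a', p', f', _, _, _, _⟩ := R'
  obtain rfl : a = a' := funext h1
  obtain rfl : p = p' := funext h2
  obtain rfl : f = f' := funext h3
  rfl

theorem restrictTo_ne_zero_iff (F : Form N d) (a : Fin (N + 1) → ℂ) :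
    restrictTo F (LinearMap.ker (linForm a)) ≠ 0 ↔ ∃ x, a ⬝ᵥ x = 0 ∧ eval x F.1 ≠ 0 := by
  rw [← not_iff_not]
  push Not
  constructor
  · intro h x hx
    rw [← linForm_apply] at hx
    exact congrFun (congrArg Subtype.val h) ⟨x, hx⟩
  · intro h
    refine Subtype.ext (funext fun x => ?_)
    have hx : linForm a x.1 = 0 := x.2
    rw [linForm_apply] at hx
    exact h _ hx

theorem RawConfig.dot_eq_zero (R : RawConfig N d e) (i : Fin e) : R.eqn i ⬝ᵥ R.vec i = 0 := by
  rw [← linForm_apply]; exact R.incident i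

theorem RawConfig.exists_eval_ne (R : RawConfig N d e) (i : Fin e) :
    ∃ x, R.eqn i ⬝ᵥ x = 0 ∧ eval x (R.form i).1 ≠ 0 :=
  (restrictTo_ne_zero_iff _ _).1 (R.restrict_ne i)

theorem eqn_mem_reg (D : Set (RawConfig N d e)) (i : Fin e) (j : Fin (N + 1)) :
    (fun R : RawConfig N d e => R.eqn i j) ∈ Reg RawConfig.coord D :=
  coord_mem_reg RawConfig.coord D (i, .inl j)

theorem vec_mem_reg (D : Set (RawConfig N d e)) (i : Fin e) (j : Fin (N + 1)) :
    (fun R : RawConfig N d e => R.vec i j) ∈ Reg RawConfig.coord D :=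
  coord_mem_reg RawConfig.coord D (i, .inr (.inl j))

theorem coeff_form_mem_reg (D : Set (RawConfig N d e)) (i : Fin e)
    (m : {m : Fin (N + 1) →₀ ℕ // m.degree = d}) :
    (fun R : RawConfig N d e => coeff m.1 (R.form i).1) ∈ Reg RawConfig.coord D :=
  coord_mem_reg RawConfig.coord D (i, .inr (.inr m))

theorem continuous_to_raw {X ι : Type*} [TopologicalSpace X] {c : X → ι → ℂ} (hc : IsCoord c)
    {φ : X → RawConfig N d e}
    (h1 : ∀ i j, (fun x => (φ x).eqn i j) ∈ Reg c Set.univ)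
    (h2 : ∀ i j, (fun x => (φ x).vec i j) ∈ Reg c Set.univ)
    (h3 : ∀ i m, (fun x => coeff m ((φ x).form i).1) ∈ Reg c Set.univ) : Continuous φ := by
  refine hc.continuous_of_reg isCoord_raw ?_
  rintro ⟨i, j | j | m⟩
  · exact h1 i j
  · exact h2 i j
  · exact h3 i m.1

/-- The linear map `x ↦ ⟨a, x⟩ w + ⟨b, w⟩ x - ⟨b, x⟩ w`, which maps `{a = 0}` to `{b = 0}`. -/
def shearMatrix (a b w : Fin (N + 1) → ℂ) : Matrix (Fin (N + 1)) (Fin (N + 1)) ℂ :=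
  Matrix.vecMulVec w a + (b ⬝ᵥ w) • 1 - Matrix.vecMulVec w b

theorem shearMatrix_mulVec (a b w x : Fin (N + 1) → ℂ) :
    (shearMatrix a b w).mulVec x = (a ⬝ᵥ x) • w + (b ⬝ᵥ w) • x - (b ⬝ᵥ x) • w := by
  simp [shearMatrix, Matrix.sub_mulVec, Matrix.add_mulVec, Matrix.vecMulVec_mulVec,
    Matrix.smul_mulVec]

theorem dot_shearMatrix (a b w x : Fin (N + 1) → ℂ) (hx : a ⬝ᵥ x = 0) :
    b ⬝ᵥ (shearMatrix a b w).mulVec x = 0 := by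
  rw [shearMatrix_mulVec, hx]
  simp [dotProduct_sub, mul_comm]

theorem exists_dot_eq_one {a : Fin (N + 1) → ℂ} (ha : a ≠ 0) : ∃ w, a ⬝ᵥ w = 1 := by
  obtain ⟨j, hj⟩ := Function.ne_iff.1 ha
  exact ⟨Pi.single j (a j)⁻¹, by simpa using mul_inv_cancel₀ hj⟩

/-- It suffices that any two points `R₀`, `R₁` of a fibre are connected by a continuous self-map `γ`
over the configuration space with `γ R₀ = R₁`: pulling back a neighbourhood of `R₁` then shows that
the saturation of an open set is open. -/
theorem isOpenMap_toConfig : IsOpenMap (RawConfig.toConfig (N := N) (d := d) (e := e)) := by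
  intro U hU
  refine isOpen_coinduced.2 (isOpen_iff_mem_nhds.2 ?_)
  rintro R₀ ⟨R₁, hR₁, h01⟩
  have h01 := (toConfig_eq_iff R₀ R₁).1 h01.symm
  choose ha hp hf using h01
  choose k hk hka using ha
  choose l hl hlp using hp
  choose n hn hnf using hf
  choose w hw using fun i => exists_dot_eq_one (R₀.eqn_ne i)
  -- The difference `R₁.form i - n i • R₀.form i` vanishes on the hyperplane of `R₀`. The shear
  -- carries the hyperplane of `R` into that of `R₀`, so the transported difference vanishes on the
  -- former. At `R = R₀` the shear is the identity, because `w i` has value 1 under the equation.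
  let γ : RawConfig N d e → RawConfig N d e := fun R =>
    { eqn := fun i => k i • R.eqn i
      vec := fun i => l i • R.vec i
      form := fun i => n i • R.form i +
        comp (R₁.form i - n i • R₀.form i) (shearMatrix (R.eqn i) (R₀.eqn i) (w i))
      eqn_ne := fun i => smul_ne_zero (hk i) (R.eqn_ne i)
      vec_ne := fun i => smul_ne_zero (hl i) (R.vec_ne i)
      incident := fun i => by
        rw [linForm_apply]
        simp [R.dot_eq_zero i]
      restrict_ne := fun i => by
        obtain ⟨x, hx, hne⟩ := R.exists_eval_ne i
        refine (restrictTo_ne_zero_iff _ _).2 ⟨x, by simp [hx], ?_⟩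
        have := hnf i _ (dot_shearMatrix (R.eqn i) (R₀.eqn i) (w i) x hx)
        simp only [Submodule.coe_add, Submodule.coe_smul, map_add, smul_eval, eval_comp,
          Submodule.coe_sub, map_sub, this]
        simpa using ⟨hn i, hne⟩ }
  have hγ : ∀ R, (γ R).toConfig = R.toConfig := fun R => by
    refine ((toConfig_eq_iff R (γ R)).2 fun i => ⟨⟨k i, hk i, rfl⟩, ⟨l i, hl i, rfl⟩,
      n i, hn i, fun x hx => ?_⟩).symm
    have := hnf i _ (dot_shearMatrix (R.eqn i) (R₀.eqn i) (w i) x hx)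
    simp only [γ, Submodule.coe_add, Submodule.coe_smul, map_add, smul_eval, eval_comp,
      Submodule.coe_sub, map_sub, this]
    ring
  have hγ₀ : γ R₀ = R₁ := by
    refine RawConfig.ext_fields (fun i => (hka i).symm) (fun i => (hlp i).symm) fun i => ?_
    refine Form.ext_eval fun x => ?_
    have : (shearMatrix (R₀.eqn i) (R₀.eqn i) (w i)).mulVec x = x := by
      rw [shearMatrix_mulVec, hw]; simp
    simp only [γ, Submodule.coe_add, Submodule.coe_smul, map_add, smul_eval, eval_comp,
      Submodule.coe_sub, map_sub, this]
    ring
  have hcont : Continuous γ := by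
    refine continuous_to_raw isCoord_raw (fun i j => ?_) (fun i j => ?_) fun i m => ?_
    · exact (Reg _ _).smul_mem (eqn_mem_reg _ i j) (k i)
    · exact (Reg _ _).smul_mem (vec_mem_reg _ i j) (l i)
    · have h1 : (fun R : RawConfig N d e => coeff m (n i • R.form i : Form N d).1) ∈
          Reg RawConfig.coord Set.univ := by
        have := (regPoly_form (coeff_form_mem_reg (N := N) (d := d) Set.univ i)).coeff m
        exact (Reg _ _).smul_mem this (n i)
      refine (Reg _ _).add_mem h1 (coeff_comp_mem_reg
        (F := fun _ => R₁.form i - n i • R₀.form i) (fun m => const_mem_reg _ _ _) ?_ m)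
      intro r s
      have := (Reg RawConfig.coord Set.univ).smul_mem
        (eqn_mem_reg (N := N) (d := d) (e := e) Set.univ i s) (w i r)
      have := (Reg _ _).add_mem this (const_mem_reg RawConfig.coord Set.univ
        ((((R₀.eqn i ⬝ᵥ w i) • 1 : Matrix (Fin (N + 1)) (Fin (N + 1)) ℂ) -
          Matrix.vecMulVec (w i) (R₀.eqn i)) r s))
      convert this using 1
      funext R
      simp [shearMatrix, Matrix.vecMulVec_apply]
      ring
  refine Filter.mem_of_superset (hcont.continuousAt.preimage_mem_nhds
    (hU.mem_nhds (by rw [hγ₀]; exact hR₁))) fun R hR => ⟨γ R, hR, hγ R⟩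

end Quotient

end StarPoints

end

noncomputable section

namespace StarPoints

open Module MvPolynomial Topology
open scoped LinearAlgebra.Projectivization

/-! ### Forms with prescribed coefficients -/

section Coefficients

variable {N d : ℕ}

/-- The monomials of degree `d`. -/
def monos (N d : ℕ) : Finset (Fin (N + 1) →₀ ℕ) := Finset.univ.finsuppAntidiag d

theorem mem_monos {m : Fin (N + 1) →₀ ℕ} : m ∈ monos N d ↔ m.degree = d := by
  rw [monos, Finset.mem_finsuppAntidiag, Finsupp.degree_eq_sum]
  simp

/-- The form of degree `d` with the given coefficients. -/
def ofCoeff (d : ℕ) (c : (Fin (N + 1) →₀ ℕ) → ℂ) : Form N d :=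
  ⟨∑ m ∈ monos N d, monomial m (c m), by
    refine Submodule.sum_mem _ fun m hm => ?_
    exact isHomogeneous_monomial _ (mem_monos.1 hm)⟩

theorem coeff_ofCoeff (c : (Fin (N + 1) →₀ ℕ) → ℂ) {m : Fin (N + 1) →₀ ℕ} (hm : m.degree = d) :
    coeff m (ofCoeff d c).1 = c m := by
  classical
  simp [ofCoeff, coeff_sum, coeff_monomial, mem_monos, hm]

theorem coeff_eq_zero_of_degree_ne (F : Form N d) {m : Fin (N + 1) →₀ ℕ} (hm : m.degree ≠ d) :
    coeff m F.1 = 0 := by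
  by_contra h
  exact hm (degree_eq_of_mem_support F (mem_support_iff.2 h))

theorem Form.ext_coeff {F G : Form N d} (h : ∀ m, m.degree = d → coeff m F.1 = coeff m G.1) :
    F = G := by
  refine Subtype.ext (MvPolynomial.ext _ _ fun m => ?_)
  by_cases hm : m.degree = d
  · exact h m hm
  · rw [coeff_eq_zero_of_degree_ne F hm, coeff_eq_zero_of_degree_ne G hm]

theorem ofCoeff_coeff (F : Form N d) : ofCoeff d (fun m => coeff m F.1) = F :=
  Form.ext_coeff fun _ hm => coeff_ofCoeff _ hm

theorem eval_ofCoeff (c : (Fin (N + 1) →₀ ℕ) → ℂ) (x : Fin (N + 1) → ℂ) :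
    eval x (ofCoeff d c).1 = ∑ m ∈ monos N d, c m * ∏ i, x i ^ m i := by
  simp only [ofCoeff, map_sum, eval_monomial]
  refine Finset.sum_congr rfl fun m _ => ?_
  rw [Finsupp.prod_fintype _ _ (by simp)]

theorem eval_form (F : Form N d) (x : Fin (N + 1) → ℂ) :
    eval x F.1 = ∑ m ∈ monos N d, coeff m F.1 * ∏ i, x i ^ m i := by
  rw [← eval_ofCoeff (d := d), ofCoeff_coeff]

open Classical in
/-- The part of `F` formed by the monomials not involving the variables in `Z`. -/
def dropVars (Z : Set (Fin (N + 1))) (F : Form N d) : Form N d :=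
  ofCoeff d fun m => if ∀ i ∈ Z, m i = 0 then coeff m F.1 else 0

open Classical in
theorem eval_dropVars (Z : Set (Fin (N + 1))) (F : Form N d) (x : Fin (N + 1) → ℂ) :
    eval x (dropVars Z F).1 = eval (fun i => if i ∈ Z then 0 else x i) F.1 := by
  rw [dropVars, eval_ofCoeff, eval_form]
  refine Finset.sum_congr rfl fun m _ => ?_
  split_ifs with h
  · congr 1
    refine Finset.prod_congr rfl fun i _ => ?_
    by_cases hi : i ∈ Z
    · simp [h i hi]
    · simp [hi]
  · push Not at h
    obtain ⟨i, hi, hne⟩ := h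
    rw [zero_mul]
    exact (mul_eq_zero_of_right _ (Finset.prod_eq_zero (Finset.mem_univ i)
      (by simp [hi, hne]))).symm

theorem eval_eq_of_coeff_eq {F G : Form N d} {r : Fin (N + 1)}
    (h : ∀ m, m r = 0 → coeff m F.1 = coeff m G.1) {x : Fin (N + 1) → ℂ} (hx : x r = 0) :
    eval x F.1 = eval x G.1 := by
  rw [eval_form, eval_form]
  refine Finset.sum_congr rfl fun m _ => ?_
  by_cases hm : m r = 0
  · rw [h m hm]
  · rw [Finset.prod_eq_zero (Finset.mem_univ r) (by simp [hx, hm])]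
    simp

/-- Substituting zero for the variable turns agreement on the hyperplane into agreement everywhere
of the parts free of that variable. -/
theorem coeff_eq_of_eval_eq {F G : Form N d} {r : Fin (N + 1)}
    (h : ∀ x, x r = 0 → eval x F.1 = eval x G.1) {m : Fin (N + 1) →₀ ℕ} (hm : m r = 0) :
    coeff m F.1 = coeff m G.1 := by
  by_cases hd : m.degree = d
  · have key : dropVars {r} F = dropVars {r} G := Form.ext_eval fun x => by
      rw [eval_dropVars, eval_dropVars]
      exact h _ (by simp)
    have := congrArg (fun H : Form N d => coeff m H.1) key
    simpa [dropVars, coeff_ofCoeff _ hd, hm] using this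
  · rw [coeff_eq_zero_of_degree_ne F hd, coeff_eq_zero_of_degree_ne G hd]

/-- On `x r = 0` the translation invariance allows `x t` to be replaced by zero. Hence the part of
`F` free of the variable `r` is already free of the variable `t`. -/
theorem coeff_eq_zero_of_invariant {F : Form N d} {r t : Fin (N + 1)} (hrt : r ≠ t)
    (h : ∀ x, x r = 0 → ∀ s : ℂ, eval (x + s • Pi.single t 1) F.1 = eval x F.1)
    {m : Fin (N + 1) →₀ ℕ} (hr : m r = 0) (ht : m t ≠ 0) : coeff m F.1 = 0 := by
  classical
  by_cases hd : m.degree = d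
  · have key : dropVars {r} F = dropVars {r, t} F := Form.ext_eval fun x => by
      rw [eval_dropVars, eval_dropVars]
      refine Eq.trans ?_ (h _ (by simp) (x t))
      congr 2
      funext i
      by_cases hi : i = r
      · subst hi; simp [hrt]
      · by_cases hi' : i = t
        · subst hi'; simp [hi]
        · simp [hi, hi']
    have := congrArg (fun H : Form N d => coeff m H.1) key
    simpa [dropVars, coeff_ofCoeff _ hd, hr, ht] using this
  · exact coeff_eq_zero_of_degree_ne F hd

end Coefficients

/-! ### Configurations in standard position -/

section Standard

variable {N d : ℕ}

/-- A combinatorial type of position: in suitable coordinates `Π_i = {x_{ρ i} = 0}` and `P_i` is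
the coordinate point with index `σ i`. -/
structure Pos (N : ℕ) where
  ρ : Fin 2 → Fin (N + 1)
  σ : Fin 2 → Fin (N + 1)
  ρ_inj : Function.Injective ρ
  σ_inj : Function.Injective σ
  ne : ∀ i, ρ i ≠ σ i

/-- The monomials `m` that may occur in the equation of a realization in standard position. -/
def Pos.Allowed (S : Pos N) (m : Fin (N + 1) →₀ ℕ) : Prop :=
  (∃ i, m (S.ρ i) = 0) ∧ ∀ i, m (S.ρ i) = 0 → m (S.σ i) = 0

/-- Forms all of whose monomials are allowed. -/
def Pos.Adapted (S : Pos N) (F : Form N d) : Prop :=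
  ∀ m, coeff m F.1 ≠ 0 → S.Allowed m

/-- The adapted forms that define good cones in `Π_0` and `Π_1`. -/
structure Pos.StdGood (S : Pos N) (F : Form N d) : Prop where
  adapted : S.Adapted F
  smooth : ∀ i x, x (S.ρ i) = 0 → (∀ s : ℂ, x ≠ s • Pi.single (S.σ i) 1) → eval x F.1 = 0 →
    ∃ v : Fin (N + 1) → ℂ, v (S.ρ i) = 0 ∧ dirDeriv F.1 x v ≠ 0
  nonzero : ∀ i, ∃ x : Fin (N + 1) → ℂ, x (S.ρ i) = 0 ∧ eval x F.1 ≠ 0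

/-- A monomial that survives on the hyperplane does not involve the variable being translated. -/
theorem Pos.Adapted.invariant {S : Pos N} {F : Form N d} (h : S.Adapted F) (i : Fin 2)
    {x : Fin (N + 1) → ℂ} (hx : x (S.ρ i) = 0) (s : ℂ) :
    eval (x + s • Pi.single (S.σ i) 1) F.1 = eval x F.1 := by
  rw [eval_form, eval_form]
  refine Finset.sum_congr rfl fun m _ => ?_
  by_cases h0 : coeff m F.1 = 0
  · simp [h0]
  congr 1
  by_cases hm : m (S.ρ i) = 0
  · refine Finset.prod_congr rfl fun j _ => ?_
    by_cases hj : j = S.σ i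
    · subst hj
      rw [(h m h0).2 i hm]; simp
    · simp [hj]
  · rw [Finset.prod_eq_zero (Finset.mem_univ (S.ρ i)) (by simp [hx, hm, S.ne i]),
      Finset.prod_eq_zero (Finset.mem_univ (S.ρ i)) (by simp [hx, hm])]

/-- A linear coordinate change together with an adapted form defining good cones. -/
structure Frame (S : Pos N) (d : ℕ) where
  h : Matrix (Fin (N + 1)) (Fin (N + 1)) ℂ
  F : Form N d
  unit : IsUnit h.det
  good : S.StdGood F

/-- The configuration given by a frame. -/
def Frame.conf {S : Pos N} (D : Frame S d) : RawConfig N d 2 where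
  eqn i := D.h (S.ρ i)
  vec i := fun r => D.h⁻¹ r (S.σ i)
  form _ := comp D.F D.h
  eqn_ne i h0 := by
    have := congrFun (congrFun (Matrix.mul_nonsing_inv _ D.unit) (S.ρ i)) (S.ρ i)
    rw [Matrix.mul_apply, h0] at this
    simp at this
  vec_ne i h0 := by
    have := congrFun (congrFun (Matrix.mul_nonsing_inv _ D.unit) (S.σ i)) (S.σ i)
    rw [Matrix.mul_apply] at this
    simp [fun r => (congrFun h0 r : D.h⁻¹ r (S.σ i) = 0)] at this
  incident i := by
    rw [linForm_apply]
    have := congrFun (congrFun (Matrix.mul_nonsing_inv _ D.unit) (S.ρ i)) (S.σ i)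
    rw [Matrix.mul_apply, Matrix.one_apply_ne (S.ne i)] at this
    exact this
  restrict_ne i := by
    obtain ⟨x, hx, hne⟩ := D.good.nonzero i
    refine (restrictTo_ne_zero_iff _ _).2 ⟨D.h⁻¹.mulVec x, ?_, ?_⟩
    · change D.h.mulVec (D.h⁻¹.mulVec x) (S.ρ i) = 0
      rw [Matrix.mulVec_mulVec, Matrix.mul_nonsing_inv _ D.unit, Matrix.one_mulVec, hx]
    · rw [eval_comp, Matrix.mulVec_mulVec, Matrix.mul_nonsing_inv _ D.unit, Matrix.one_mulVec]
      exact hne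

theorem Frame.conf_eqn_dot {S : Pos N} (D : Frame S d) (i : Fin 2) (x : Fin (N + 1) → ℂ) :
    D.conf.eqn i ⬝ᵥ x = D.h.mulVec x (S.ρ i) := rfl

theorem Frame.mulVec_conf_vec {S : Pos N} (D : Frame S d) (i : Fin 2) :
    D.h.mulVec (D.conf.vec i) = Pi.single (S.σ i) 1 := by
  have : D.conf.vec i = D.h⁻¹.mulVec (Pi.single (S.σ i) 1) := by
    funext r; simp [Frame.conf]
  rw [this, Matrix.mulVec_mulVec, Matrix.mul_nonsing_inv _ D.unit, Matrix.one_mulVec]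

theorem Frame.goodAt {S : Pos N} (D : Frame S d) (i : Fin 2) :
    GoodAt (D.conf.eqn i) (D.conf.vec i) (D.conf.form i) := by
  refine ⟨fun x hx s => ?_, fun x hx hxp h0 => ?_⟩
  · rw [D.conf_eqn_dot] at hx
    change eval _ (comp D.F D.h).1 = eval _ (comp D.F D.h).1
    rw [eval_comp, eval_comp, Matrix.mulVec_add, Matrix.mulVec_smul, D.mulVec_conf_vec,
      D.good.adapted.invariant i hx]
  · rw [D.conf_eqn_dot] at hx
    change eval _ (comp D.F D.h).1 = 0 at h0
    rw [eval_comp] at h0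
    have hinv : ∀ y, D.h⁻¹.mulVec (D.h.mulVec y) = y := fun y => by
      rw [Matrix.mulVec_mulVec, Matrix.nonsing_inv_mul _ D.unit, Matrix.one_mulVec]
    have hinv' : ∀ y, D.h.mulVec (D.h⁻¹.mulVec y) = y := fun y => by
      rw [Matrix.mulVec_mulVec, Matrix.mul_nonsing_inv _ D.unit, Matrix.one_mulVec]
    obtain ⟨v, hv, hne⟩ := D.good.smooth i _ hx (fun s hs => hxp s (by
      rw [← hinv x, hs, ← D.mulVec_conf_vec i, ← Matrix.mulVec_smul, hinv])) h0
    refine ⟨D.h⁻¹.mulVec v, ?_, ?_⟩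
    · rw [D.conf_eqn_dot, hinv', hv]
    · change dirDeriv (comp D.F D.h).1 _ _ ≠ 0
      rw [dirDeriv_comp, hinv']
      exact hne

theorem Frame.cutsOut_comp {S : Pos N} (D : Frame S d) (G : Form N d)
    (hG : ∀ i (x : Fin (N + 1) → ℂ), x (S.ρ i) = 0 → eval x G.1 = eval x D.F.1) (i : Fin 2) :
    CutsOut (comp G D.h) (D.conf.toConfig i) := by
  refine (cutsOut_iff _ i _).2 ⟨1, one_ne_zero, fun x hx => ?_⟩
  rw [D.conf_eqn_dot] at hx
  change _ = 1 * eval x (comp D.F D.h).1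
  rw [one_mul, eval_comp, eval_comp, hG i _ hx]

theorem Frame.realizes {S : Pos N} (D : Frame S d) : Realizes (comp D.F D.h) D.conf.toConfig :=
  D.cutsOut_comp D.F fun _ _ _ => rfl

/-- A realized configuration of good cones in position `S` comes from a frame. -/
theorem exists_frame (S : Pos N) (R : RawConfig N d 2)
    (hgood : ∀ i, GoodAt (R.eqn i) (R.vec i) (R.form i)) {F : Form N d}
    (hF : Realizes F R.toConfig) {h : Matrix (Fin (N + 1)) (Fin (N + 1)) ℂ} (hh : IsUnit h.det)
    (ha : ∀ i, ∃ k : ℂ, k ≠ 0 ∧ R.eqn i = k • h (S.ρ i))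
    (hp : ∀ i, ∃ k : ℂ, k ≠ 0 ∧ h.mulVec (R.vec i) = k • Pi.single (S.σ i) 1) :
    ∃ D : Frame S d, D.h = h ∧ D.conf.toConfig = R.toConfig := by
  classical
  have hinv : ∀ y, h⁻¹.mulVec (h.mulVec y) = y := fun y => by
    rw [Matrix.mulVec_mulVec, Matrix.nonsing_inv_mul _ hh, Matrix.one_mulVec]
  have hinv' : ∀ y, h.mulVec (h⁻¹.mulVec y) = y := fun y => by
    rw [Matrix.mulVec_mulVec, Matrix.mul_nonsing_inv _ hh, Matrix.one_mulVec]
  have hF' := fun i => (cutsOut_iff R i F).1 (hF i)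
  have hgF : ∀ i, GoodAt (R.eqn i) (R.vec i) F := fun i => by
    obtain ⟨k, hk, hkF⟩ := hF' i
    exact (hgood i).congr (R.dot_eq_zero i) hk hkF
  have hdot : ∀ i x, R.eqn i ⬝ᵥ x = 0 ↔ h.mulVec x (S.ρ i) = 0 := fun i x => by
    obtain ⟨k, hk, hka⟩ := ha i
    rw [hka, smul_dotProduct, smul_eq_mul, mul_eq_zero]
    simp only [hk, false_or]
    rfl
  have hdot' : ∀ i x, R.eqn i ⬝ᵥ h⁻¹.mulVec x = 0 ↔ x (S.ρ i) = 0 := fun i x => by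
    rw [hdot, hinv']
  let F₁ : Form N d := comp F h⁻¹
  have hinvF₁ : ∀ i x, x (S.ρ i) = 0 → ∀ s : ℂ,
      eval (x + s • Pi.single (S.σ i) 1) F₁.1 = eval x F₁.1 := fun i x hx s => by
    obtain ⟨k, hk, hkp⟩ := hp i
    have : h⁻¹.mulVec (Pi.single (S.σ i) 1) = k⁻¹ • R.vec i := by
      rw [← hinv (R.vec i), hkp, Matrix.mulVec_smul, smul_smul, inv_mul_cancel₀ hk, one_smul]
    simp only [F₁, eval_comp, Matrix.mulVec_add, Matrix.mulVec_smul, this, smul_smul]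
    exact (hgF i).1 _ ((hdot' i x).2 hx) _
  -- A forbidden monomial either involves both `ρ`-variables, so that dropping it changes neither
  -- restriction, or has coefficient zero by the cone condition. Hence `F₂` and `F₁` agree on both
  -- hyperplanes.
  let F₂ : Form N d := ofCoeff d fun m => if S.Allowed m then coeff m F₁.1 else 0
  have hF₂ : ∀ i x, x (S.ρ i) = 0 → eval x F₂.1 = eval x F₁.1 := fun i x hx => by
    refine eval_eq_of_coeff_eq (fun m hm => ?_) hx
    by_cases hdeg : m.degree = d
    · rw [coeff_ofCoeff _ hdeg]
      split_ifs with hal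
      · rfl
      · have : ∃ j, m (S.ρ j) = 0 ∧ m (S.σ j) ≠ 0 := by
          by_contra! hcon
          exact hal ⟨⟨i, hm⟩, hcon⟩
        obtain ⟨j, hj, hj'⟩ := this
        exact (coeff_eq_zero_of_invariant (S.ne j) (hinvF₁ j) hj hj').symm
    · rw [coeff_eq_zero_of_degree_ne _ hdeg, coeff_eq_zero_of_degree_ne _ hdeg]
  have hgood₂ : S.StdGood F₂ := by
    refine ⟨fun m hm => ?_, fun i x hx hxp h0 => ?_, fun i => ?_⟩
    · by_contra hal
      apply hm
      by_cases hdeg : m.degree = d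
      · rw [coeff_ofCoeff _ hdeg, if_neg hal]
      · exact coeff_eq_zero_of_degree_ne _ hdeg
    · rw [hF₂ i x hx, eval_comp] at h0
      obtain ⟨v, hv, hne⟩ := (hgF i).2 _ ((hdot' i x).2 hx) (fun s hs => by
        obtain ⟨k, hk, hkp⟩ := hp i
        apply hxp (s * k)
        rw [← hinv' x, hs, Matrix.mulVec_smul, hkp, smul_smul]) h0
      refine ⟨h.mulVec v, (hdot i v).1 hv, ?_⟩
      have : dirDeriv F₂.1 x (h.mulVec v) = 1 * dirDeriv F₁.1 x (h.mulVec v) := by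
        refine dirDeriv_eq_of_eval_line fun s => ?_
        rw [one_mul]
        exact hF₂ i _ (by simp [hx, (hdot i v).1 hv])
      rw [this, one_mul, dirDeriv_comp, hinv]
      exact hne
    · obtain ⟨x, hx, hne⟩ := R.exists_eval_ne i
      obtain ⟨k, hk, hkF⟩ := hF' i
      refine ⟨h.mulVec x, (hdot i x).1 hx, ?_⟩
      rw [hF₂ i _ ((hdot i x).1 hx), eval_comp, hinv, hkF x hx]
      exact mul_ne_zero hk hne
  refine ⟨⟨h, F₂, hh, hgood₂⟩, rfl, ?_⟩
  refine ((toConfig_eq_iff _ _).2 fun i => ⟨?_, ?_, ?_⟩).symm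
  · obtain ⟨k, hk, hka⟩ := ha i
    refine ⟨k⁻¹, inv_ne_zero hk, ?_⟩
    rw [hka, smul_smul, inv_mul_cancel₀ hk, one_smul]
    rfl
  · obtain ⟨k, hk, hkp⟩ := hp i
    refine ⟨k⁻¹, inv_ne_zero hk, ?_⟩
    rw [← hinv (R.vec i), hkp, Matrix.mulVec_smul, smul_smul, inv_mul_cancel₀ hk, one_smul]
    funext r
    simp [Frame.conf]
  · obtain ⟨k, hk, hkF⟩ := hF' i
    refine ⟨k, hk, fun x hx => ?_⟩
    change eval x (comp F₂ h).1 = _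
    rw [eval_comp, hF₂ i _ ((hdot i x).1 hx), eval_comp, hinv, hkF x hx]

end Standard

end StarPoints

end

noncomputable section

namespace StarPoints

open Module MvPolynomial Topology
open scoped LinearAlgebra.Projectivization

/-! ### Linear algebra: normalizing biorthogonal families -/

section LinearAlgebra

variable {N : ℕ}

/-- The space splits as the span of the `w j` plus the common kernel of the `l j`. Send `w j` to the
coordinate vector of index `τ j`, and the kernel to the corresponding coordinate subspace by an
arbitrary isomorphism, which exists because the dimensions agree. -/
theorem exists_matrix_of_biorthogonal {J : Type*} [Fintype J] [DecidableEq J]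
    (l w : J → Fin (N + 1) → ℂ) (hlw : ∀ j k, l j ⬝ᵥ w k = if j = k then 1 else 0)
    {τ : J → Fin (N + 1)} (hτ : Function.Injective τ) :
    ∃ h : Matrix (Fin (N + 1)) (Fin (N + 1)) ℂ, IsUnit h.det ∧
      ∀ j, h (τ j) = l j ∧ h.mulVec (w j) = Pi.single (τ j) 1 := by
  let Φ : (Fin (N + 1) → ℂ) →ₗ[ℂ] (J → ℂ) := LinearMap.pi fun j => linForm (l j)
  let Φ₀ : (Fin (N + 1) → ℂ) →ₗ[ℂ] (J → ℂ) := LinearMap.pi fun j => LinearMap.proj (τ j)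
  have hΦ : ∀ x j, Φ x j = l j ⬝ᵥ x := fun x j => linForm_apply _ _
  have hΦw : ∀ j k, Φ (w k) j = if j = k then 1 else 0 := fun j k => by rw [hΦ, hlw]
  have hsurj : LinearMap.range Φ = ⊤ := LinearMap.range_eq_top.2 fun y => by
    refine ⟨∑ k, y k • w k, funext fun j => ?_⟩
    simp [map_sum, hΦw]
  have hsurj₀ : LinearMap.range Φ₀ = ⊤ := LinearMap.range_eq_top.2 fun y => by
    refine ⟨∑ k, y k • Pi.single (τ k) 1, funext fun j => ?_⟩
    simp [Φ₀, Pi.single_apply, hτ.eq_iff]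
  have hfin : finrank ℂ (LinearMap.ker Φ) = finrank ℂ (LinearMap.ker Φ₀) := by
    have h1 := Φ.finrank_range_add_finrank_ker
    have h2 := Φ₀.finrank_range_add_finrank_ker
    rw [hsurj] at h1
    rw [hsurj₀] at h2
    omega
  let e := LinearEquiv.ofFinrankEq _ _ hfin
  let κ₀ : (Fin (N + 1) → ℂ) →ₗ[ℂ] (Fin (N + 1) → ℂ) :=
    LinearMap.id - ∑ k, (linForm (l k)).smulRight (w k)
  have hκ₀ : ∀ x, κ₀ x = x - ∑ k, (l k ⬝ᵥ x) • w k := fun x => by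
    simp [κ₀, linForm_apply]
  let κ : (Fin (N + 1) → ℂ) →ₗ[ℂ] LinearMap.ker Φ := κ₀.codRestrict _ fun x => by
    rw [LinearMap.mem_ker, hκ₀]
    funext j
    rw [map_sub, map_sum]
    simp [hΦw, hΦ]
  let H : (Fin (N + 1) → ℂ) →ₗ[ℂ] (Fin (N + 1) → ℂ) :=
    ∑ k, (linForm (l k)).smulRight (Pi.single (τ k) 1) +
      (LinearMap.ker Φ₀).subtype ∘ₗ e.toLinearMap ∘ₗ κ
  have hHτ : ∀ x j, H x (τ j) = l j ⬝ᵥ x := fun x j => by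
    have h0 : (e (κ x)).1 (τ j) = 0 := congrFun (e (κ x)).2 j
    simp [H, linForm_apply, Pi.single_apply, hτ.eq_iff, h0]
  have hHw : ∀ j, H (w j) = Pi.single (τ j) 1 := fun j => by
    have h0 : κ (w j) = 0 := Subtype.ext (by
      change κ₀ (w j) = 0
      rw [hκ₀]; simp [hlw])
    simp [H, linForm_apply, h0, hlw]
  have hinj : Function.Injective H := by
    rw [← LinearMap.ker_eq_bot, LinearMap.ker_eq_bot']
    intro x hx
    have h1 : ∀ j, l j ⬝ᵥ x = 0 := fun j => by rw [← hHτ, hx]; rfl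
    have h2 : H x = (e (κ x)).1 := by simp [H, linForm_apply, h1]
    rw [hx] at h2
    have h3 : κ x = 0 := by
      apply e.injective
      rw [map_zero]
      exact Subtype.ext h2.symm
    have h4 : κ₀ x = 0 := congrArg Subtype.val h3
    rw [hκ₀] at h4
    simpa [h1] using h4
  have hmul : ∀ x, (LinearMap.toMatrix' H).mulVec x = H x := fun x => by
    rw [LinearMap.toMatrix'_mulVec]
  refine ⟨LinearMap.toMatrix' H, ?_, fun j => ⟨?_, ?_⟩⟩
  · rw [← Matrix.isUnit_iff_isUnit_det, ← Matrix.mulVec_injective_iff_isUnit]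
    intro x y hxy
    exact hinj (by simpa [hmul] using hxy)
  · funext k
    have := hHτ (Pi.single k 1) j
    rw [← hmul] at this
    simpa using this
  · rw [hmul, hHw]

theorem exists_dual_pair {p : Fin 2 → Fin (N + 1) → ℂ} (hp : LinearIndependent ℂ p) :
    ∃ ξ : Fin 2 → Fin (N + 1) → ℂ, ∀ i j, ξ i ⬝ᵥ p j = if i = j then 1 else 0 := by
  obtain ⟨g, hg⟩ := LinearMap.exists_leftInverse_of_injective (Fintype.linearCombination ℂ p)
    (LinearMap.ker_eq_bot.2 (linearIndependent_iff_injective_fintypeLinearCombination.1 hp))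
  refine ⟨fun i k => g (Pi.single k 1) i, fun i j => ?_⟩
  have h1 := linForm_coeff ((LinearMap.proj i).comp g)
  rw [← linForm_apply]
  have h2 := LinearMap.congr_fun h1 (p j)
  have h3 := congrFun (LinearMap.congr_fun hg (Pi.single j 1)) i
  simp [Fintype.linearCombination_apply, Pi.single_apply, ite_smul] at h3
  rw [← h3]
  exact h2

theorem linearIndependent_of_forall_ne {p : Fin 2 → Fin (N + 1) → ℂ} (h0 : p 0 ≠ 0)
    (h : ∀ s : ℂ, p 1 ≠ s • p 0) : LinearIndependent ℂ p := by
  have : p = ![p 0, p 1] := by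
    funext i; fin_cases i <;> rfl
  rw [this, LinearIndependent.pair_iff' h0]
  exact fun a ha => h a ha.symm

end LinearAlgebra

/-! ### The two positions of suited pairs -/

section Positions

variable {N d : ℕ}

theorem pt_le_hyp_iff (R : RawConfig N d 2) (i j : Fin 2) :
    (R.toConfig i).pt.submodule ≤ (R.toConfig j).hyp ↔ R.eqn j ⬝ᵥ R.vec i = 0 := by
  rw [← mem_hyp_iff]
  constructor
  · intro h
    exact h ((mem_pt_iff R i _).2 ⟨1, (one_smul _ _).symm⟩)
  · intro h x hx
    obtain ⟨s, rfl⟩ := (mem_pt_iff R i x).1 hx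
    exact Submodule.smul_mem _ s h

theorem pt_ne_iff (R : RawConfig N d 2) (i j : Fin 2) :
    (R.toConfig i).pt ≠ (R.toConfig j).pt ↔ ∀ s : ℂ, R.vec i ≠ s • R.vec j := by
  change Projectivization.mk ℂ (R.vec i) (R.vec_ne i) ≠
    Projectivization.mk ℂ (R.vec j) (R.vec_ne j) ↔ _
  rw [ne_eq, Projectivization.mk_eq_mk_iff', not_exists]
  exact forall_congr' fun s => by rw [eq_comm]

/-- Restatement of suitedness in homogeneous coordinates. -/
theorem mem_suited_iff (R : RawConfig N d 2) :
    R.toConfig ∈ suitedConfigs N d 2 ↔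
      (∀ i, GoodAt (R.eqn i) (R.vec i) (R.form i)) ∧
      (∀ i j, i ≠ j → ∀ s : ℂ, R.vec i ≠ s • R.vec j) ∧
      ∃ F : Form N d, Realizes F R.toConfig := by
  refine and_congr (forall_congr' fun i => isGood_iff R i) (and_congr ?_ Iff.rfl)
  exact forall₃_congr fun i j _ => pt_ne_iff R i j

theorem mem_general_iff (R : RawConfig N d 2) :
    R.toConfig ∈ generalConfigs N d 2 ↔
      (∀ i, GoodAt (R.eqn i) (R.vec i) (R.form i)) ∧
      ∀ i j, i ≠ j → R.eqn j ⬝ᵥ R.vec i ≠ 0 := by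
  refine and_congr (forall_congr' fun i => isGood_iff R i) ?_
  exact forall₃_congr fun i j _ => not_congr (pt_le_hyp_iff R i j)

theorem goodAt_of_realizes {R : RawConfig N d 2}
    (h : ∀ i, GoodAt (R.eqn i) (R.vec i) (R.form i)) {F : Form N d}
    (hF : Realizes F R.toConfig) (i : Fin 2) : GoodAt (R.eqn i) (R.vec i) F := by
  obtain ⟨k, hk, hkF⟩ := (cutsOut_iff R i F).1 (hF i)
  exact (h i).congr (R.dot_eq_zero i) hk hkF

theorem GoodAt.eval_vertex {a p : Fin (N + 1) → ℂ} {F : Form N d} (h : GoodAt a p F)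
    (hd : d ≠ 0) (s : ℂ) : eval (s • p) F.1 = 0 := by
  have h1 := h.1 0 (by simp) s
  have h2 := eval_smul_form F 0 0
  rw [zero_smul, zero_pow hd, zero_mul] at h2
  rw [zero_add] at h1
  rw [h1, h2]

/-- A cone of degree at least 2 is singular at its vertex. -/
theorem GoodAt.dirDeriv_vertex {a p : Fin (N + 1) → ℂ} {F : Form N d} (h : GoodAt a p F)
    (hd : 2 ≤ d) {v : Fin (N + 1) → ℂ} (hv : a ⬝ᵥ v = 0) (s : ℂ) : dirDeriv F.1 (s • p) v = 0 := by
  refine dirDeriv_eq_zero_of_cone F hd fun t => ?_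
  rw [add_comm (s • p)]
  exact h.1 _ (by simp [hv]) s

/-- Two good cones cut out by the same hypersurface lie in different hyperplanes. -/
theorem eqn_ne_smul (hd : 2 ≤ d) {R : RawConfig N d 2} {F : Form N d} {i j : Fin 2}
    (hi : GoodAt (R.eqn i) (R.vec i) F) (hj : GoodAt (R.eqn j) (R.vec j) F)
    (hp : ∀ s : ℂ, R.vec j ≠ s • R.vec i) (k : ℂ) : R.eqn j ≠ k • R.eqn i := by
  intro hk
  have hk0 : k ≠ 0 := by
    rintro rfl
    exact R.eqn_ne j (by simpa using hk)
  have hiff : ∀ x, R.eqn j ⬝ᵥ x = 0 ↔ R.eqn i ⬝ᵥ x = 0 := fun x => by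
    rw [hk, smul_dotProduct, smul_eq_mul, mul_eq_zero]
    simp [hk0]
  have h0 := hj.eval_vertex (by omega) 1
  rw [one_smul] at h0
  -- With equal hyperplanes, the vertex of the second cone is a point of the first one off its own
  -- vertex, so it would be both a smooth and a singular point.
  obtain ⟨v, hv, hne⟩ := hi.2 (R.vec j) ((hiff _).1 (R.dot_eq_zero j)) hp h0
  apply hne
  simpa using hj.dirDeriv_vertex hd ((hiff _).2 hv) 1

/-- The vertex `P_i` is then a smooth point of `C_j`. If `P_j` were off `Π_i`, every direction would
be the sum of one in `Π_i`, along which `dF` vanishes at the vertex `P_i`, and a multiple of `P_j`,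
along which `F` is constant. -/
theorem dot_eq_zero_of_dot_eq_zero (hd : 2 ≤ d) {R : RawConfig N d 2} {F : Form N d} {i j : Fin 2}
    (hi : GoodAt (R.eqn i) (R.vec i) F) (hj : GoodAt (R.eqn j) (R.vec j) F)
    (hp : ∀ s : ℂ, R.vec i ≠ s • R.vec j) (h : R.eqn j ⬝ᵥ R.vec i = 0) :
    R.eqn i ⬝ᵥ R.vec j = 0 := by
  by_contra hne
  have h0 := hi.eval_vertex (by omega) 1
  rw [one_smul] at h0
  obtain ⟨v, hv, hv0⟩ := hj.2 (R.vec i) h hp h0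
  apply hv0
  set s := (R.eqn i ⬝ᵥ v) / (R.eqn i ⬝ᵥ R.vec j)
  have hv' : R.eqn i ⬝ᵥ (v - s • R.vec j) = 0 := by
    rw [dotProduct_sub, dotProduct_smul, smul_eq_mul, div_mul_cancel₀ _ hne, sub_self]
  have h1 := hi.dirDeriv_vertex hd hv' 1
  rw [one_smul] at h1
  have h2 : dirDeriv F.1 (R.vec i) (R.vec j) = 0 :=
    dirDeriv_eq_zero_of_const F.1 fun s => hj.1 _ h s
  rw [show v = (v - s • R.vec j) + s • R.vec j by simp, dirDeriv_add, dirDeriv_smul, h1, h2]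
  simp

/-- The configurations given by frames in position `S`. -/
def frameConfigs (S : Pos N) (d : ℕ) : Set (Config N d 2) :=
  Set.range fun D : Frame S d => D.conf.toConfig

/-- The position with `P_0 ∉ Π_1` and `P_1 ∉ Π_0`. -/
def posV (hN : 3 ≤ N) : Pos N where
  ρ i := ⟨i, by omega⟩
  σ i := ⟨1 - i, by omega⟩
  ρ_inj i j h := by simpa [Fin.ext_iff] using h
  σ_inj i j h := by simp only [Fin.mk.injEq] at h; omega
  ne i h := by simp only [Fin.mk.injEq] at h; omega

/-- The position with `P_0, P_1 ∈ Π_0 ∩ Π_1`. -/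
def posW (hN : 3 ≤ N) : Pos N where
  ρ i := ⟨i, by omega⟩
  σ i := ⟨i + 2, by omega⟩
  ρ_inj i j h := by simpa [Fin.ext_iff] using h
  σ_inj i j h := by simp only [Fin.mk.injEq] at h; omega
  ne i h := by simp only [Fin.mk.injEq] at h; omega

@[simp]
theorem posV_ρ_val (hN : 3 ≤ N) (i : Fin 2) : ((posV hN).ρ i : ℕ) = i := rfl

@[simp]
theorem posV_σ_val (hN : 3 ≤ N) (i : Fin 2) : ((posV hN).σ i : ℕ) = 1 - i := rfl

@[simp]
theorem posW_ρ_val (hN : 3 ≤ N) (i : Fin 2) : ((posW hN).ρ i : ℕ) = i := rfl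

@[simp]
theorem posW_σ_val (hN : 3 ≤ N) (i : Fin 2) : ((posW hN).σ i : ℕ) = i + 2 := rfl

theorem eqn_dot_vec_conf {S : Pos N} (D : Frame S d) (i j : Fin 2) :
    D.conf.eqn j ⬝ᵥ D.conf.vec i = if S.ρ j = S.σ i then 1 else 0 := by
  rw [D.conf_eqn_dot, D.mulVec_conf_vec, Pi.single_apply]

theorem frame_vec_ne {S : Pos N} (D : Frame S d) {i j : Fin 2} (hij : i ≠ j) (s : ℂ) :
    D.conf.vec i ≠ s • D.conf.vec j := by
  intro h
  have := congrArg D.h.mulVec h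
  rw [Matrix.mulVec_smul, D.mulVec_conf_vec, D.mulVec_conf_vec] at this
  have := congrFun this (S.σ i)
  simp [S.σ_inj.eq_iff, hij] at this

theorem frame_mem_suited {S : Pos N} (D : Frame S d) :
    D.conf.toConfig ∈ suitedConfigs N d 2 :=
  (mem_suited_iff _).2 ⟨D.goodAt, fun _ _ hij s => frame_vec_ne D hij s, _, D.realizes⟩

/-- The two equations and the two points, taken in the opposite order and rescaled, are biorthogonal
exactly because each point is off the other hyperplane. -/
theorem mem_frameConfigs_of_general (hN : 3 ≤ N) {L : Config N d 2}
    (hL : L ∈ suitedConfigs N d 2) (hg : L ∈ generalConfigs N d 2) :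
    L ∈ frameConfigs (posV hN) d := by
  obtain ⟨R, rfl⟩ := toConfig_surjective L
  obtain ⟨hgood, -, F, hF⟩ := (mem_suited_iff R).1 hL
  have hdot := ((mem_general_iff R).1 hg).2
  have h10 := hdot 0 1 (by simp)
  have h01 := hdot 1 0 (by simp)
  obtain ⟨h, hh, H⟩ := exists_matrix_of_biorthogonal (J := Fin 2) R.eqn
    ![(R.eqn 0 ⬝ᵥ R.vec 1)⁻¹ • R.vec 1, (R.eqn 1 ⬝ᵥ R.vec 0)⁻¹ • R.vec 0]
    (by
      intro j k
      fin_cases j <;> fin_cases k <;> simp [R.dot_eq_zero, h10, h01])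
    (posV hN).ρ_inj
  obtain ⟨D, -, hD⟩ := exists_frame (posV hN) R hgood hF hh
    (fun i => ⟨1, one_ne_zero, by rw [one_smul, (H i).1]⟩)
    (fun i => ⟨R.eqn (1 - i) ⬝ᵥ R.vec i, hdot _ _ (by fin_cases i <;> simp), by
      have h0 := (H 0).2
      have h1 := (H 1).2
      simp only [Matrix.cons_val_zero, Matrix.cons_val_one, Matrix.mulVec_smul] at h0 h1
      fin_cases i
      · change h.mulVec (R.vec 0) = (R.eqn 1 ⬝ᵥ R.vec 0) • Pi.single ((posV hN).ρ 1) 1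
        rw [← h1, smul_smul, mul_inv_cancel₀ h10, one_smul]
      · change h.mulVec (R.vec 1) = (R.eqn 0 ⬝ᵥ R.vec 1) • Pi.single ((posV hN).ρ 0) 1
        rw [← h0, smul_smul, mul_inv_cancel₀ h01, one_smul]⟩)
  exact ⟨D, hD⟩

/-- All four incidences hold, so equations and points do not pair with each other; each family needs
its own dual vectors before both can be straightened at once. -/
theorem mem_frameConfigs_of_not_general (hN : 3 ≤ N) (hd : 2 ≤ d) {L : Config N d 2}
    (hL : L ∈ suitedConfigs N d 2) (hg : L ∉ generalConfigs N d 2) :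
    L ∈ frameConfigs (posW hN) d := by
  obtain ⟨R, rfl⟩ := toConfig_surjective L
  obtain ⟨hgood, hvec, F, hF⟩ := (mem_suited_iff R).1 hL
  have hgF := goodAt_of_realizes hgood hF
  have hdot : ∀ i j, R.eqn j ⬝ᵥ R.vec i = 0 := by
    have h1 : ∃ i j, i ≠ j ∧ R.eqn j ⬝ᵥ R.vec i = 0 := by
      by_contra! hcon
      exact hg ((mem_general_iff R).2 ⟨hgood, hcon⟩)
    obtain ⟨i, j, hij, h0⟩ := h1
    have h0' := dot_eq_zero_of_dot_eq_zero hd (hgF i) (hgF j) (hvec i j hij) h0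
    intro i' j'
    by_cases hij' : i' = j'
    · rw [hij', R.dot_eq_zero]
    · by_cases h : i' = i
      · rw [h, show j' = j by omega, h0]
      · rw [show i' = j by omega, show j' = i by omega, h0']
  obtain ⟨u, hu⟩ := exists_dual_pair (p := R.eqn) (linearIndependent_of_forall_ne (R.eqn_ne 0)
    fun s => eqn_ne_smul hd (hgF 0) (hgF 1) (hvec 1 0 (by simp)) s)
  obtain ⟨ξ, hξ⟩ := exists_dual_pair (p := R.vec) (linearIndependent_of_forall_ne (R.vec_ne 0)
    fun s => hvec 1 0 (by simp) s)
  -- Subtracting multiples of the equations makes `ξ'` vanish on the `u k`. The pairing with the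
  -- points is unchanged, since the equations vanish there.
  let ξ' : Fin 2 → Fin (N + 1) → ℂ := fun i => ξ i - ∑ k, (ξ i ⬝ᵥ u k) • R.eqn k
  have hu' : ∀ i j, R.eqn i ⬝ᵥ u j = if i = j then 1 else 0 := fun i j => by
    rw [dotProduct_comm, hu]; simp [eq_comm]
  have hξ' : ∀ i j, ξ' i ⬝ᵥ R.vec j = if i = j then 1 else 0 := fun i j => by
    simp [ξ', sub_dotProduct, add_dotProduct, hξ, hdot]
  have hξu : ∀ i j, ξ' i ⬝ᵥ u j = 0 := fun i j => by
    fin_cases j <;> simp [ξ', sub_dotProduct, add_dotProduct, hu']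
  obtain ⟨h, hh, H⟩ := exists_matrix_of_biorthogonal (J := Fin 2 ⊕ Fin 2)
    (Sum.elim R.eqn ξ') (Sum.elim u R.vec)
    (by
      rintro (j | j) (k | k)
      · simp [hu']
      · simp [hdot]
      · simp [hξu]
      · simp [hξ'])
    (τ := Sum.elim (posW hN).ρ (posW hN).σ)
    (by
      rintro (j | j) (k | k) hjk
      · simpa using (posW hN).ρ_inj hjk
      · simp [Fin.ext_iff] at hjk; omega
      · simp [Fin.ext_iff] at hjk; omega
      · simpa using (posW hN).σ_inj hjk)
  obtain ⟨D, -, hD⟩ := exists_frame (posW hN) R hgood hF hh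
    (fun i => ⟨1, one_ne_zero, by rw [one_smul]; exact (H (.inl i)).1.symm⟩)
    (fun i => ⟨1, one_ne_zero, by rw [one_smul]; exact (H (.inr i)).2⟩)
  exact ⟨D, hD⟩

theorem W_eq_frameConfigs (hN : 3 ≤ N) (hd : 2 ≤ d) : W N d = frameConfigs (posW hN) d := by
  ext L
  constructor
  · rintro ⟨hL, hg⟩
    exact mem_frameConfigs_of_not_general hN hd hL hg
  · rintro ⟨D, rfl⟩
    refine ⟨frame_mem_suited D, fun h => ?_⟩
    have := ((mem_general_iff _).1 h).2 0 1 (by simp)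
    rw [eqn_dot_vec_conf] at this
    simp [Fin.ext_iff] at this

/-- The substitution homomorphism given by a matrix. -/
def linSubst (A : Matrix (Fin (N + 1)) (Fin (N + 1)) ℂ) :
    MvPolynomial (Fin (N + 1)) ℂ →ₐ[ℂ] MvPolynomial (Fin (N + 1)) ℂ :=
  aeval fun i => ∑ j, MvPolynomial.C (A i j) * MvPolynomial.X j

theorem eval_linSubst (A : Matrix (Fin (N + 1)) (Fin (N + 1)) ℂ) (x : Fin (N + 1) → ℂ)
    (p : MvPolynomial (Fin (N + 1)) ℂ) : eval x (linSubst A p) = eval (A.mulVec x) p := by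
  change aeval x (aeval _ p) = aeval _ p
  rw [← AlgHom.comp_apply, comp_aeval]
  congr 2
  funext i
  simp [Matrix.mulVec, dotProduct]

theorem irreducible_comp {F : Form N d} (hF : Irreducible F.1)
    {A : Matrix (Fin (N + 1)) (Fin (N + 1)) ℂ} (hA : IsUnit A.det) :
    Irreducible (comp F A).1 := by
  let E : MvPolynomial (Fin (N + 1)) ℂ ≃ₐ[ℂ] MvPolynomial (Fin (N + 1)) ℂ :=
    AlgEquiv.ofAlgHom (linSubst A) (linSubst A⁻¹)
      (AlgHom.ext fun p => MvPolynomial.funext fun x => by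
        simp [eval_linSubst, Matrix.nonsing_inv_mul _ hA])
      (AlgHom.ext fun p => MvPolynomial.funext fun x => by
        simp [eval_linSubst, Matrix.mul_nonsing_inv _ hA])
  exact (MulEquiv.irreducible_iff E.toMulEquiv).2 hF

/-- Requiring an irreducible realization excludes no general suited pair, since the realization is
free modulo forms vanishing on both hyperplanes. -/
theorem V_eq_frameConfigs (hN : 3 ≤ N) (hd : 2 ≤ d) : V N d 2 = frameConfigs (posV hN) d := by
  ext L
  constructor
  · rintro ⟨hg, F, -, hF⟩
    refine mem_frameConfigs_of_general hN ⟨hg.1, fun i j hij h => hg.2 i j hij ?_, F, hF⟩ hg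
    rw [h]
    exact (L j).pt_le
  · rintro ⟨D, rfl⟩
    refine ⟨(mem_general_iff _).2 ⟨D.goodAt, fun i j hij => ?_⟩, ?_⟩
    · rw [eqn_dot_vec_conf, if_pos]
      · exact one_ne_zero
      · simp only [Fin.ext_iff, posV_ρ_val, posV_σ_val]; omega
    · set r0 := (posV hN).ρ 0 with hr0
      set r1 := (posV hN).ρ 1 with hr1
      have hr : r0 ≠ r1 := (posV hN).ρ_inj.ne (by simp)
      have hmono : ∀ m, coeff m D.F.1 ≠ 0 → m r0 = 0 ∧ m r1 = 0 := fun m hm => by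
        obtain ⟨⟨i, hi⟩, h2⟩ := D.good.adapted m hm
        have h3 := h2 i hi
        fin_cases i
        · exact ⟨hi, h3⟩
        · exact ⟨h3, hi⟩
      -- The added monomial vanishes on both hyperplanes. The sum has degree one in `X r1`, with
      -- coefficient a power of `X r0` and constant term `D.F`. The latter is prime to `X r0`, as it
      -- does not vanish on that hyperplane, so the sum is irreducible.
      have hG : (X r0 ^ (d - 1) * X r1 + D.F.1 : MvPolynomial (Fin (N + 1)) ℂ).IsHomogeneous d := by
        refine IsHomogeneous.add ?_ D.F.2
        have := (isHomogeneous_X_pow (R := ℂ) r0 (d - 1)).mul (isHomogeneous_X ℂ r1)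
        rwa [show d - 1 + 1 = d by omega] at this
      refine ⟨comp ⟨_, hG⟩ D.h, irreducible_comp ?_ D.unit, D.cutsOut_comp _ fun i x hx => ?_⟩
      · refine irreducible_mul_X_add _ _ _ (pow_ne_zero _ (X_ne_zero _)) ?_ ?_ ?_
        · intro h
          have := vars_pow _ _ h
          simp [hr.symm] at this
        · rw [mem_vars_iff_mem_support]
          rintro ⟨m, hm, hm'⟩
          exact Finsupp.mem_support_iff.1 hm' (hmono m (mem_support_iff.1 hm)).2
        · refine IsRelPrime.pow_left ?_
          refine (MvPolynomial.X_prime.irreducible.isRelPrime_iff_not_dvd).2 ?_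
          rintro ⟨q, hq⟩
          obtain ⟨x, hx, hne⟩ := D.good.nonzero 0
          apply hne
          rw [hq, map_mul, eval_X, ← hr0.symm, hx, zero_mul]
      · have : x r0 ^ (d - 1) * x r1 = 0 := by
          fin_cases i
          · have : x r0 = 0 := hx
            rw [this, zero_pow (by omega), zero_mul]
          · have : x r1 = 0 := hx
            rw [this, mul_zero]
        simp [this]

theorem V_subset_suited (hN : 3 ≤ N) (hd : 2 ≤ d) : V N d 2 ⊆ suitedConfigs N d 2 := by
  rw [V_eq_frameConfigs hN hd]
  rintro _ ⟨D, rfl⟩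
  exact frame_mem_suited D

theorem suited_eq_union (hN : 3 ≤ N) (hd : 2 ≤ d) :
    suitedConfigs N d 2 = V N d 2 ∪ W N d := by
  ext L
  constructor
  · intro hL
    by_cases hg : L ∈ generalConfigs N d 2
    · left
      rw [V_eq_frameConfigs hN hd]
      exact mem_frameConfigs_of_general hN hL hg
    · exact Or.inr ⟨hL, hg⟩
  · rintro (h | h)
    · exact V_subset_suited hN hd h
    · exact h.1

end Positions

end StarPoints

end

noncomputable section

namespace StarPoints

open Module MvPolynomial Topology

/-! ### Smoothness is an open condition -/

section Smooth

variable {N d : ℕ} {X ι : Type*}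

theorem homogeneousComponent_mul_of_right {n : Type*} (e : ℕ) (p : MvPolynomial n ℂ)
    {q : MvPolynomial n ℂ} {k : ℕ} (hq : q.IsHomogeneous k) :
    homogeneousComponent e (p * q) =
      if k ≤ e then homogeneousComponent (e - k) p * q else 0 := by
  let _ : GradedAlgebra (homogeneousSubmodule n ℂ) := gradedAlgebra
  have key : ∀ (φ : MvPolynomial n ℂ) (i : ℕ),
      (DirectSum.decompose (homogeneousSubmodule n ℂ) φ i : MvPolynomial n ℂ) =
        homogeneousComponent i φ := decomposition.decompose'_apply
  rw [← key, ← key]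
  exact DirectSum.coe_decompose_mul_of_right_mem (homogeneousSubmodule n ℂ) (a := p) e
    ((mem_homogeneousSubmodule k q).2 hq)

/-- In a family of systems of homogeneous equations, having no nontrivial solution is an open
condition. -/
theorem eventually_no_common_zero [TopologicalSpace X] {c : X → ι → ℂ} (hc : IsCoord c)
    {K : Type*} [Fintype K] (deg : K → ℕ) {P : K → X → MvPolynomial (Fin (N + 1)) ℂ}
    (hP : ∀ k x, (P k x).IsHomogeneous (deg k)) (hreg : ∀ k, RegPoly c Set.univ (P k)) {x₀ : X}
    (h₀ : ∀ y, (∀ k, eval y (P k x₀) = 0) → y = 0) :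
    ∀ᶠ x in 𝓝 x₀, ∀ y, (∀ k, eval y (P k x) = 0) → y = 0 := by
  classical
  let J : Ideal (MvPolynomial (Fin (N + 1)) ℂ) := Ideal.span (Set.range fun k => P k x₀)
  -- By the Nullstellensatz some power of the ideal of the variables lies in the ideal of the system
  -- at `x₀`. Thus all monomials of some degree `e` are combinations of the equations.
  have hJ : idealOfVars (Fin (N + 1)) ℂ ≤ J.radical := by
    rw [← vanishingIdeal_zeroLocus_eq_radical (K := ℂ) J]
    rw [idealOfVars, Ideal.span_le]
    rintro _ ⟨i, rfl⟩ y hy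
    have : y = 0 := h₀ y fun k => by
      have := hy (P k x₀) (Ideal.subset_span ⟨k, rfl⟩)
      simpa using this
    simp [this]
  obtain ⟨e, he⟩ := Ideal.exists_pow_le_of_le_radical_of_fg hJ (idealOfVars_fg _ _)
  have hG : ∀ m : monos N e, ∃ G : K → MvPolynomial (Fin (N + 1)) ℂ,
      ∑ k, G k * P k x₀ = monomial m.1 1 := fun m => by
    have : monomial m.1 (1 : ℂ) ∈ J := he
      ((monomial_mem_pow_idealOfVars_iff e m.1 one_ne_zero).2 (mem_monos.1 m.2).ge)
    exact Ideal.mem_span_range_iff_exists_fun.1 this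
  choose G hG using hG
  -- Taking the degree `e` part keeps the multipliers fixed while `x` varies, and makes the
  -- combinations homogeneous for every `x`.
  let G' (m : monos N e) (k : K) : MvPolynomial (Fin (N + 1)) ℂ :=
    if deg k ≤ e then homogeneousComponent (e - deg k) (G m k) else 0
  have hsum : ∀ m x, homogeneousComponent e (∑ k, G m k * P k x) = ∑ k, G' m k * P k x := by
    intro m x
    rw [map_sum]
    refine Finset.sum_congr rfl fun k _ => ?_
    rw [homogeneousComponent_mul_of_right e _ (hP k x)]
    simp only [G']
    split_ifs <;> simp
  let Q (m : monos N e) (x : X) : Form N e := ⟨∑ k, G' m k * P k x, by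
    rw [← hsum]; exact homogeneousComponent_isHomogeneous _ _⟩
  have hQ₀ : ∀ m, (Q m x₀).1 = monomial m.1 1 := fun m => by
    change ∑ k, G' m k * P k x₀ = _
    rw [← hsum, hG, homogeneousComponent_of_mem (isHomogeneous_monomial _ (mem_monos.1 m.2))]
    simp
  -- This matrix is the identity at `x₀`, hence invertible nearby. At a common zero `y` it kills the
  -- vector of monomials of degree `e`, so all of these vanish, in particular every `y i ^ e`.
  let M (x : X) : Matrix (monos N e) (monos N e) ℂ := fun m m' => coeff m'.1 (Q m x).1
  have hM : (fun x => (M x).det) ∈ Reg c Set.univ := det_mem_reg fun m m' =>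
    RegPoly.coeff (RegPoly.sum fun k => (regPoly_const c Set.univ _).mul (hreg k)) _
  have hM₀ : M x₀ = 1 := by
    ext m m'
    simp only [M, hQ₀, coeff_monomial, Matrix.one_apply, Subtype.ext_iff]
  have hopen := (hc.isOpen_reg isOpen_univ hM).mem_nhds (x := x₀) ⟨trivial, by simp [hM₀]⟩
  filter_upwards [hopen] with x hx y hy
  have hx' : (M x).det ≠ 0 := hx.2
  have hvec : (M x).mulVec (fun m : monos N e => ∏ i, y i ^ m.1 i) = 0 := by
    funext m
    have h1 : eval y (Q m x).1 = 0 := by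
      change eval y (∑ k, G' m k * P k x) = 0
      rw [map_sum]
      exact Finset.sum_eq_zero fun k _ => by rw [map_mul, hy k, mul_zero]
    rw [eval_form, ← Finset.sum_coe_sort] at h1
    exact h1
  have hzero := Matrix.eq_zero_of_mulVec_eq_zero hx' hvec
  funext i
  have := congrFun hzero ⟨Finsupp.single i e, mem_monos.2 (by simp)⟩
  simp only [Pi.zero_apply] at this
  rw [Finset.prod_eq_single i (by intro j _ hj; simp [hj.symm]) (by simp)] at this
  exact eq_zero_of_pow_eq_zero (by simpa using this)

theorem eval_pderiv (F : MvPolynomial (Fin (N + 1)) ℂ) (x : Fin (N + 1) → ℂ) (j : Fin (N + 1)) :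
    eval x (pderiv j F) = dirDeriv F x (Pi.single j 1) := by
  simp [dirDeriv, Pi.single_apply]

theorem dirDeriv_self (F : Form N d) (x : Fin (N + 1) → ℂ) :
    dirDeriv F.1 x x = d * eval x F.1 := by
  have h1 := hasDerivAt_eval_line F.1 x x
  have h2 : HasDerivAt (fun s : ℂ => (1 + s) ^ d * eval x F.1) (d * eval x F.1) 0 := by
    have := (((hasDerivAt_id (0 : ℂ)).const_add 1).pow d).mul_const (eval x F.1)
    simpa using this
  refine h1.unique (h2.congr_of_eventuallyEq (Filter.Eventually.of_forall fun s => ?_))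
  change eval (x + s • x) F.1 = (1 + s) ^ d * eval x F.1
  rw [← eval_smul_form, add_smul, one_smul]

theorem dirDeriv_eq_zero_of_pderiv {F : MvPolynomial (Fin (N + 1)) ℂ} {x v : Fin (N + 1) → ℂ}
    {r : Fin (N + 1)} (hv : v r = 0) (h : ∀ j, j ≠ r → eval x (pderiv j F) = 0) :
    dirDeriv F x v = 0 := by
  refine Finset.sum_eq_zero fun j _ => ?_
  by_cases hj : j = r
  · rw [hj, hv, zero_mul]
  · rw [h j hj, mul_zero]

/-- A cone is smooth off its vertex iff its section by `x (σ i) = 0` is smooth. This is the absence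
of nontrivial zeros of a homogeneous system, so the general openness result applies. -/
theorem eventually_stdGood [TopologicalSpace X] {c : X → ι → ℂ} (hc : IsCoord c) {S : Pos N}
    (hd : d ≠ 0) {F : X → Form N d}
    (hF : ∀ m : {m : Fin (N + 1) →₀ ℕ // m.degree = d},
      (fun x => coeff m.1 (F x).1) ∈ Reg c Set.univ)
    (hA : ∀ x, S.Adapted (F x)) {x₀ : X} (h₀ : S.StdGood (F x₀)) :
    ∀ᶠ x in 𝓝 x₀, S.StdGood (F x) := by
  classical
  have hreg := regPoly_form hF
  have h1 : ∀ i, ∀ᶠ x in 𝓝 x₀, ∃ y : Fin (N + 1) → ℂ, y (S.ρ i) = 0 ∧ eval y (F x).1 ≠ 0 := by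
    intro i
    obtain ⟨y, hy, hne⟩ := h₀.nonzero i
    have hmem : (fun x => eval y (F x).1) ∈ Reg c Set.univ := by
      have := (Reg c Set.univ).sum_mem (t := monos N d)
        fun m _ => (Reg c Set.univ).mul_mem (hreg.coeff m)
          (const_mem_reg c Set.univ (∏ i, y i ^ m i))
      convert this using 1
      funext x
      rw [eval_form, Finset.sum_apply]
      rfl
    filter_upwards [(hc.isOpen_reg isOpen_univ hmem).mem_nhds ⟨trivial, hne⟩] with x hx
    exact ⟨y, hy, hx.2⟩
  have h2 : ∀ i, ∀ᶠ x in 𝓝 x₀, ∀ y : Fin (N + 1) → ℂ, y (S.ρ i) = 0 → y (S.σ i) = 0 →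
      (∀ j, j ≠ S.ρ i → eval y (pderiv j (F x).1) = 0) → y = 0 := by
    intro i
    -- The system consists of the two coordinates cutting out the section and the partial
    -- derivatives along the hyperplane. The equation `F = 0` may be omitted: Euler's formula
    -- implies it.
    have := eventually_no_common_zero hc (K := Option (Fin (N + 1)))
      (fun k => k.elim 1 fun j => if j = S.ρ i then 1 else d - 1)
      (P := fun k x => k.elim (MvPolynomial.X (S.σ i)) fun j =>
        if j = S.ρ i then MvPolynomial.X j else pderiv j (F x).1)
      (by
        rintro (_ | j) x
        · exact isHomogeneous_X ℂ _
        · by_cases hj : j = S.ρ i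
          · simpa [hj] using isHomogeneous_X ℂ _
          · have hFx : (F x).1.IsHomogeneous d := (F x).2
            simpa [hj] using hFx.pderiv)
      (by
        rintro (_ | j)
        · exact regPoly_const c _ _
        · by_cases hj : j = S.ρ i
          · simpa [hj] using regPoly_const c _ _
          · simpa [hj] using hreg.pderiv j)
      (x₀ := x₀) (by
        intro y hy
        have hσ : y (S.σ i) = 0 := by simpa using hy none
        have hρ : y (S.ρ i) = 0 := by simpa using hy (some (S.ρ i))
        have hj : ∀ j, j ≠ S.ρ i → eval y (pderiv j (F x₀).1) = 0 := fun j hj => by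
          simpa [hj] using hy (some j)
        by_contra hne
        have hev : eval y (F x₀).1 = 0 := by
          have := dirDeriv_self (F x₀) y
          rw [dirDeriv_eq_zero_of_pderiv hρ hj] at this
          exact (mul_eq_zero.1 this.symm).resolve_left (by exact_mod_cast hd)
        obtain ⟨v, hv, hv'⟩ := h₀.smooth i y hρ (fun s hs => hne (by
          have : s = 0 := by simpa [hσ] using (congrFun hs (S.σ i)).symm
          rw [hs, this, zero_smul])) hev
        exact hv' (dirDeriv_eq_zero_of_pderiv hv hj))
    filter_upwards [this] with x hx y hρ hσ hj
    refine hx y ?_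
    rintro (_ | j)
    · simpa using hσ
    · by_cases hj' : j = S.ρ i
      · simpa [hj'] using hρ
      · simpa [hj'] using hj j hj'
  filter_upwards [Filter.eventually_all.2 h1, Filter.eventually_all.2 h2] with x hx1 hx2
  refine ⟨hA x, fun i y hρ hy _ => ?_, hx1⟩
  by_contra! hcon
  apply hy (y (S.σ i))
  -- A singular point is moved along the ruling through the vertex into the section `x (σ i) = 0`.
  -- Derivatives along the hyperplane do not change, by invariance.
  have key := hx2 i (y - y (S.σ i) • Pi.single (S.σ i) 1) (by simp [hρ, S.ne i]) (by simp) ?_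
  · exact sub_eq_zero.1 key
  · intro j hj
    rw [eval_pderiv, ← hcon (Pi.single j 1) (by simp [hj.symm]), ← one_mul (dirDeriv (F x).1 y _)]
    refine dirDeriv_eq_of_eval_line fun s => ?_
    rw [one_mul, ← (hA x).invariant i (x := y - y (S.σ i) • Pi.single (S.σ i) 1 +
      s • Pi.single j 1) (by simp [hρ, S.ne i, hj.symm]) (y (S.σ i))]
    congr 2
    abel

end Smooth

/-! ### Families of frames -/

section Families

variable {N d : ℕ}

/-- The indices of the free coefficients of an adapted form, when the coefficients with index in
`P` are normalized to `1`. -/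
abbrev Pos.CoeffIndex (S : Pos N) (d : ℕ) (P : Finset (Fin (N + 1) →₀ ℕ)) : Type :=
  {m : Fin (N + 1) →₀ ℕ // m.degree = d ∧ S.Allowed m ∧ m ∉ P}

open Classical in
/-- The adapted form with given free coefficients. -/
def Pos.paramForm (S : Pos N) (d : ℕ) (P : Finset (Fin (N + 1) →₀ ℕ))
    (c : S.CoeffIndex d P → ℂ) : Form N d :=
  ofCoeff d fun m => if h : m.degree = d ∧ S.Allowed m ∧ m ∉ P then c ⟨m, h⟩
    else if S.Allowed m then 1 else 0

theorem Pos.coeff_paramForm (S : Pos N) (P : Finset (Fin (N + 1) →₀ ℕ))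
    (c : S.CoeffIndex d P → ℂ) (m : S.CoeffIndex d P) :
    coeff m.1 (S.paramForm d P c).1 = c m := by
  rw [Pos.paramForm, coeff_ofCoeff _ m.2.1, dif_pos m.2]

theorem Pos.coeff_paramForm_pivot (S : Pos N) {P : Finset (Fin (N + 1) →₀ ℕ)}
    (c : S.CoeffIndex d P → ℂ) {m : Fin (N + 1) →₀ ℕ} (hm : m ∈ P) (hdeg : m.degree = d)
    (hal : S.Allowed m) : coeff m (S.paramForm d P c).1 = 1 := by
  rw [Pos.paramForm, coeff_ofCoeff _ hdeg, dif_neg (fun h => h.2.2 hm), if_pos hal]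

theorem Pos.coeff_paramForm_of_not_allowed (S : Pos N) {P : Finset (Fin (N + 1) →₀ ℕ)}
    (c : S.CoeffIndex d P → ℂ) {m : Fin (N + 1) →₀ ℕ} (hal : ¬ S.Allowed m) :
    coeff m (S.paramForm d P c).1 = 0 := by
  by_cases hdeg : m.degree = d
  · rw [Pos.paramForm, coeff_ofCoeff _ hdeg, dif_neg (fun h => hal h.2.1), if_neg hal]
  · exact coeff_eq_zero_of_degree_ne _ hdeg

theorem Pos.adapted_paramForm (S : Pos N) (P : Finset (Fin (N + 1) →₀ ℕ))
    (c : S.CoeffIndex d P → ℂ) : S.Adapted (S.paramForm d P c) := fun m hm => by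
  by_contra hal
  exact hm (S.coeff_paramForm_of_not_allowed c hal)

theorem Pos.paramForm_coeff {S : Pos N} {P : Finset (Fin (N + 1) →₀ ℕ)} {F : Form N d}
    (hF : S.Adapted F) (hP : ∀ m ∈ P, coeff m F.1 = 1) :
    S.paramForm d P (fun m => coeff m.1 F.1) = F := by
  refine Form.ext_coeff fun m hm => ?_
  by_cases hal : S.Allowed m
  · by_cases hmP : m ∈ P
    · rw [S.coeff_paramForm_pivot _ hmP hm hal, hP m hmP]
    · exact S.coeff_paramForm P _ ⟨m, hm, hal, hmP⟩
  · rw [S.coeff_paramForm_of_not_allowed _ hal]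
    by_contra h
    exact hal (hF m fun h' => h h'.symm)

theorem Pos.coeff_paramForm_mem_reg {X ι : Type*} {c : X → ι → ℂ} {D : Set X} (S : Pos N)
    (P : Finset (Fin (N + 1) →₀ ℕ)) {b : X → S.CoeffIndex d P → ℂ}
    (hb : ∀ m, (fun x => b x m) ∈ Reg c D) (m : Fin (N + 1) →₀ ℕ) :
    (fun x => coeff m (S.paramForm d P (b x)).1) ∈ Reg c D := by
  by_cases hm : m.degree = d
  · simp only [Pos.paramForm, coeff_ofCoeff _ hm]
    by_cases h : m.degree = d ∧ S.Allowed m ∧ m ∉ P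
    · simpa only [dif_pos h] using hb ⟨m, h⟩
    · simpa only [dif_neg h] using const_mem_reg c D _
  · simpa only [coeff_eq_zero_of_degree_ne _ hm] using const_mem_reg c D 0

theorem continuous_conf {X ι : Type*} [TopologicalSpace X] {c : X → ι → ℂ} (hc : IsCoord c)
    {S : Pos N} {φ : X → Frame S d} (h1 : ∀ i j, (fun x => (φ x).h i j) ∈ Reg c Set.univ)
    (h2 : ∀ m, (fun x => coeff m (φ x).F.1) ∈ Reg c Set.univ) :
    Continuous fun x => (φ x).conf := by
  refine continuous_to_raw hc (fun i j => h1 _ _) (fun i j => ?_) fun i m => ?_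
  · exact matInv_mem_reg h1 (fun x _ => (φ x).unit.ne_zero) _ _
  · exact coeff_comp_mem_reg (fun m => h2 m.1) h1 m

/-- The frames are parametrized by the matrix entries and the allowed coefficients. The admissible
parameters form a neighbourhood of the point given by `F₀`, hence an irreducible set, and the family
is its continuous image. -/
theorem isIrreducible_frameConfigs (S : Pos N) (hd : d ≠ 0) {F₀ : Form N d}
    (hF₀ : S.StdGood F₀) : IsIrreducible (frameConfigs S d) := by
  let ι := (Fin (N + 1) × Fin (N + 1)) ⊕ S.CoeffIndex d ∅
  let g (u : Aff ι) : Matrix (Fin (N + 1)) (Fin (N + 1)) ℂ := fun i j => u.coord (.inl (i, j))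
  let F (u : Aff ι) : Form N d := S.paramForm d ∅ fun m => u.coord (.inr m)
  let Q : Set (Aff ι) := {u | (g u).det ≠ 0 ∧ S.StdGood (F u)}
  have hg : ∀ i j, (fun u => g u i j) ∈ Reg (Aff.coord (ι := ι)) Set.univ :=
    fun i j => coord_mem_reg _ _ _
  have hF : ∀ m, (fun u => coeff m (F u).1) ∈ Reg (Aff.coord (ι := ι)) Set.univ :=
    S.coeff_paramForm_mem_reg ∅ fun m => coord_mem_reg _ _ _
  let u (h : Matrix (Fin (N + 1)) (Fin (N + 1)) ℂ) (G : Form N d) : Aff ι :=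
    ⟨Sum.elim (fun ij => h ij.1 ij.2) fun m => coeff m.1 G.1⟩
  have hFu : ∀ h G, S.Adapted G → F (u h G) = G := fun h G hG =>
    Pos.paramForm_coeff hG (by simp)
  have hQ : Q ∈ 𝓝 (u 1 F₀) := by
    refine Filter.inter_mem ?_ ?_
    · have := (isCoord_aff.isOpen_reg isOpen_univ (det_mem_reg hg)).mem_nhds (x := u 1 F₀)
        ⟨trivial, by
          change (1 : Matrix (Fin (N + 1)) (Fin (N + 1)) ℂ).det ≠ 0
          simp⟩
      exact Filter.mem_of_superset this fun x hx => hx.2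
    · refine eventually_stdGood isCoord_aff hd (fun m => hF m.1)
        (fun x => S.adapted_paramForm ∅ _) ?_
      rw [hFu _ _ hF₀.adapted]
      exact hF₀
  have := irreducibleSpace_of_mem_nhds hQ
  let φ : Q → Frame S d := fun u => ⟨g u.1, F u.1, isUnit_iff_ne_zero.2 u.2.1, u.2.2⟩
  have hcont : Continuous fun u => (φ u).conf := by
    refine continuous_conf (isCoord_aff.comp IsInducing.subtypeVal) (fun i j => ?_) fun m => ?_
    · exact reg_comp (hg i j) fun _ _ => trivial
    · exact reg_comp (hF m) fun _ _ => trivial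
  have hrange : frameConfigs S d = (fun u => (φ u).conf.toConfig) '' Set.univ := by
    ext L
    constructor
    · rintro ⟨⟨h, G, hh, hG⟩, rfl⟩
      have hmem : u h G ∈ Q := ⟨hh.ne_zero, by rw [hFu _ _ hG.adapted]; exact hG⟩
      refine ⟨⟨u h G, hmem⟩, trivial, ?_⟩
      have : φ ⟨u h G, hmem⟩ = ⟨h, G, hh, hG⟩ := by
        simp only [φ, Frame.mk.injEq]
        exact ⟨rfl, hFu _ _ hG.adapted⟩
      simp only [this]
    · rintro ⟨u, -, rfl⟩
      exact ⟨φ u, rfl⟩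
  rw [hrange]
  exact (IrreducibleSpace.isIrreducible_univ _).image _
    (continuous_toConfig.comp hcont).continuousOn

end Families

end StarPoints

end

noncomputable section

namespace StarPoints

open Module MvPolynomial Topology

/-! ### Charts -/

section TopologicalChart

/-- A criterion for a map to a quotient to be an open embedding. -/
theorem isOpenEmbedding_chart {A R C : Type*} [TopologicalSpace A] [TopologicalSpace R]
    [TopologicalSpace C] {π : R → C} (hπ : Continuous π) (hπo : IsOpenMap π) {V : Set C}
    {φ : A → R} (hφ : Continuous φ) (hφV : ∀ u, π (φ u) ∈ V) {O : Set R} (hO : IsOpen O)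
    (hφO : ∀ u, φ u ∈ O) {ψ : {r : R // r ∈ O ∧ π r ∈ V} → A} (hψ : Continuous ψ)
    (hφψ : ∀ r, π (φ (ψ r)) = π r.1) (hfib : ∀ r r', π r.1 = π r'.1 → ψ r = ψ r')
    (hψφ : ∀ u, ψ ⟨φ u, hφO u, hφV u⟩ = u) :
    IsOpenEmbedding (fun u => (⟨π (φ u), hφV u⟩ : V)) := by
  refine IsOpenEmbedding.of_continuous_injective_isOpenMap
    ((hπ.comp hφ).subtype_mk _) (fun u u' h => ?_) fun B hB => ?_
  · rw [← hψφ u, ← hψφ u']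
    exact hfib _ _ (congrArg Subtype.val h)
  · obtain ⟨B', hB', hBB'⟩ := (hB.preimage hψ)
    refine ⟨π '' (O ∩ B'), hπo _ (hO.inter hB'), ?_⟩
    ext v
    constructor
    · rintro ⟨r, ⟨hrO, hrB⟩, hrv⟩
      have hrV : π r ∈ V := by rw [hrv]; exact v.2
      have hmem : (⟨r, hrO, hrV⟩ : {r : R // r ∈ O ∧ π r ∈ V}) ∈ ψ ⁻¹' B := by
        rw [← hBB']; exact hrB
      exact ⟨_, hmem, Subtype.ext ((hφψ _).trans hrv)⟩
    · rintro ⟨u, hu, rfl⟩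
      have hmem : (⟨φ u, hφO u, hφV u⟩ : {r : R // r ∈ O ∧ π r ∈ V}) ∈ ψ ⁻¹' B := by
        rw [Set.mem_preimage, hψφ]; exact hu
      rw [← hBB'] at hmem
      exact ⟨φ u, ⟨hφO u, hmem⟩, rfl⟩

end TopologicalChart

/-! ### Linear coordinate changes acting on configurations -/

section Action

variable {N d : ℕ}

/-- The action of an invertible matrix on configurations. -/
def act (g : Matrix (Fin (N + 1)) (Fin (N + 1)) ℂ) (hg : IsUnit g.det) (R : RawConfig N d 2) :
    RawConfig N d 2 where
  eqn i := Matrix.vecMul (R.eqn i) g⁻¹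
  vec i := g.mulVec (R.vec i)
  form i := comp (R.form i) g⁻¹
  eqn_ne i h := R.eqn_ne i (by
    have := congrArg (fun a => Matrix.vecMul a g) h
    simpa [Matrix.vecMul_vecMul, Matrix.nonsing_inv_mul _ hg] using this)
  vec_ne i h := R.vec_ne i (by
    have := congrArg (fun a => g⁻¹.mulVec a) h
    simpa [Matrix.mulVec_mulVec, Matrix.nonsing_inv_mul _ hg] using this)
  incident i := by
    rw [linForm_apply, ← Matrix.dotProduct_mulVec, Matrix.mulVec_mulVec,
      Matrix.nonsing_inv_mul _ hg, Matrix.one_mulVec, R.dot_eq_zero]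
  restrict_ne i := by
    obtain ⟨x, hx, hne⟩ := R.exists_eval_ne i
    have h1 : g⁻¹.mulVec (g.mulVec x) = x := by
      rw [Matrix.mulVec_mulVec, Matrix.nonsing_inv_mul _ hg, Matrix.one_mulVec]
    refine (restrictTo_ne_zero_iff _ _).2 ⟨g.mulVec x, ?_, ?_⟩
    · rw [← Matrix.dotProduct_mulVec, h1, hx]
    · rw [eval_comp, h1]; exact hne

theorem act_inv_act {g : Matrix (Fin (N + 1)) (Fin (N + 1)) ℂ} (hg : IsUnit g.det)
    (hg' : IsUnit g⁻¹.det) (R : RawConfig N d 2) : act g⁻¹ hg' (act g hg R) = R := by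
  refine RawConfig.ext_fields (fun i => ?_) (fun i => ?_) fun i => ?_
  · simp [act, Matrix.vecMul_vecMul, Matrix.nonsing_inv_nonsing_inv _ hg,
      Matrix.nonsing_inv_mul _ hg]
  · simp [act, Matrix.nonsing_inv_mul _ hg]
  · simp [act, comp_comp, Matrix.nonsing_inv_nonsing_inv _ hg, Matrix.nonsing_inv_mul _ hg,
      comp_one]

theorem act_act_inv {g : Matrix (Fin (N + 1)) (Fin (N + 1)) ℂ} (hg : IsUnit g.det)
    (hg' : IsUnit g⁻¹.det) (R : RawConfig N d 2) : act g hg (act g⁻¹ hg' R) = R := by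
  refine RawConfig.ext_fields (fun i => ?_) (fun i => ?_) fun i => ?_
  · simp [act, Matrix.vecMul_vecMul, Matrix.nonsing_inv_nonsing_inv _ hg,
      Matrix.mul_nonsing_inv _ hg]
  · simp [act, Matrix.mul_nonsing_inv _ hg]
  · simp [act, comp_comp, Matrix.nonsing_inv_nonsing_inv _ hg, Matrix.mul_nonsing_inv _ hg,
      comp_one]

theorem toConfig_act {g : Matrix (Fin (N + 1)) (Fin (N + 1)) ℂ} (hg : IsUnit g.det)
    {R R' : RawConfig N d 2} (h : R.toConfig = R'.toConfig) :
    (act g hg R).toConfig = (act g hg R').toConfig := by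
  rw [toConfig_eq_iff] at h ⊢
  intro i
  obtain ⟨⟨k, hk, hka⟩, ⟨l, hl, hlp⟩, n, hn, hnf⟩ := h i
  refine ⟨⟨k, hk, ?_⟩, ⟨l, hl, ?_⟩, n, hn, fun x hx => ?_⟩
  · simp [act, hka, Matrix.smul_vecMul]
  · simp [act, hlp, Matrix.mulVec_smul]
  · simp only [act, eval_comp] at hx ⊢
    exact hnf _ (by rw [Matrix.dotProduct_mulVec, hx])

theorem continuous_act {g : Matrix (Fin (N + 1)) (Fin (N + 1)) ℂ} (hg : IsUnit g.det) :
    Continuous (act (d := d) g hg) := by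
  refine continuous_to_raw isCoord_raw (fun i j => ?_) (fun i j => ?_) fun i m => ?_
  · have := (Reg RawConfig.coord Set.univ).sum_mem (t := Finset.univ) fun k _ =>
      (Reg RawConfig.coord Set.univ).mul_mem (eqn_mem_reg (N := N) (d := d) Set.univ i k)
        (const_mem_reg RawConfig.coord Set.univ (g⁻¹ k j))
    convert this using 1
    funext R
    simp [act, Matrix.vecMul, dotProduct]
  · have := (Reg RawConfig.coord Set.univ).sum_mem (t := Finset.univ) fun k _ =>
      (Reg RawConfig.coord Set.univ).mul_mem
        (const_mem_reg RawConfig.coord Set.univ (g j k))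
        (vec_mem_reg (N := N) (d := d) Set.univ i k)
    convert this using 1
    funext R
    simp [act, Matrix.mulVec, dotProduct]
  · exact coeff_comp_mem_reg (F := fun R : RawConfig N d 2 => R.form i) (A := fun _ => g⁻¹)
      (coeff_form_mem_reg Set.univ i) (fun _ _ => const_mem_reg RawConfig.coord Set.univ _) m

theorem act_conf {S : Pos N} (D : Frame S d) {g : Matrix (Fin (N + 1)) (Fin (N + 1)) ℂ}
    (hg : IsUnit g.det) (D' : Frame S d) (hh : D'.h = D.h * g⁻¹) (hF : D'.F = D.F) :
    act g hg D.conf = D'.conf := by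
  refine RawConfig.ext_fields (fun i => ?_) (fun i => ?_) fun i => ?_
  · simp only [Frame.conf, hh]; rfl
  · funext r
    simp only [Frame.conf, hh, Matrix.mul_inv_rev, Matrix.nonsing_inv_nonsing_inv _ hg]
    rfl
  · simp only [act, Frame.conf, hh, hF, comp_comp]

theorem act_mem_frameConfigs {S : Pos N} {g : Matrix (Fin (N + 1)) (Fin (N + 1)) ℂ}
    (hg : IsUnit g.det) {R : RawConfig N d 2} (h : R.toConfig ∈ frameConfigs S d) :
    (act g hg R).toConfig ∈ frameConfigs S d := by
  obtain ⟨D, hD⟩ := h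
  let D' : Frame S d := ⟨D.h * g⁻¹, D.F, by
    rw [Matrix.det_mul]; exact D.unit.mul (Matrix.isUnit_nonsing_inv_det _ hg), D.good⟩
  refine ⟨D', ?_⟩
  change D'.conf.toConfig = _
  rw [← act_conf D hg D' rfl rfl]
  exact toConfig_act hg hD

end Action

/-! ### Slices for matrices and normalized forms -/

section Slice

variable {N d : ℕ}

theorem Pos.StdGood.congr {S : Pos N} {F G : Form N d} (h : S.StdGood F) (hG : S.Adapted G)
    (hFG : ∀ i, ∃ k : ℂ, k ≠ 0 ∧ ∀ x, x (S.ρ i) = 0 → eval x G.1 = k * eval x F.1) :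
    S.StdGood G := by
  refine ⟨hG, fun i x hx hxp h0 => ?_, fun i => ?_⟩
  · obtain ⟨k, hk, hkF⟩ := hFG i
    rw [hkF x hx] at h0
    obtain ⟨v, hv, hne⟩ := h.smooth i x hx hxp ((mul_eq_zero.1 h0).resolve_left hk)
    refine ⟨v, hv, ?_⟩
    rw [dirDeriv_eq_of_eval_line (k := k) (G := F.1) (y := x) (w := v)
      fun s => hkF _ (by simp [hx, hv])]
    exact mul_ne_zero hk hne
  · obtain ⟨k, hk, hkF⟩ := hFG i
    obtain ⟨x, hx, hne⟩ := h.nonzero i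
    exact ⟨x, hx, by rw [hkF x hx]; exact mul_ne_zero hk hne⟩

/-- Monomials whose coefficients can be normalized to `1`. -/
structure Pos.IsPivot (S : Pos N) (d : ℕ) (μ : Fin 2 → Fin (N + 1) →₀ ℕ) : Prop where
  degree : ∀ i, (μ i).degree = d
  allowed : ∀ i, S.Allowed (μ i)
  vis : ∀ i, μ i (S.ρ i) = 0
  consistent : μ 0 = μ 1 ∨ ∀ m, m.degree = d → S.Allowed m → ∃ i, m (S.ρ i) ≠ 0

/-- The two cone equations may be rescaled separately, but a monomial visible on both hyperplanes
ties the two scalars together; then both must be normalized by the same pivot. -/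
theorem Pos.IsPivot.eq {S : Pos N} {μ : Fin 2 → Fin (N + 1) →₀ ℕ} (hμ : S.IsPivot d μ)
    {m : Fin (N + 1) →₀ ℕ} (hm : m.degree = d) (hal : S.Allowed m) {i j : Fin 2}
    (hi : m (S.ρ i) = 0) (hj : m (S.ρ j) = 0) : μ i = μ j := by
  by_cases hij : i = j
  · rw [hij]
  rcases hμ.consistent with h | h
  · fin_cases i <;> fin_cases j <;> simp_all
  · obtain ⟨k, hk⟩ := h m hm hal
    rcases (show k = i ∨ k = j by omega) with rfl | rfl
    · exact absurd hi hk
    · exact absurd hj hk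

/-- An index `i` for which the monomial `m` does not vanish on `Π_i`. -/
def Pos.visIndex (S : Pos N) (m : Fin (N + 1) →₀ ℕ) : Fin 2 := if m (S.ρ 0) = 0 then 0 else 1

theorem Pos.visIndex_spec {S : Pos N} {m : Fin (N + 1) →₀ ℕ} (h : S.Allowed m) :
    m (S.ρ (S.visIndex m)) = 0 := by
  obtain ⟨⟨i, hi⟩, -⟩ := h
  unfold Pos.visIndex
  split_ifs with h0
  · exact h0
  · fin_cases i
    · exact absurd hi h0
    · exact hi

/-- The set of pivots. -/
abbrev pivotSet (μ : Fin 2 → Fin (N + 1) →₀ ℕ) : Finset (Fin (N + 1) →₀ ℕ) := {μ 0, μ 1}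

/-- The coefficients of the normalization of a form. -/
def Pos.normCoeff (S : Pos N) (μ : Fin 2 → Fin (N + 1) →₀ ℕ) (F : Fin 2 → Form N d)
    (m : S.CoeffIndex d (pivotSet μ)) : ℂ :=
  coeff m.1 (F (S.visIndex m.1)).1 / coeff (μ (S.visIndex m.1)) (F (S.visIndex m.1)).1

theorem Pos.normCoeff_congr {S : Pos N} {μ : Fin 2 → Fin (N + 1) →₀ ℕ} (hμ : S.IsPivot d μ)
    {F G : Fin 2 → Form N d} {k : Fin 2 → ℂ} (hk : ∀ i, k i ≠ 0)
    (h : ∀ i m, m (S.ρ i) = 0 → coeff m (F i).1 = k i * coeff m (G i).1) :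
    S.normCoeff μ F = S.normCoeff μ G := by
  funext m
  unfold Pos.normCoeff
  rw [h _ _ (Pos.visIndex_spec m.2.2.1), h _ _ (hμ.vis _), mul_div_mul_left _ _ (hk _)]

/-- Each coefficient is divided by the pivot coefficient of one hyperplane on which its monomial is
visible. By `Pos.IsPivot.eq` this choice is immaterial for monomials visible on both. -/
theorem Pos.eval_normalize {S : Pos N} {μ : Fin 2 → Fin (N + 1) →₀ ℕ} (hμ : S.IsPivot d μ)
    {F : Form N d} (hF : S.Adapted F) (hne : ∀ i, coeff (μ i) F.1 ≠ 0) (i : Fin 2)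
    {x : Fin (N + 1) → ℂ} (hx : x (S.ρ i) = 0) :
    eval x (S.paramForm d (pivotSet μ) (S.normCoeff μ fun _ => F)).1 =
      (coeff (μ i) F.1)⁻¹ * eval x F.1 := by
  rw [← smul_eval]
  refine eval_eq_of_coeff_eq (G := (coeff (μ i) F.1)⁻¹ • F) (fun m hm => ?_) hx
  rw [Submodule.coe_smul, coeff_smul, smul_eq_mul]
  by_cases hdeg : m.degree = d
  swap
  · rw [coeff_eq_zero_of_degree_ne _ hdeg, coeff_eq_zero_of_degree_ne _ hdeg, mul_zero]
  by_cases hal : S.Allowed m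
  swap
  · rw [S.coeff_paramForm_of_not_allowed _ hal]
    have : coeff m F.1 = 0 := by
      by_contra h
      exact hal (hF m h)
    rw [this, mul_zero]
  by_cases hP : m ∈ pivotSet μ
  · rw [S.coeff_paramForm_pivot _ hP hdeg hal]
    have : ∃ j, m = μ j := by
      simp only [Finset.mem_insert, Finset.mem_singleton] at hP
      rcases hP with h | h
      exacts [⟨0, h⟩, ⟨1, h⟩]
    obtain ⟨j, rfl⟩ := this
    rw [hμ.eq hdeg hal hm (hμ.vis j), inv_mul_cancel₀ (hne j)]
  · rw [S.coeff_paramForm _ _ ⟨m, hdeg, hal, hP⟩, Pos.normCoeff,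
      hμ.eq hdeg hal (Pos.visIndex_spec hal) hm, div_eq_inv_mul]

theorem Pos.StdGood.normalize {S : Pos N} {μ : Fin 2 → Fin (N + 1) →₀ ℕ} (hμ : S.IsPivot d μ)
    {F : Form N d} (hF : S.StdGood F) (hne : ∀ i, coeff (μ i) F.1 ≠ 0) :
    S.StdGood (S.paramForm d (pivotSet μ) (S.normCoeff μ fun _ => F)) :=
  hF.congr (S.adapted_paramForm _ _) fun i =>
    ⟨_, inv_ne_zero (hne i), fun _ hx => Pos.eval_normalize hμ hF.adapted hne i hx⟩

theorem toConfig_normalize {S : Pos N} {μ : Fin 2 → Fin (N + 1) →₀ ℕ} (hμ : S.IsPivot d μ)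
    (D : Frame S d) (hne : ∀ i, coeff (μ i) D.F.1 ≠ 0) :
    (⟨D.h, _, D.unit, D.good.normalize hμ hne⟩ : Frame S d).conf.toConfig = D.conf.toConfig := by
  refine ((toConfig_eq_iff _ _).2 fun i => ⟨⟨1, one_ne_zero, ?_⟩, ⟨1, one_ne_zero, ?_⟩,
    (coeff (μ i) D.F.1)⁻¹, inv_ne_zero (hne i), fun x hx => ?_⟩).symm
  · rw [one_smul]; rfl
  · rw [one_smul]; rfl
  · simp only [Frame.conf, eval_comp]
    exact Pos.eval_normalize hμ D.good.adapted hne i hx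

/-- The positions of the free entries of the matrices in the slice. -/
abbrev Pos.Free (S : Pos N) : Type :=
  {q : Fin (N + 1) × Fin (N + 1) // q.1 ≠ q.2 ∧ (q.1 ∈ Set.range S.ρ ∨ q.2 ∈ Set.range S.σ)}

open Classical in
/-- The matrices that are equal to the identity matrix outside the free entries. -/
def Pos.slice (S : Pos N) (f : Fin (N + 1) → Fin (N + 1) → ℂ) :
    Matrix (Fin (N + 1)) (Fin (N + 1)) ℂ := fun r j =>
  if r = j then 1 else if r ∈ Set.range S.ρ ∨ j ∈ Set.range S.σ then f r j else 0

theorem Pos.slice_row {S : Pos N} {f : Fin (N + 1) → Fin (N + 1) → ℂ} {k : Fin 2}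
    {a : Fin (N + 1) → ℂ} (ha : a (S.ρ k) ≠ 0) (hf : ∀ j, f (S.ρ k) j = a j / a (S.ρ k)) :
    S.slice f (S.ρ k) = (a (S.ρ k))⁻¹ • a := by
  funext j
  by_cases hj : S.ρ k = j
  · subst hj; simp [Pos.slice, ha]
  · simp [Pos.slice, hj, hf, div_eq_inv_mul]

theorem Pos.slice_mulVec {S : Pos N} (f : Fin (N + 1) → Fin (N + 1) → ℂ) {r : Fin (N + 1)}
    (hr : r ∉ Set.range S.ρ) (p : Fin (N + 1) → ℂ) :
    (S.slice f).mulVec p r = p r + ∑ i, if r = S.σ i then 0 else f r (S.σ i) * p (S.σ i) := by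
  classical
  have h1 : ∀ j, S.slice f r j * p j = (if r = j then p j else 0) +
      ∑ i, if j = S.σ i then (if r = S.σ i then 0 else f r (S.σ i) * p (S.σ i)) else 0 := by
    intro j
    by_cases hrj : r = j
    · subst hrj
      have : ∀ i, (if r = S.σ i then (if r = S.σ i then 0 else f r (S.σ i) * p (S.σ i)) else 0) =
          0 := fun i => by split_ifs <;> rfl
      simp [Pos.slice, this]
    · by_cases hj : j ∈ Set.range S.σ
      · obtain ⟨i, rfl⟩ := hj
        rw [Finset.sum_eq_single i]
        · simp [Pos.slice, hrj]
        · intro i' _ hi'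
          rw [if_neg (fun h => hi' (S.σ_inj h).symm)]
        · simp
      · rw [Finset.sum_eq_zero fun i _ => if_neg fun h => hj ⟨i, h.symm⟩]
        simp only [Pos.slice, hrj, if_false]
        rw [if_neg (by rintro (h | h); exacts [hr h, hj h])]
        simp
  simp only [Matrix.mulVec, dotProduct, h1, Finset.sum_add_distrib]
  rw [Finset.sum_comm]
  simp

/-- The minor of the coordinates of the two points. -/
def Pos.minor (S : Pos N) (p : Fin 2 → Fin (N + 1) → ℂ) : ℂ :=
  p 0 (S.σ 0) * p 1 (S.σ 1) - p 1 (S.σ 0) * p 0 (S.σ 1)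

/-- The entries of the matrix in the slice that brings given hyperplanes and points into standard
position. -/
def Pos.entries (S : Pos N) (a p : Fin 2 → Fin (N + 1) → ℂ) (r j : Fin (N + 1)) : ℂ :=
  if r = S.ρ 0 then a 0 j / a 0 (S.ρ 0)
  else if r = S.ρ 1 then a 1 j / a 1 (S.ρ 1)
  else if j = S.σ 0 then
    if r = S.σ 1 then -p 0 r / p 0 (S.σ 0)
    else -(p 0 r * p 1 (S.σ 1) - p 1 r * p 0 (S.σ 1)) / S.minor p
  else
    if r = S.σ 0 then -p 1 r / p 1 (S.σ 1)
    else -(p 1 r * p 0 (S.σ 0) - p 0 r * p 1 (S.σ 0)) / S.minor p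

theorem Pos.entries_row (S : Pos N) (a p : Fin 2 → Fin (N + 1) → ℂ) (k : Fin 2)
    (j : Fin (N + 1)) : S.entries a p (S.ρ k) j = a k j / a k (S.ρ k) := by
  have h10 : S.ρ 1 ≠ S.ρ 0 := S.ρ_inj.ne (by simp)
  fin_cases k
  · simp [Pos.entries]
  · simp [Pos.entries, h10]

/-- For a row outside both index ranges, sending both points to the right place is a 2 by 2 linear
system in its two free entries, solved by Cramer's rule with determinant `S.minor p`. If the row
belongs to the other point, its diagonal entry is fixed to 1 and one equation in one unknown
remains. -/
theorem Pos.slice_entries_mulVec {S : Pos N} (a : Fin 2 → Fin (N + 1) → ℂ)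
    {p : Fin 2 → Fin (N + 1) → ℂ} (h0 : ∀ i, p i (S.σ i) ≠ 0) (hδ : S.minor p ≠ 0)
    {r : Fin (N + 1)} (hr : r ∉ Set.range S.ρ) {i : Fin 2} (hi : r ≠ S.σ i) :
    (S.slice (S.entries a p)).mulVec (p i) r = 0 := by
  have hr0 : r ≠ S.ρ 0 := fun h => hr ⟨0, h.symm⟩
  have hr1 : r ≠ S.ρ 1 := fun h => hr ⟨1, h.symm⟩
  have h10 : S.σ 1 ≠ S.σ 0 := S.σ_inj.ne (by simp)
  have h00 := h0 0
  have h11 := h0 1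
  rw [Pos.slice_mulVec _ hr, Fin.sum_univ_two]
  simp only [Pos.entries, if_neg hr0, if_neg hr1, if_true, if_neg h10]
  by_cases hσ0 : r = S.σ 0
  · have hσ1 : r ≠ S.σ 1 := by rw [hσ0]; exact h10.symm
    obtain rfl : i = 1 := by
      fin_cases i
      · exact absurd hσ0 hi
      · rfl
    simp only [if_pos hσ0, if_neg hσ1]
    field_simp
    ring
  · by_cases hσ1 : r = S.σ 1
    · obtain rfl : i = 0 := by
        fin_cases i
        · rfl
        · exact absurd hσ1 hi
      simp only [if_neg hσ0, if_pos hσ1]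
      field_simp
      ring
    · simp only [if_neg hσ0, if_neg hσ1]
      field_simp
      unfold Pos.minor
      fin_cases i <;> simp only [Fin.zero_eta, Fin.mk_one] <;> ring

/-- The linear equations for the free entries have only one solution. Hence the chart coordinates of
a configuration built from a slice matrix recover that matrix. -/
theorem Pos.entries_unique {S : Pos N} {f : Fin (N + 1) → Fin (N + 1) → ℂ}
    {a p : Fin 2 → Fin (N + 1) → ℂ} (h0 : ∀ i, p i (S.σ i) ≠ 0) (hδ : S.minor p ≠ 0)
    (hf : ∀ k j, j ≠ S.ρ k → f (S.ρ k) j = a k j / a k (S.ρ k))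
    (hp : ∀ i r, r ∉ Set.range S.ρ → r ≠ S.σ i → (S.slice f).mulVec (p i) r = 0)
    (q : S.Free) : S.entries a p q.1.1 q.1.2 = f q.1.1 q.1.2 := by
  obtain ⟨⟨r, j⟩, hrj, hfree⟩ := q
  simp only at hrj hfree ⊢
  by_cases hr : r ∈ Set.range S.ρ
  · obtain ⟨k, rfl⟩ := hr
    rw [Pos.entries_row, hf k j hrj.symm]
  have hr0 : r ≠ S.ρ 0 := fun h => hr ⟨0, h.symm⟩
  have hr1 : r ≠ S.ρ 1 := fun h => hr ⟨1, h.symm⟩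
  have h10 : S.σ 1 ≠ S.σ 0 := S.σ_inj.ne (by simp)
  have h00 := h0 0
  have h11 := h0 1
  have hp0 := hp 0 r hr
  have hp1 := hp 1 r hr
  simp only [Pos.slice_mulVec _ hr, Fin.sum_univ_two] at hp0 hp1
  obtain ⟨i, rfl⟩ := hfree.resolve_left hr
  simp only [Pos.entries, if_neg hr0, if_neg hr1]
  fin_cases i
  · simp only [Fin.zero_eta] at hrj ⊢
    have hp0 := hp0 hrj
    simp only [if_true]
    split_ifs with h1
    · simp only [if_neg hrj, if_pos h1] at hp0
      field_simp
      linear_combination -hp0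
    · have hp1 := hp1 h1
      simp only [if_neg hrj, if_neg h1] at hp0 hp1
      rw [div_eq_iff hδ]
      unfold Pos.minor
      linear_combination (-p 1 (S.σ 1)) * hp0 + p 0 (S.σ 1) * hp1
  · simp only [Fin.mk_one] at hrj ⊢
    have hp1 := hp1 hrj
    simp only [if_neg h10]
    split_ifs with h1
    · simp only [if_neg hrj, if_pos h1] at hp1
      field_simp
      linear_combination -hp1
    · have hp0 := hp0 h1
      simp only [if_neg hrj, if_neg h1] at hp0 hp1
      rw [div_eq_iff hδ]
      unfold Pos.minor
      linear_combination (-p 0 (S.σ 0)) * hp1 + p 1 (S.σ 0) * hp0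

end Slice

end StarPoints

end

noncomputable section

namespace StarPoints

open Module MvPolynomial Topology

/-! ### Bringing a configuration into standard position by a slice matrix -/

section ChartDefs

variable {N d : ℕ}

theorem Pos.slice_congr {S : Pos N} {f f' : Fin (N + 1) → Fin (N + 1) → ℂ}
    (h : ∀ q : S.Free, f q.1.1 q.1.2 = f' q.1.1 q.1.2) : S.slice f = S.slice f' := by
  classical
  funext r j
  unfold Pos.slice
  split_ifs with h1 h2
  · rfl
  · exact h ⟨(r, j), h1, h2⟩
  · rfl

theorem Pos.minor_smul (S : Pos N) (p : Fin 2 → Fin (N + 1) → ℂ) (l : Fin 2 → ℂ) :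
    S.minor (fun i => l i • p i) = l 0 * l 1 * S.minor p := by
  simp only [Pos.minor, Pi.smul_apply, smul_eq_mul]
  ring

/-- Every entry is homogeneous of degree zero in each equation and each point, so the slice matrix
depends only on the configuration. -/
theorem Pos.entries_smul (S : Pos N) (a p : Fin 2 → Fin (N + 1) → ℂ) {k l : Fin 2 → ℂ}
    (hk : ∀ i, k i ≠ 0) (hl : ∀ i, l i ≠ 0) :
    S.entries (fun i => k i • a i) (fun i => l i • p i) = S.entries a p := by
  have hl2 : l 0 * l 1 ≠ 0 := mul_ne_zero (hl 0) (hl 1)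
  funext r j
  simp only [Pos.entries, S.minor_smul, Pi.smul_apply, smul_eq_mul]
  split_ifs
  · rw [mul_div_mul_left _ _ (hk 0)]
  · rw [mul_div_mul_left _ _ (hk 1)]
  · rw [← mul_neg, mul_div_mul_left _ _ (hl 0)]
  · rw [← mul_div_mul_left _ (S.minor p) hl2]; congr 1; ring
  · rw [← mul_neg, mul_div_mul_left _ _ (hl 1)]
  · rw [← mul_div_mul_left _ (S.minor p) hl2]; congr 1; ring

/-- The matrix in the slice that brings a configuration into standard position. -/
def Pos.straighten (S : Pos N) (R : RawConfig N d 2) : Matrix (Fin (N + 1)) (Fin (N + 1)) ℂ :=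
  S.slice (S.entries R.eqn R.vec)

/-- The forms of a configuration after it is brought into standard position. -/
def Pos.straightForm (S : Pos N) (R : RawConfig N d 2) (i : Fin 2) : Form N d :=
  comp (R.form i) (S.straighten R)⁻¹

/-- The configurations to which the chart around the standard position applies. -/
structure Pos.InChart (S : Pos N) (μ : Fin 2 → Fin (N + 1) →₀ ℕ) (R : RawConfig N d 2) :
    Prop where
  eqn : ∀ i, R.eqn i (S.ρ i) ≠ 0
  vec : ∀ i, R.vec i (S.σ i) ≠ 0
  minor : S.minor R.vec ≠ 0
  det : (S.straighten R).det ≠ 0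
  pivot : ∀ i, coeff (μ i) (S.straightForm R i).1 ≠ 0

theorem Pos.straighten_congr {S : Pos N} {R R' : RawConfig N d 2}
    (h : R.toConfig = R'.toConfig) : S.straighten R' = S.straighten R := by
  have h := (toConfig_eq_iff R R').1 h
  choose ha hp _ using h
  choose k hk hka using ha
  choose l hl hlp using hp
  unfold Pos.straighten
  rw [show R'.eqn = fun i => k i • R.eqn i from funext hka,
    show R'.vec = fun i => l i • R.vec i from funext hlp, S.entries_smul _ _ hk hl]

theorem Pos.straighten_row {S : Pos N} {R : RawConfig N d 2} {i : Fin 2}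
    (h : R.eqn i (S.ρ i) ≠ 0) : S.straighten R (S.ρ i) = (R.eqn i (S.ρ i))⁻¹ • R.eqn i :=
  Pos.slice_row h fun j => S.entries_row _ _ i j

theorem Pos.dot_of_straighten {S : Pos N} {R : RawConfig N d 2} (hdet : (S.straighten R).det ≠ 0)
    {i : Fin 2} (h : R.eqn i (S.ρ i) ≠ 0) {x : Fin (N + 1) → ℂ} (hx : x (S.ρ i) = 0) :
    R.eqn i ⬝ᵥ (S.straighten R)⁻¹.mulVec x = 0 := by
  have h1 : (S.straighten R).mulVec ((S.straighten R)⁻¹.mulVec x) (S.ρ i) = 0 := by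
    rw [Matrix.mulVec_mulVec, Matrix.mul_nonsing_inv _ (isUnit_iff_ne_zero.2 hdet),
      Matrix.one_mulVec, hx]
  change S.straighten R (S.ρ i) ⬝ᵥ _ = 0 at h1
  rw [Pos.straighten_row h, smul_dotProduct, smul_eq_mul] at h1
  exact (mul_eq_zero.1 h1).resolve_left (inv_ne_zero h)

/-- Only the restriction of a form to its hyperplane is determined up to a scalar. After
straightening, that restriction sees exactly the monomials free of the variable `ρ i`. -/
theorem Pos.straightForm_congr {S : Pos N} {R R' : RawConfig N d 2}
    (h : R.toConfig = R'.toConfig) (hdet : (S.straighten R).det ≠ 0)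
    (ha : ∀ i, R.eqn i (S.ρ i) ≠ 0) :
    ∃ k : Fin 2 → ℂ, (∀ i, k i ≠ 0) ∧ ∀ i m, m (S.ρ i) = 0 →
      coeff m (S.straightForm R' i).1 = k i * coeff m (S.straightForm R i).1 := by
  have h' := (toConfig_eq_iff R R').1 h
  choose _ _ hf using h'
  choose k hk hkf using hf
  refine ⟨k, hk, fun i m hm => ?_⟩
  have := coeff_eq_of_eval_eq (F := S.straightForm R' i) (G := k i • S.straightForm R i)
    (fun x hx => ?_) hm
  · rw [this, Submodule.coe_smul, coeff_smul, smul_eq_mul]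
  · rw [Submodule.coe_smul, smul_eval, Pos.straightForm, Pos.straightForm, eval_comp, eval_comp,
      Pos.straighten_congr h, hkf i _ (Pos.dot_of_straighten hdet (ha i) hx)]

theorem Pos.InChart.congr {S : Pos N} {μ : Fin 2 → Fin (N + 1) →₀ ℕ} (hμ : S.IsPivot d μ)
    {R R' : RawConfig N d 2} (hR : S.InChart μ R) (h : R.toConfig = R'.toConfig) :
    S.InChart μ R' := by
  obtain ⟨n, hn, hnf⟩ := Pos.straightForm_congr h hR.det hR.eqn
  have h' := (toConfig_eq_iff R R').1 h
  choose ha hp _ using h'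
  choose k hk hka using ha
  choose l hl hlp using hp
  refine ⟨fun i => ?_, fun i => ?_, ?_, ?_, fun i => ?_⟩
  · rw [hka]; exact mul_ne_zero (hk i) (hR.eqn i)
  · rw [hlp]; exact mul_ne_zero (hl i) (hR.vec i)
  · rw [show R'.vec = fun i => l i • R.vec i from funext hlp, S.minor_smul]
    exact mul_ne_zero (mul_ne_zero (hl 0) (hl 1)) hR.minor
  · rw [Pos.straighten_congr h]; exact hR.det
  · rw [hnf i _ (hμ.vis i)]; exact mul_ne_zero (hn i) (hR.pivot i)

/-- Belonging to the family supplies the incidences that the slice matrix cannot enforce: the rows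
`ρ j` vanish on the points which should lie on `Π_j`. -/
theorem exists_frame_of_inChart {S : Pos N} {μ : Fin 2 → Fin (N + 1) →₀ ℕ}
    {R : RawConfig N d 2} (hR : S.InChart μ R) (hmem : R.toConfig ∈ frameConfigs S d) :
    ∃ D : Frame S d, D.h = S.straighten R ∧ D.conf.toConfig = R.toConfig := by
  obtain ⟨D, hD⟩ := hmem
  have hs : R.toConfig ∈ suitedConfigs N d 2 := hD ▸ frame_mem_suited D
  obtain ⟨hgood, -, F, hF⟩ := (mem_suited_iff R).1 hs
  have hunit : IsUnit (S.straighten R).det := isUnit_iff_ne_zero.2 hR.det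
  have hdot : ∀ i j, S.ρ j ≠ S.σ i → R.eqn j ⬝ᵥ R.vec i = 0 := fun i j hij => by
    have h := (toConfig_eq_iff D.conf R).1 hD
    obtain ⟨⟨k, hk, hka⟩, -, -⟩ := h j
    obtain ⟨-, ⟨l, hl, hlp⟩, -⟩ := h i
    rw [hka, hlp, smul_dotProduct, dotProduct_smul, eqn_dot_vec_conf, if_neg hij]
    simp
  refine exists_frame S R hgood hF hunit (fun i => ⟨R.eqn i (S.ρ i), hR.eqn i, ?_⟩) fun i => ?_
  · rw [Pos.straighten_row (hR.eqn i), smul_smul, mul_inv_cancel₀ (hR.eqn i), one_smul]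
  · have hsingle : (S.straighten R).mulVec (R.vec i) =
        (S.straighten R).mulVec (R.vec i) (S.σ i) • Pi.single (S.σ i) 1 := by
      funext r
      by_cases hr : r = S.σ i
      · subst hr; simp
      simp only [Pi.smul_apply, Pi.single_eq_of_ne hr, smul_zero]
      by_cases hr' : r ∈ Set.range S.ρ
      · obtain ⟨j, rfl⟩ := hr'
        change S.straighten R (S.ρ j) ⬝ᵥ _ = 0
        rw [Pos.straighten_row (hR.eqn j), smul_dotProduct, hdot i j hr, smul_zero]
      · exact Pos.slice_entries_mulVec _ hR.vec hR.minor hr' hr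
    refine ⟨_, fun h0 => R.vec_ne i ?_, hsingle⟩
    rw [h0, zero_smul] at hsingle
    have := congrArg (S.straighten R)⁻¹.mulVec hsingle
    rwa [Matrix.mulVec_mulVec, Matrix.nonsing_inv_mul _ hunit, Matrix.one_mulVec,
      Matrix.mulVec_zero] at this

theorem Frame.straightForm_conf {S : Pos N} (D : Frame S d) (hD : S.straighten D.conf = D.h)
    (i : Fin 2) : S.straightForm D.conf i = D.F := by
  rw [Pos.straightForm, hD]
  exact comp_cancel_inv _ D.unit

end ChartDefs

/-! ### Regularity of the chart coordinates -/

section ChartRegular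

variable {N d : ℕ}

theorem Pos.entries_mem_reg (S : Pos N) {D : Set (RawConfig N d 2)}
    (h1 : ∀ R ∈ D, ∀ i, R.eqn i (S.ρ i) ≠ 0) (h2 : ∀ R ∈ D, ∀ i, R.vec i (S.σ i) ≠ 0)
    (h3 : ∀ R ∈ D, S.minor R.vec ≠ 0) (r j : Fin (N + 1)) :
    (fun R : RawConfig N d 2 => S.entries R.eqn R.vec r j) ∈ Reg RawConfig.coord D := by
  have hv := vec_mem_reg (N := N) (d := d) (e := 2) D
  have hm : ∀ a b a' b' i i' k k', (fun R : RawConfig N d 2 => R.vec i a * R.vec i' b -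
      R.vec k a' * R.vec k' b') ∈ Reg RawConfig.coord D := fun a b a' b' i i' k k' =>
    (Reg _ _).sub_mem ((Reg _ _).mul_mem (hv _ _) (hv _ _)) ((Reg _ _).mul_mem (hv _ _) (hv _ _))
  unfold Pos.entries
  split_ifs
  · exact div_mem_reg (eqn_mem_reg _ _ _) (eqn_mem_reg _ _ _) fun R hR => h1 R hR 0
  · exact div_mem_reg (eqn_mem_reg _ _ _) (eqn_mem_reg _ _ _) fun R hR => h1 R hR 1
  · exact div_mem_reg ((Reg _ _).neg_mem (hv _ _)) (hv _ _) fun R hR => h2 R hR 0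
  · exact div_mem_reg ((Reg _ _).neg_mem (hm _ _ _ _ _ _ _ _)) (hm _ _ _ _ _ _ _ _) h3
  · exact div_mem_reg ((Reg _ _).neg_mem (hv _ _)) (hv _ _) fun R hR => h2 R hR 1
  · exact div_mem_reg ((Reg _ _).neg_mem (hm _ _ _ _ _ _ _ _)) (hm _ _ _ _ _ _ _ _) h3

theorem Pos.slice_mem_reg {X ι : Type*} {c : X → ι → ℂ} {D : Set X} (S : Pos N)
    {f : X → Fin (N + 1) → Fin (N + 1) → ℂ} (hf : ∀ q : S.Free, (fun x => f x q.1.1 q.1.2) ∈ Reg c D)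
    (r j : Fin (N + 1)) : (fun x => S.slice (f x) r j) ∈ Reg c D := by
  unfold Pos.slice
  split_ifs with h1 h2
  · exact const_mem_reg c D 1
  · exact hf ⟨(r, j), h1, h2⟩
  · exact const_mem_reg c D 0

theorem Pos.straightForm_mem_reg (S : Pos N) {D : Set (RawConfig N d 2)}
    (h1 : ∀ R ∈ D, ∀ i, R.eqn i (S.ρ i) ≠ 0) (h2 : ∀ R ∈ D, ∀ i, R.vec i (S.σ i) ≠ 0)
    (h3 : ∀ R ∈ D, S.minor R.vec ≠ 0) (h4 : ∀ R ∈ D, (S.straighten R).det ≠ 0) (i : Fin 2)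
    (m : Fin (N + 1) →₀ ℕ) :
    (fun R : RawConfig N d 2 => coeff m (S.straightForm R i).1) ∈ Reg RawConfig.coord D :=
  coeff_comp_mem_reg (F := fun R : RawConfig N d 2 => R.form i)
    (A := fun R => (S.straighten R)⁻¹) (coeff_form_mem_reg D i)
    (matInv_mem_reg (S.slice_mem_reg fun q => S.entries_mem_reg h1 h2 h3 q.1.1 q.1.2) h4) m

/-- The conditions are imposed in stages, because each quantity is regular only where the earlier
denominators do not vanish: the entries, then the determinant, then the pivot coefficients. -/
theorem Pos.isOpen_inChart (S : Pos N) (μ : Fin 2 → Fin (N + 1) →₀ ℕ) :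
    IsOpen {R : RawConfig N d 2 | S.InChart μ R} := by
  have hv := vec_mem_reg (N := N) (d := d) (e := 2) Set.univ
  let f₁ (R : RawConfig N d 2) : ℂ :=
    R.eqn 0 (S.ρ 0) * R.eqn 1 (S.ρ 1) * (R.vec 0 (S.σ 0) * R.vec 1 (S.σ 1)) * S.minor R.vec
  have hf₁ : f₁ ∈ Reg RawConfig.coord Set.univ := by
    refine (Reg _ _).mul_mem ((Reg _ _).mul_mem ((Reg _ _).mul_mem (eqn_mem_reg _ _ _)
      (eqn_mem_reg _ _ _)) ((Reg _ _).mul_mem (hv _ _) (hv _ _))) ?_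
    exact (Reg _ _).sub_mem ((Reg _ _).mul_mem (hv _ _) (hv _ _))
      ((Reg _ _).mul_mem (hv _ _) (hv _ _))
  have hO₁ := isCoord_raw.isOpen_reg isOpen_univ hf₁
  set O₁ := {R : RawConfig N d 2 | R ∈ Set.univ ∧ f₁ R ≠ 0} with hO₁def
  have key : ∀ R, R ∈ O₁ ↔ (∀ i, R.eqn i (S.ρ i) ≠ 0) ∧ (∀ i, R.vec i (S.σ i) ≠ 0) ∧
      S.minor R.vec ≠ 0 := fun R => by
    simp only [hO₁def, Set.mem_univ, true_and, f₁, Set.mem_ofPred_eq, mul_ne_zero_iff,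
      Fin.forall_fin_two]
    tauto
  have hO₂ := isCoord_raw.isOpen_reg hO₁ (f := fun R => (S.straighten R).det)
    (det_mem_reg (S.slice_mem_reg fun q => S.entries_mem_reg (fun R hR => ((key R).1 hR).1)
      (fun R hR => ((key R).1 hR).2.1) (fun R hR => ((key R).1 hR).2.2) _ _))
  have hform := S.straightForm_mem_reg (D := {R : RawConfig N d 2 | R ∈ O₁ ∧ (S.straighten R).det ≠ 0})
    (fun R hR => ((key R).1 hR.1).1) (fun R hR => ((key R).1 hR.1).2.1)
    (fun R hR => ((key R).1 hR.1).2.2) (fun R hR => hR.2)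
  have hO₃ := isCoord_raw.isOpen_reg hO₂ ((Reg _ _).mul_mem (hform 0 (μ 0)) (hform 1 (μ 1)))
  convert hO₃ using 1
  ext R
  have h3 : (((fun R : RawConfig N d 2 => coeff (μ 0) (S.straightForm R 0).1) *
      fun R : RawConfig N d 2 => coeff (μ 1) (S.straightForm R 1).1) R ≠ 0) ↔
      ∀ i, coeff (μ i) (S.straightForm R i).1 ≠ 0 := by
    rw [Pi.mul_apply, mul_ne_zero_iff, Fin.forall_fin_two]
  constructor
  · intro h
    exact ⟨⟨(key R).2 ⟨h.eqn, h.vec, h.minor⟩, h.det⟩, h3.2 h.pivot⟩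
  · rintro ⟨⟨h1, h2⟩, h4⟩
    obtain ⟨a, b, c⟩ := (key R).1 h1
    exact ⟨a, b, c, h2, h3.1 h4⟩

end ChartRegular

/-! ### The chart, its translates, and the dimension of a family of frames -/

section Chart

variable {N d : ℕ}

/-- The index set of the coordinates of the chart. -/
abbrev Pos.ChartIndex (S : Pos N) (d : ℕ) (μ : Fin 2 → Fin (N + 1) →₀ ℕ) : Type :=
  S.Free ⊕ S.CoeffIndex d (pivotSet μ)

open Classical in
/-- The matrix with given free entries. -/
def Pos.chartMatrix (S : Pos N) {μ : Fin 2 → Fin (N + 1) →₀ ℕ} (u : Aff (S.ChartIndex d μ)) :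
    Matrix (Fin (N + 1)) (Fin (N + 1)) ℂ :=
  S.slice fun r j => if h : r ≠ j ∧ (r ∈ Set.range S.ρ ∨ j ∈ Set.range S.σ) then
    u.coord (.inl ⟨(r, j), h⟩) else 0

/-- The normalized form with given free coefficients. -/
def Pos.chartForm (S : Pos N) {μ : Fin 2 → Fin (N + 1) →₀ ℕ} (u : Aff (S.ChartIndex d μ)) :
    Form N d :=
  S.paramForm d (pivotSet μ) fun m => u.coord (.inr m)

/-- The coordinates of a configuration in the chart. -/
def Pos.chartCoord (S : Pos N) (μ : Fin 2 → Fin (N + 1) →₀ ℕ) (R : RawConfig N d 2) :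
    Aff (S.ChartIndex d μ) :=
  ⟨Sum.elim (fun q => S.entries R.eqn R.vec q.1.1 q.1.2) (S.normCoeff μ (S.straightForm R))⟩

theorem Pos.chartMatrix_chartCoord (S : Pos N) (μ : Fin 2 → Fin (N + 1) →₀ ℕ)
    (R : RawConfig N d 2) : S.chartMatrix (S.chartCoord μ R) = S.straighten R :=
  Pos.slice_congr fun q => by rw [dif_pos q.2]; rfl

theorem Pos.chartCoord_congr {S : Pos N} {μ : Fin 2 → Fin (N + 1) →₀ ℕ} (hμ : S.IsPivot d μ)
    {R R' : RawConfig N d 2} (hR : S.InChart μ R) (h : R.toConfig = R'.toConfig) :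
    S.chartCoord μ R' = S.chartCoord μ R := by
  obtain ⟨n, hn, hnf⟩ := Pos.straightForm_congr h hR.det hR.eqn
  have h' := (toConfig_eq_iff R R').1 h
  choose ha hp _ using h'
  choose k hk hka using ha
  choose l hl hlp using hp
  unfold Pos.chartCoord
  rw [show R'.eqn = fun i => k i • R.eqn i from funext hka,
    show R'.vec = fun i => l i • R.vec i from funext hlp, S.entries_smul _ _ hk hl,
    Pos.normCoeff_congr hμ hn hnf]

theorem Frame.entries_conf {S : Pos N} {μ : Fin 2 → Fin (N + 1) →₀ ℕ} (D : Frame S d)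
    {u : Aff (S.ChartIndex d μ)} (hh : D.h = S.chartMatrix u)
    (h0 : ∀ i, D.conf.vec i (S.σ i) ≠ 0) (hδ : S.minor D.conf.vec ≠ 0) (q : S.Free) :
    S.entries D.conf.eqn D.conf.vec q.1.1 q.1.2 = u.coord (.inl q) := by
  have := Pos.entries_unique (a := D.conf.eqn) (p := D.conf.vec) (f := fun r j => if h : r ≠ j ∧
    (r ∈ Set.range S.ρ ∨ j ∈ Set.range S.σ) then u.coord (.inl ⟨(r, j), h⟩) else 0) h0 hδ
    (fun k j hj => ?_) (fun i r _ hr => ?_) q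
  · rw [this, dif_pos q.2]
  · have h1 : D.conf.eqn k (S.ρ k) = 1 := by
      change D.h _ _ = 1
      rw [hh]; simp [Pos.chartMatrix, Pos.slice]
    have h2 : D.conf.eqn k j = S.chartMatrix u (S.ρ k) j := by rw [← hh]; rfl
    rw [h1, div_one, h2]
    simp [Pos.chartMatrix, Pos.slice, hj.symm]
  · change (S.chartMatrix u).mulVec _ _ = 0
    rw [← hh, D.mulVec_conf_vec, Pi.single_eq_of_ne hr]

theorem Frame.straighten_conf {S : Pos N} {μ : Fin 2 → Fin (N + 1) →₀ ℕ} (D : Frame S d)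
    {u : Aff (S.ChartIndex d μ)} (hh : D.h = S.chartMatrix u)
    (h0 : ∀ i, D.conf.vec i (S.σ i) ≠ 0) (hδ : S.minor D.conf.vec ≠ 0) :
    S.straighten D.conf = D.h := by
  rw [hh]
  exact Pos.slice_congr fun q => by rw [D.entries_conf hh h0 hδ q, dif_pos q.2]

theorem coeff_chartForm_pivot {S : Pos N} {μ : Fin 2 → Fin (N + 1) →₀ ℕ} (hμ : S.IsPivot d μ)
    (u : Aff (S.ChartIndex d μ)) (i : Fin 2) : coeff (μ i) (S.chartForm u).1 = 1 := by
  refine S.coeff_paramForm_pivot _ ?_ (hμ.degree i) (hμ.allowed i)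
  fin_cases i <;> simp

theorem Frame.chartCoord_conf {S : Pos N} {μ : Fin 2 → Fin (N + 1) →₀ ℕ} (hμ : S.IsPivot d μ)
    (D : Frame S d) {u : Aff (S.ChartIndex d μ)} (hh : D.h = S.chartMatrix u)
    (hF : D.F = S.chartForm u) (h0 : ∀ i, D.conf.vec i (S.σ i) ≠ 0)
    (hδ : S.minor D.conf.vec ≠ 0) : S.chartCoord μ D.conf = u := by
  ext q
  rcases q with q | m
  · exact D.entries_conf hh h0 hδ q
  · change S.normCoeff μ (S.straightForm D.conf) m = _
    rw [Pos.normCoeff, D.straightForm_conf (D.straighten_conf hh h0 hδ), hF,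
      coeff_chartForm_pivot hμ, div_one]
    exact S.coeff_paramForm _ _ m

/-- The domain of the chart. -/
def Pos.chartSet (S : Pos N) (d : ℕ) (μ : Fin 2 → Fin (N + 1) →₀ ℕ) :
    Set (Aff (S.ChartIndex d μ)) :=
  {u | ∃ D : Frame S d, D.h = S.chartMatrix u ∧ D.F = S.chartForm u ∧ S.InChart μ D.conf}

/-- The frame given by a point of the chart. -/
def Pos.chartFrame (S : Pos N) {μ : Fin 2 → Fin (N + 1) →₀ ℕ} (u : S.chartSet d μ) : Frame S d :=
  u.2.choose

theorem Pos.chartFrame_h (S : Pos N) {μ : Fin 2 → Fin (N + 1) →₀ ℕ} (u : S.chartSet d μ) :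
    (S.chartFrame u).h = S.chartMatrix u.1 := u.2.choose_spec.1

theorem Pos.chartFrame_F (S : Pos N) {μ : Fin 2 → Fin (N + 1) →₀ ℕ} (u : S.chartSet d μ) :
    (S.chartFrame u).F = S.chartForm u.1 := u.2.choose_spec.2.1

theorem Pos.inChart_chartFrame (S : Pos N) {μ : Fin 2 → Fin (N + 1) →₀ ℕ} (u : S.chartSet d μ) :
    S.InChart μ (S.chartFrame u).conf := u.2.choose_spec.2.2

theorem Frame.ext_fields {S : Pos N} {D D' : Frame S d} (h1 : D.h = D'.h) (h2 : D.F = D'.F) :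
    D = D' := by
  cases D; cases D'; simp_all

/-- The frame straightening `R` can be normalized without changing its configuration, and the
normalized coefficients are those computed from the forms of `R` alone. -/
theorem exists_frame_chartCoord {S : Pos N} {μ : Fin 2 → Fin (N + 1) →₀ ℕ} (hμ : S.IsPivot d μ)
    {R : RawConfig N d 2} (hR : S.InChart μ R) (hmem : R.toConfig ∈ frameConfigs S d) :
    ∃ D : Frame S d, D.h = S.chartMatrix (S.chartCoord μ R) ∧
      D.F = S.chartForm (S.chartCoord μ R) ∧ D.conf.toConfig = R.toConfig := by
  obtain ⟨D, hDh, hD⟩ := exists_frame_of_inChart hR hmem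
  have hRD := hR.congr hμ hD.symm
  have hform := D.straightForm_conf (by rw [hDh, Pos.straighten_congr hD.symm])
  have hne : ∀ i, coeff (μ i) D.F.1 ≠ 0 := fun i => by
    rw [← hform i]; exact hRD.pivot i
  refine ⟨_, ?_, ?_, (toConfig_normalize hμ D hne).trans hD⟩
  · rw [S.chartMatrix_chartCoord]; exact hDh
  · rw [← Pos.chartCoord_congr hμ hR hD.symm]
    change S.paramForm d _ (S.normCoeff μ _) = S.paramForm d _ (S.normCoeff μ _)
    rw [show S.straightForm D.conf = fun _ => D.F from funext hform]

theorem chartCoord_mem {S : Pos N} {μ : Fin 2 → Fin (N + 1) →₀ ℕ} (hμ : S.IsPivot d μ)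
    {R : RawConfig N d 2} (hR : S.InChart μ R) (hmem : R.toConfig ∈ frameConfigs S d) :
    S.chartCoord μ R ∈ S.chartSet d μ := by
  obtain ⟨D, h1, h2, h3⟩ := exists_frame_chartCoord hμ hR hmem
  exact ⟨D, h1, h2, hR.congr hμ h3.symm⟩

theorem toConfig_chartFrame_chartCoord {S : Pos N} {μ : Fin 2 → Fin (N + 1) →₀ ℕ}
    (hμ : S.IsPivot d μ) {R : RawConfig N d 2} (hR : S.InChart μ R)
    (hmem : R.toConfig ∈ frameConfigs S d) :
    (S.chartFrame ⟨_, chartCoord_mem hμ hR hmem⟩).conf.toConfig = R.toConfig := by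
  obtain ⟨D, h1, h2, h3⟩ := exists_frame_chartCoord hμ hR hmem
  rw [← h3]
  congr 2
  exact Frame.ext_fields ((S.chartFrame_h _).trans h1.symm) ((S.chartFrame_F _).trans h2.symm)

theorem Pos.chartMatrix_mem_reg (S : Pos N) (μ : Fin 2 → Fin (N + 1) →₀ ℕ) (r j : Fin (N + 1)) :
    (fun u : Aff (S.ChartIndex d μ) => S.chartMatrix u r j) ∈ Reg Aff.coord Set.univ := by
  refine S.slice_mem_reg (fun q => ?_) r j
  simp only [dif_pos q.2]
  exact coord_mem_reg _ _ _

theorem Pos.chartForm_mem_reg (S : Pos N) (μ : Fin 2 → Fin (N + 1) →₀ ℕ)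
    (m : Fin (N + 1) →₀ ℕ) :
    (fun u : Aff (S.ChartIndex d μ) => coeff m (S.chartForm u).1) ∈ Reg Aff.coord Set.univ :=
  S.coeff_paramForm_mem_reg _ (fun _ => coord_mem_reg _ _ _) m

theorem continuous_chartFrame (S : Pos N) (μ : Fin 2 → Fin (N + 1) →₀ ℕ) :
    Continuous fun u : S.chartSet d μ => (S.chartFrame u).conf := by
  refine continuous_conf (isCoord_aff.comp IsInducing.subtypeVal) (fun i j => ?_) fun m => ?_
  · simp only [S.chartFrame_h]
    exact reg_comp (S.chartMatrix_mem_reg μ i j) fun _ _ => trivial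
  · simp only [S.chartFrame_F]
    exact reg_comp (S.chartForm_mem_reg μ m) fun _ _ => trivial

theorem continuous_chartCoord (S : Pos N) (μ : Fin 2 → Fin (N + 1) →₀ ℕ) :
    Continuous fun R : {R : RawConfig N d 2 // S.InChart μ R} => S.chartCoord μ R.1 := by
  let O := {R : RawConfig N d 2 | S.InChart μ R}
  refine (isCoord_raw.comp IsInducing.subtypeVal).continuous_of_reg isCoord_aff fun q => ?_
  rcases q with q | m
  · exact reg_comp (S.entries_mem_reg (D := O) (fun R hR => hR.eqn) (fun R hR => hR.vec)
      (fun R hR => hR.minor) q.1.1 q.1.2) fun R _ => R.2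
  · have h := S.straightForm_mem_reg (D := O) (fun R hR => hR.eqn) (fun R hR => hR.vec)
      (fun R hR => hR.minor) (fun R hR => hR.det)
    exact reg_comp (div_mem_reg (h _ _) (h _ _) fun R hR => hR.pivot _) fun R _ => R.2

theorem continuousOn_chartCoord (S : Pos N) (μ : Fin 2 → Fin (N + 1) →₀ ℕ) :
    ContinuousOn (S.chartCoord (d := d) μ) {R | S.InChart μ R} :=
  continuousOn_iff_continuous_domRestrict.2 (continuous_chartCoord S μ)

/-- The chart, translated by an invertible matrix, is an open embedding. -/
theorem isOpenEmbedding_act_chart {S : Pos N} {μ : Fin 2 → Fin (N + 1) →₀ ℕ} (hμ : S.IsPivot d μ)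
    {g : Matrix (Fin (N + 1)) (Fin (N + 1)) ℂ} (hg : IsUnit g.det) (hg' : IsUnit g⁻¹.det) :
    IsOpenEmbedding fun u : S.chartSet d μ =>
      (⟨(act g⁻¹ hg' (S.chartFrame u).conf).toConfig,
        act_mem_frameConfigs hg' ⟨_, rfl⟩⟩ : frameConfigs S d) := by
  let ψ (r : {r : RawConfig N d 2 // r ∈ act g hg ⁻¹' {R | S.InChart μ R} ∧
      r.toConfig ∈ frameConfigs S d}) : S.chartSet d μ :=
    ⟨S.chartCoord μ (act g hg r.1), chartCoord_mem hμ r.2.1 (act_mem_frameConfigs hg r.2.2)⟩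
  refine isOpenEmbedding_chart continuous_toConfig isOpenMap_toConfig
    (φ := fun u => act g⁻¹ hg' (S.chartFrame u).conf)
    ((continuous_act hg').comp (continuous_chartFrame S μ))
    (fun u => act_mem_frameConfigs hg' ⟨_, rfl⟩)
    (O := act g hg ⁻¹' {R | S.InChart μ R})
    ((S.isOpen_inChart μ).preimage (continuous_act hg)) (fun u => ?_) (ψ := ψ) ?_ ?_ ?_ ?_
  · change S.InChart μ _
    rw [act_act_inv hg hg']
    exact S.inChart_chartFrame u
  · refine Continuous.subtype_mk ?_ _
    have h1 : Continuous fun r : {r : RawConfig N d 2 // r ∈ act g hg ⁻¹' {R | S.InChart μ R} ∧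
        r.toConfig ∈ frameConfigs S d} => act g hg r.1 :=
      (continuous_act hg).comp continuous_subtype_val
    exact (continuousOn_chartCoord (d := d) S μ).comp_continuous h1 fun r => r.2.1
  · intro r
    have h3 : (S.chartFrame (ψ r)).conf.toConfig = (act g hg r.1).toConfig :=
      toConfig_chartFrame_chartCoord hμ r.2.1 (act_mem_frameConfigs hg r.2.2)
    refine (toConfig_act hg' h3).trans ?_
    rw [act_inv_act hg hg']
  · intro r r' h
    exact Subtype.ext (Pos.chartCoord_congr hμ r'.2.1 (toConfig_act hg h.symm))
  · intro u
    refine Subtype.ext ?_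
    change S.chartCoord μ (act g hg (act g⁻¹ hg' _)) = _
    rw [act_act_inv hg hg']
    exact Frame.chartCoord_conf hμ _ (S.chartFrame_h u) (S.chartFrame_F u)
      (S.inChart_chartFrame u).vec (S.inChart_chartFrame u).minor

/-- The point of the chart given by the identity matrix and the normalization of a form. -/
def Pos.chartPoint (S : Pos N) (μ : Fin 2 → Fin (N + 1) →₀ ℕ) (F : Form N d) :
    Aff (S.ChartIndex d μ) :=
  ⟨Sum.elim (fun _ => 0) (S.normCoeff μ fun _ => F)⟩

theorem Pos.chartMatrix_chartPoint (S : Pos N) (μ : Fin 2 → Fin (N + 1) →₀ ℕ) (F : Form N d) :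
    S.chartMatrix (S.chartPoint μ F) = 1 := by
  classical
  funext r j
  simp only [Pos.chartMatrix, Pos.slice, Pos.chartPoint, Sum.elim_inl, dite_eq_ite, ite_self,
    Matrix.one_apply]

theorem chartPoint_inChart {S : Pos N} {μ : Fin 2 → Fin (N + 1) →₀ ℕ} (hμ : S.IsPivot d μ)
    {F : Form N d} (D : Frame S d)
    (hh : D.h = S.chartMatrix (S.chartPoint μ F)) (hDF : D.F = S.chartForm (S.chartPoint μ F)) :
    S.InChart μ D.conf := by
  have h1 : D.h = 1 := hh.trans (S.chartMatrix_chartPoint μ F)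
  have hv : ∀ i r, D.conf.vec i r = if r = S.σ i then 1 else 0 := fun i r => by
    change D.h⁻¹ r (S.σ i) = _
    rw [h1, inv_one, Matrix.one_apply]
  have h10 : S.σ 1 ≠ S.σ 0 := S.σ_inj.ne (by simp)
  have hvec : ∀ i, D.conf.vec i (S.σ i) ≠ 0 := fun i => by simp [hv]
  have hmin : S.minor D.conf.vec ≠ 0 := by simp [Pos.minor, hv, h10]
  have hst := D.straighten_conf hh hvec hmin
  refine ⟨fun i => ?_, hvec, hmin, ?_, fun i => ?_⟩
  · change D.h _ _ ≠ 0
    simp [h1]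
  · rw [hst, h1]; simp
  · rw [D.straightForm_conf hst, hDF, coeff_chartForm_pivot hμ]
    exact one_ne_zero

/-- At the identity matrix every determinant and minor involved equals 1 and the form has smooth
cones. All these are open conditions. -/
theorem chartSet_mem_nhds (hd : d ≠ 0) {S : Pos N} {μ : Fin 2 → Fin (N + 1) →₀ ℕ}
    (hμ : S.IsPivot d μ) {F : Form N d} (hF : S.StdGood F) (hne : ∀ i, coeff (μ i) F.1 ≠ 0) :
    S.chartSet d μ ∈ 𝓝 (S.chartPoint μ F) := by
  let Q : Set (Aff (S.ChartIndex d μ)) :=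
    {u | (S.chartMatrix u).det ≠ 0 ∧ S.StdGood (S.chartForm u)}
  have hQ : Q ∈ 𝓝 (S.chartPoint μ F) := by
    refine Filter.inter_mem ?_ ?_
    · have := (isCoord_aff.isOpen_reg isOpen_univ
        (det_mem_reg (S.chartMatrix_mem_reg (d := d) μ))).mem_nhds (x := S.chartPoint μ F)
        ⟨trivial, by simp [S.chartMatrix_chartPoint μ F]⟩
      exact Filter.mem_of_superset this fun x hx => hx.2
    · exact eventually_stdGood isCoord_aff hd (fun m => S.chartForm_mem_reg μ m.1)
        (fun x => S.adapted_paramForm _ _) (hF.normalize hμ hne)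
  let φ : Q → Frame S d := fun u => ⟨_, _, isUnit_iff_ne_zero.2 u.2.1, u.2.2⟩
  have hφ : Continuous fun u => (φ u).conf := by
    refine continuous_conf (isCoord_aff.comp IsInducing.subtypeVal) (fun i j => ?_) fun m => ?_
    · exact reg_comp (S.chartMatrix_mem_reg μ i j) fun _ _ => trivial
    · exact reg_comp (S.chartForm_mem_reg μ m) fun _ _ => trivial
  have hopen := (S.isOpen_inChart μ).preimage hφ
  have hmem := hopen.mem_nhds (x := ⟨_, mem_of_mem_nhds hQ⟩)
    (chartPoint_inChart hμ (F := F) _ rfl rfl)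
  have := Filter.image_mem_map (m := Subtype.val) hmem
  have hmap : Filter.map Subtype.val (𝓝 (⟨S.chartPoint μ F, mem_of_mem_nhds hQ⟩ : Q)) =
      𝓝 (S.chartPoint μ F) := map_nhds_subtype_coe_eq_nhds (mem_of_mem_nhds hQ) hQ
  rw [hmap] at this
  refine Filter.mem_of_superset this ?_
  rintro _ ⟨u, hu, rfl⟩
  exact ⟨φ u, rfl, rfl, hu⟩

instance (S : Pos N) (P : Finset (Fin (N + 1) →₀ ℕ)) : Finite (S.CoeffIndex d P) := by
  have : Set.Finite {m : Fin (N + 1) →₀ ℕ | m.degree = d ∧ S.Allowed m ∧ m ∉ P} :=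
    (monos N d).finite_toSet.subset fun m hm => by simpa [mem_monos] using hm.1
  exact this.to_subtype

/-- The dimension of the set of configurations given by frames. -/
theorem topologicalKrullDim_frameConfigs (hd : d ≠ 0) (S : Pos N) {n : ℕ} {F₀ : Form N d}
    (hF₀ : S.StdGood F₀)
    (hcov : ∀ F : Form N d, S.StdGood F → ∃ μ : Fin 2 → Fin (N + 1) →₀ ℕ, S.IsPivot d μ ∧
      (∀ i, coeff (μ i) F.1 ≠ 0) ∧ Nat.card (S.ChartIndex d μ) = n) :
    topologicalKrullDim (frameConfigs S d) = n := by
  apply le_antisymm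
  · refine topologicalKrullDim_le_of_cover fun L => ?_
    obtain ⟨L, D, rfl⟩ := L
    obtain ⟨μ, hμ, hne, hn⟩ := hcov D.F D.good
    -- Translating by `D.h` moves the frame to one with identity matrix, so charts around the
    -- standard position cover everything.
    have hg' : IsUnit D.h⁻¹.det := Matrix.isUnit_nonsing_inv_det _ D.unit
    have hemb := isOpenEmbedding_act_chart hμ D.unit hg'
    refine ⟨_, hemb.isOpen_range, ?_, ?_⟩
    · let u : S.chartSet d μ := ⟨_, mem_of_mem_nhds (chartSet_mem_nhds hd hμ D.good hne)⟩
      refine ⟨u, Subtype.ext ?_⟩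
      change (act D.h⁻¹ hg' (S.chartFrame u).conf).toConfig = D.conf.toConfig
      rw [act_conf _ hg' ⟨D.h, _, D.unit, D.good.normalize hμ hne⟩ ?_ ?_,
        toConfig_normalize hμ D hne]
      · rw [S.chartFrame_h, S.chartMatrix_chartPoint, one_mul,
          Matrix.nonsing_inv_nonsing_inv _ D.unit]
      · rw [S.chartFrame_F]; rfl
    · rw [← hn]
      exact (IsInducing.topologicalKrullDim_le
        hemb.isEmbedding.toHomeomorph.symm.isInducing).trans
        (topologicalKrullDim_le_of_isCoord (isCoord_aff.comp IsInducing.subtypeVal))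
  -- For the lower bound one chart is enough: its domain contains a neighbourhood in affine space
  -- and embeds into the family.
  · obtain ⟨μ, hμ, hne, hn⟩ := hcov F₀ hF₀
    have h1 : IsUnit (1 : Matrix (Fin (N + 1)) (Fin (N + 1)) ℂ).det := by simp
    have hemb := isOpenEmbedding_act_chart hμ h1 (by simp)
    rw [← hn]
    exact (le_topologicalKrullDim_of_mem_nhds (chartSet_mem_nhds hd hμ hF₀ hne)).trans
      (IsInducing.topologicalKrullDim_le hemb.isInducing)

end Chart

end StarPoints

end

noncomputable section

namespace StarPoints

open Module MvPolynomial Topology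

/-! ### Forms in standard position -/

section StandardForms

variable {N d : ℕ}

theorem posV_allowed_iff (hN : 3 ≤ N) (m : Fin (N + 1) →₀ ℕ) :
    (posV hN).Allowed m ↔ ∀ i, m ((posV hN).ρ i) = 0 := by
  have h0 : (posV hN).σ 0 = (posV hN).ρ 1 := Fin.ext (by simp)
  have h1 : (posV hN).σ 1 = (posV hN).ρ 0 := Fin.ext (by simp)
  simp only [Pos.Allowed, Fin.exists_fin_two, Fin.forall_fin_two, h0, h1]
  tauto

theorem posW_ρ_ne_σ (hN : 3 ≤ N) (i j : Fin 2) : (posW hN).ρ i ≠ (posW hN).σ j := fun h => by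
  have := congrArg Fin.val h
  simp only [posW_ρ_val, posW_σ_val] at this
  omega

/-- The Fermat form in the variables `X_2, …, X_N`. -/
def fermatV (N d : ℕ) : Form N d :=
  ⟨∑ j ∈ Finset.univ.filter (fun j : Fin (N + 1) => 2 ≤ j.1), X j ^ d,
    IsHomogeneous.sum _ _ _ fun _ _ => isHomogeneous_X_pow _ _⟩

theorem stdGood_fermatV (hN : 3 ≤ N) (hd : d ≠ 0) : (posV hN).StdGood (fermatV N d) := by
  classical
  have heval : ∀ x : Fin (N + 1) → ℂ, eval x (fermatV N d).1 =
      ∑ j ∈ Finset.univ.filter (fun j : Fin (N + 1) => 2 ≤ j.1), x j ^ d := fun x => by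
    simp [fermatV]
  refine ⟨fun m hm => ?_, fun i x hx hxp h0 => ?_, fun i => ?_⟩
  · have : ∃ j : Fin (N + 1), 2 ≤ j.1 ∧ m = Finsupp.single j d := by
      by_contra! hcon
      apply hm
      simp only [fermatV, coeff_sum]
      refine Finset.sum_eq_zero fun j hj => ?_
      rw [coeff_X_pow, if_neg fun h => hcon j (by simpa using hj) h.symm]
    obtain ⟨j, hj, rfl⟩ := this
    refine (posV_allowed_iff hN _).2 fun i => Finsupp.single_eq_of_ne fun h => ?_
    have := congrArg Fin.val h
    simp only [posV_ρ_val] at this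
    omega
  · have : ∃ j : Fin (N + 1), 2 ≤ j.1 ∧ x j ≠ 0 := by
      by_contra! hcon
      apply hxp (x ((posV hN).σ i))
      funext j
      by_cases hj : j = (posV hN).σ i
      · subst hj; simp
      · rw [Pi.smul_apply, Pi.single_eq_of_ne hj, smul_zero]
        by_cases h2 : 2 ≤ j.1
        · exact hcon j h2
        · have : j = (posV hN).ρ i := by
            refine Fin.ext ?_
            have h3 : j.1 ≠ 1 - i := fun h => hj (Fin.ext h)
            rw [posV_ρ_val]
            omega
          rw [this, hx]
    obtain ⟨j, hj, hxj⟩ := this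
    refine ⟨Pi.single j 1, ?_, ?_⟩
    · refine Pi.single_eq_of_ne (fun h => ?_) _
      have := congrArg Fin.val h
      simp only [posV_ρ_val] at this
      omega
    · rw [← eval_pderiv]
      simp only [fermatV, map_sum, Derivation.leibniz_pow, pderiv_X]
      rw [Finset.sum_eq_single j]
      · simp [hd, hxj]
      · intro k _ hk
        simp [Pi.single_eq_of_ne hk]
      · simp [hj]
  · have h2 : (⟨2, by omega⟩ : Fin (N + 1)) ≠ (posV hN).ρ i := fun h => by
      have := congrArg Fin.val h
      simp only [posV_ρ_val] at this
      omega
    refine ⟨Pi.single ⟨2, by omega⟩ 1, Pi.single_eq_of_ne h2.symm _, ?_⟩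
    rw [heval, Finset.sum_eq_single ⟨2, by omega⟩]
    · simp
    · intro k _ hk
      rw [Pi.single_eq_of_ne hk, zero_pow hd]
    · simp

/-- A form defining good cones in both hyperplanes in the position `posW`. -/
def fermatW (hN : 3 ≤ N) (hd : 1 ≤ d) : Form N d :=
  ⟨(∑ i : Fin 2, (X ((posW hN).ρ i) ^ d + X ((posW hN).ρ i) * X ((posW hN).σ i) ^ (d - 1))) +
    ∑ j ∈ Finset.univ.filter (fun j : Fin (N + 1) => 4 ≤ j.1), X j ^ d, by
    refine IsHomogeneous.add (IsHomogeneous.sum _ _ _ fun i _ => ?_)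
      (IsHomogeneous.sum _ _ _ fun _ _ => isHomogeneous_X_pow _ _)
    refine (isHomogeneous_X_pow _ _).add ?_
    have := (isHomogeneous_X ℂ ((posW hN).ρ i)).mul (isHomogeneous_X_pow ((posW hN).σ i) (d - 1))
    rwa [show 1 + (d - 1) = d by omega] at this⟩

theorem eval_pderiv_fermatW (hN : 3 ≤ N) (hd : 1 ≤ d) (x : Fin (N + 1) → ℂ) (k : Fin (N + 1)) :
    eval x (pderiv k (fermatW hN hd).1) =
      (∑ i : Fin 2, ((if k = (posW hN).ρ i then
        d * x ((posW hN).ρ i) ^ (d - 1) + x ((posW hN).σ i) ^ (d - 1) else 0) +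
        if k = (posW hN).σ i then
          x ((posW hN).ρ i) * ((d - 1 : ℕ) * x ((posW hN).σ i) ^ (d - 1 - 1)) else 0)) +
      if 4 ≤ k.1 then d * x k ^ (d - 1) else 0 := by
  classical
  simp only [fermatW, map_add, map_sum, Derivation.leibniz_pow, Derivation.leibniz, pderiv_X]
  congr 1
  · refine Finset.sum_congr rfl fun i _ => ?_
    by_cases h1 : k = (posW hN).ρ i
    · subst h1
      simp [posW_ρ_ne_σ hN i i]
    · by_cases h2 : k = (posW hN).σ i
      · subst h2
        simp [(posW_ρ_ne_σ hN i i).symm]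
      · simp [h1, h2]
  · split_ifs with h
    · rw [Finset.sum_eq_single k]
      · simp
      · intro j _ hj
        simp [Pi.single_eq_of_ne hj]
      · simp [h]
    · refine Finset.sum_eq_zero fun j hj => ?_
      have : j ≠ k := by
        rintro rfl
        exact h (by simpa using hj)
      simp [Pi.single_eq_of_ne this]

theorem eq_ρ_or_σ_of_lt (hN : 3 ≤ N) {j : Fin (N + 1)} (hj : ¬ 4 ≤ j.1) :
    (∃ i, j = (posW hN).ρ i) ∨ ∃ i, j = (posW hN).σ i := by
  by_cases h : j.1 < 2
  · exact Or.inl ⟨⟨j.1, h⟩, rfl⟩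
  · refine Or.inr ⟨⟨j.1 - 2, by omega⟩, Fin.ext ?_⟩
    simp only [posW_σ_val]
    omega

/-- On `Π_i` the form is of Fermat type in the variables of index at least 4, plus `x ^ d + x * y ^
(d - 1)` in the variables `x`, `y` with indices `ρ k`, `σ k`, where `k` is the other index. This
binary form has no singular zero other than the origin. -/
theorem stdGood_fermatW (hN : 3 ≤ N) (hd : 3 ≤ d) :
    (posW hN).StdGood (fermatW hN (by omega : 1 ≤ d)) := by
  classical
  set S := posW hN with hS
  have hne := posW_ρ_ne_σ hN
  rw [← hS] at hne
  have hρ4 : ∀ i, ¬ 4 ≤ (S.ρ i).1 := fun i => by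
    have : (S.ρ i).1 = i := posW_ρ_val hN i
    omega
  have hσ4 : ∀ i, ¬ 4 ≤ (S.σ i).1 := fun i => by
    have : (S.σ i).1 = i + 2 := posW_σ_val hN i
    omega
  refine ⟨fun m hm => ?_, fun i x hx hxp h0 => ?_, fun i => ?_⟩
  · have : (∃ i, m = Finsupp.single (S.ρ i) d) ∨
        (∃ i, m = Finsupp.single (S.ρ i) 1 + Finsupp.single (S.σ i) (d - 1)) ∨
        ∃ j : Fin (N + 1), 4 ≤ j.1 ∧ m = Finsupp.single j d := by
      by_contra! hcon
      apply hm
      have hmon : ∀ i, (X (S.ρ i) * X (S.σ i) ^ (d - 1) : MvPolynomial (Fin (N + 1)) ℂ) =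
          monomial (Finsupp.single (S.ρ i) 1 + Finsupp.single (S.σ i) (d - 1)) 1 := fun i => by
        rw [X_pow_eq_monomial, X, monomial_mul, one_mul]
      simp only [fermatW, coeff_add, coeff_sum, ← hS, hmon]
      rw [Finset.sum_eq_zero, Finset.sum_eq_zero, add_zero]
      · intro j hj
        rw [coeff_X_pow, if_neg fun h => hcon.2.2 j (by simpa using hj) h.symm]
      · intro i _
        rw [coeff_X_pow, if_neg fun h => hcon.1 i h.symm, coeff_monomial,
          if_neg fun h => hcon.2.1 i h.symm, add_zero]
    have hother : ∀ i : Fin 2, ∃ k, k ≠ i := fun i => ⟨1 - i, by fin_cases i <;> simp⟩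
    rcases this with ⟨i, rfl⟩ | ⟨i, rfl⟩ | ⟨j, hj, rfl⟩
    · obtain ⟨k, hk⟩ := hother i
      refine ⟨⟨k, ?_⟩, fun l hl => ?_⟩
      · rw [Finsupp.single_eq_of_ne (S.ρ_inj.ne hk)]
      · rw [Finsupp.single_eq_of_ne (hne i l).symm]
    · obtain ⟨k, hk⟩ := hother i
      refine ⟨⟨k, ?_⟩, fun l hl => ?_⟩
      · simp [Finsupp.single_eq_of_ne (S.ρ_inj.ne hk), Finsupp.single_eq_of_ne (hne k i)]
      · have hli : l ≠ i := by
          rintro rfl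
          simp at hl
        simp [Finsupp.single_eq_of_ne (S.σ_inj.ne hli), Finsupp.single_eq_of_ne (hne i l).symm]
    · have h1 : ∀ i, S.ρ i ≠ j := fun i h => hρ4 i (h ▸ hj)
      have h2 : ∀ i, S.σ i ≠ j := fun i h => hσ4 i (h ▸ hj)
      exact ⟨⟨0, Finsupp.single_eq_of_ne (h1 0)⟩, fun l _ => Finsupp.single_eq_of_ne (h2 l)⟩
  · by_cases h4 : ∃ j : Fin (N + 1), 4 ≤ j.1 ∧ x j ≠ 0
    · obtain ⟨j, hj, hxj⟩ := h4
      have h1 : ∀ i, j ≠ S.ρ i := fun i h => hρ4 i (h ▸ hj)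
      have h2 : ∀ i, j ≠ S.σ i := fun i h => hσ4 i (h ▸ hj)
      refine ⟨Pi.single j 1, Pi.single_eq_of_ne (h1 i).symm _, ?_⟩
      rw [← eval_pderiv, eval_pderiv_fermatW, ← hS]
      simp [h1, h2, hj, hxj]
      omega
    push Not at h4
    obtain ⟨k, hk⟩ : ∃ k : Fin 2, k ≠ i := ⟨1 - i, by fin_cases i <;> simp⟩
    have hcases : ∀ l : Fin 2, l = i ∨ l = k := fun l => by omega
    have hρk : S.ρ k ≠ S.ρ i := S.ρ_inj.ne hk
    have hσk : S.σ k ≠ S.σ i := S.σ_inj.ne hk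
    have hd1 : eval x (pderiv (S.ρ k) (fermatW hN (by omega : 1 ≤ d)).1) =
        d * x (S.ρ k) ^ (d - 1) + x (S.σ k) ^ (d - 1) := by
      rw [eval_pderiv_fermatW, ← hS, if_neg (hρ4 k), Finset.sum_eq_single k]
      · simp [hne]
      · intro l _ hl
        simp [hne, S.ρ_inj.eq_iff, hl.symm]
      · simp
    have hd2 : eval x (pderiv (S.σ k) (fermatW hN (by omega : 1 ≤ d)).1) =
        x (S.ρ k) * ((d - 1 : ℕ) * x (S.σ k) ^ (d - 1 - 1)) := by
      rw [eval_pderiv_fermatW, ← hS, if_neg (hσ4 k), Finset.sum_eq_single k]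
      · simp [(hne _ _).symm]
      · intro l _ hl
        simp [(hne _ _).symm, S.σ_inj.eq_iff, hl.symm]
      · simp
    by_cases hρ0 : eval x (pderiv (S.ρ k) (fermatW hN (by omega : 1 ≤ d)).1) = 0
    · by_cases hσ0 : eval x (pderiv (S.σ k) (fermatW hN (by omega : 1 ≤ d)).1) = 0
      · exfalso
        rw [hd2] at hσ0
        rw [hd1] at hρ0
        have hd1' : ((d - 1 : ℕ) : ℂ) ≠ 0 := by
          rw [Nat.cast_ne_zero]; omega
        have hdd : (d : ℂ) ≠ 0 := by
          rw [Nat.cast_ne_zero]; omega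
        -- Either factor of the `σ k`-derivative vanishes, and the `ρ k`-derivative then kills the
        -- remaining coordinate; `d ≥ 3` keeps the exponent `d - 2` positive.
        have hz : x (S.ρ k) = 0 ∧ x (S.σ k) = 0 := by
          rcases mul_eq_zero.1 hσ0 with h | h
          · rw [h, zero_pow (by omega), mul_zero, zero_add] at hρ0
            exact ⟨h, eq_zero_of_pow_eq_zero hρ0⟩
          · have h := eq_zero_of_pow_eq_zero ((mul_eq_zero.1 h).resolve_left hd1')
            rw [h, zero_pow (by omega), add_zero] at hρ0
            exact ⟨eq_zero_of_pow_eq_zero ((mul_eq_zero.1 hρ0).resolve_left hdd), h⟩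
        apply hxp (x (S.σ i))
        funext j
        by_cases hj : j = S.σ i
        · subst hj; simp
        · rw [Pi.smul_apply, Pi.single_eq_of_ne hj, smul_zero]
          by_cases hj4 : 4 ≤ j.1
          · exact h4 j hj4
          · rcases eq_ρ_or_σ_of_lt hN hj4 with ⟨l, hl⟩ | ⟨l, hl⟩
            · rw [hl]
              rcases hcases l with rfl | rfl
              exacts [hx, hz.1]
            · rcases hcases l with rfl | rfl
              · exact absurd hl hj
              · rw [hl]; exact hz.2
      · exact ⟨Pi.single (S.σ k) 1, Pi.single_eq_of_ne (hne i k) _, by rwa [← eval_pderiv]⟩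
    · exact ⟨Pi.single (S.ρ k) 1, Pi.single_eq_of_ne hρk.symm _, by rwa [← eval_pderiv]⟩
  · obtain ⟨k, hk⟩ : ∃ k : Fin 2, k ≠ i := ⟨1 - i, by fin_cases i <;> simp⟩
    refine ⟨Pi.single (S.ρ k) 1, Pi.single_eq_of_ne (S.ρ_inj.ne hk.symm) _, ?_⟩
    have hd0 : d ≠ 0 := by omega
    simp only [fermatW, map_add, map_sum, map_pow, map_mul, eval_X, ← hS]
    rw [Finset.sum_eq_single k, Finset.sum_eq_zero]
    · simp [Pi.single_eq_of_ne (hne k k).symm, show d - 1 ≠ 0 by omega]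
    · intro j hj
      have : j ≠ S.ρ k := fun h => hρ4 k (h ▸ by simpa using hj)
      rw [Pi.single_eq_of_ne this, zero_pow hd0]
    · intro l _ hl
      simp [Pi.single_eq_of_ne (S.ρ_inj.ne hl), hd0]
    · simp

theorem exists_coeff_ne {F : Form N d} {x : Fin (N + 1) → ℂ} (hx : eval x F.1 ≠ 0) :
    ∃ m, coeff m F.1 ≠ 0 ∧ ∀ j, x j = 0 → m j = 0 := by
  rw [eval_form] at hx
  obtain ⟨m, -, hm⟩ := Finset.exists_ne_zero_of_sum_ne_zero hx
  refine ⟨m, left_ne_zero_of_mul hm, fun j hj => ?_⟩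
  by_contra h
  exact right_ne_zero_of_mul hm (Finset.prod_eq_zero (Finset.mem_univ j) (by simp [hj, h]))

/-- Allowed monomials here avoid both `ρ`-variables, so any monomial of `F` serves as a common
pivot. -/
theorem exists_pivot_posV (hN : 3 ≤ N) {F : Form N d} (hF : (posV hN).StdGood F) :
    ∃ m, (posV hN).IsPivot d (fun _ => m) ∧ coeff m F.1 ≠ 0 := by
  obtain ⟨x, -, hx⟩ := hF.nonzero 0
  obtain ⟨m, hm, -⟩ := exists_coeff_ne hx
  have hal := hF.adapted m hm
  exact ⟨m, ⟨fun _ => degree_eq_of_mem_support F (mem_support_iff.2 hm), fun _ => hal,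
    (posV_allowed_iff hN m).1 hal, Or.inl rfl⟩, hm⟩

/-- The smoothness of the cones along the line through the two points forces a coefficient to be
nonzero. -/
theorem coeff_ne_zero_posW (hN : 3 ≤ N) (hd : 3 ≤ d) {F : Form N d} (hF : (posW hN).StdGood F)
    (k : Fin 2) :
    coeff (Finsupp.single ((posW hN).ρ k) 1 + Finsupp.single ((posW hN).σ k) (d - 1)) F.1 ≠ 0 := by
  classical
  set S := posW hN with hS
  have hne := posW_ρ_ne_σ hN
  rw [← hS] at hne
  intro hcoeff
  obtain ⟨i, hik⟩ : ∃ i : Fin 2, i ≠ k := ⟨1 - k, by fin_cases k <;> simp⟩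
  have hx0 : (Pi.single (S.σ k) 1 : Fin (N + 1) → ℂ) (S.ρ i) = 0 :=
    Pi.single_eq_of_ne (hne i k) _
  -- At the point `P_k` only monomials of degree at least `d - 1` in the variable `σ k` contribute
  -- to the value or a first derivative. Among these, `X_{ρ k} X_{σ k}^(d-1)` is the only allowed
  -- one, and its coefficient is assumed zero; so `F` would be singular at `P_k`, which is a point
  -- of the other cone off its vertex.
  have hsingle : ∀ m, coeff m F.1 ≠ 0 → ∀ j : Fin (N + 1), m j ≠ 0 →
      (∀ r, r ≠ S.σ k → r ≠ j → m r = 0) → m j ≤ 1 ∨ j = S.σ k → False := by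
    intro m hm j hj hr hj1
    have hal := hF.adapted m hm
    have hdeg := degree_eq_of_mem_support F (mem_support_iff.2 hm)
    have hjσ : j ≠ S.σ k := by
      rintro rfl
      have := hal.2 k (hr _ (hne k k) (hne k k))
      exact hj this
    have hmj : m j = 1 := by
      rcases hj1 with h | h
      · omega
      · exact absurd h hjσ
    have hmeq : m = Finsupp.single j 1 + Finsupp.single (S.σ k) (d - 1) := by
      have h1 : m = Finsupp.single j 1 + Finsupp.single (S.σ k) (m (S.σ k)) := by
        ext r
        rw [Finsupp.add_apply]
        by_cases h1 : r = j
        · subst h1; rw [Finsupp.single_eq_same, Finsupp.single_eq_of_ne hjσ, hmj, add_zero]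
        · by_cases h2 : r = S.σ k
          · subst h2; rw [Finsupp.single_eq_same, Finsupp.single_eq_of_ne h1, zero_add]
          · rw [Finsupp.single_eq_of_ne h1, Finsupp.single_eq_of_ne h2, hr r h2 h1, add_zero]
      have h2 : 1 + m (S.σ k) = d := by
        rw [← hdeg]
        conv_rhs => rw [h1]
        rw [map_add, Finsupp.degree_single, Finsupp.degree_single]
      rw [h1]
      congr 2
      rw [← h2]
      simp
    have hρ : j = S.ρ k := by
      by_contra hjρ
      have h3 : m (S.ρ k) = 0 := hr _ (hne k k) (Ne.symm hjρ)
      have h4 := hal.2 k h3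
      rw [hmeq, Finsupp.add_apply, Finsupp.single_eq_of_ne hjσ.symm, Finsupp.single_eq_same] at h4
      omega
    rw [hmeq, hρ] at hm
    exact hm hcoeff
  obtain ⟨v, -, hv⟩ := hF.smooth i (Pi.single (S.σ k) 1) hx0 (fun s hs => by
    have := congrFun hs (S.σ k)
    simp [S.σ_inj.eq_iff, hik.symm] at this) (by
    by_contra h
    obtain ⟨m, hm, hm0⟩ := exists_coeff_ne h
    have hdeg := degree_eq_of_mem_support F (mem_support_iff.2 hm)
    refine hsingle m hm (S.σ k) (fun h0 => ?_) (fun r hr _ => hm0 r (Pi.single_eq_of_ne hr _))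
      (Or.inr rfl)
    have : m = 0 := by
      ext r
      by_cases hr : r = S.σ k
      · rw [hr, h0]; rfl
      · exact hm0 r (Pi.single_eq_of_ne hr _)
    rw [this] at hdeg
    simp at hdeg
    omega)
  apply hv
  refine Finset.sum_eq_zero fun j _ => ?_
  rw [F.1.as_sum, map_sum, map_sum, Finset.sum_eq_zero, mul_zero]
  intro m hm
  rw [pderiv_monomial, eval_monomial]
  by_contra hcon
  have h1 := right_ne_zero_of_mul hcon
  have h2 : m j ≠ 0 := fun h => by simp [h] at hcon
  rw [Finsupp.prod_fintype _ _ (by simp), Finset.prod_ne_zero_iff] at h1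
  have h3 : ∀ r, r ≠ S.σ k → (m - Finsupp.single j 1 : Fin (N + 1) →₀ ℕ) r = 0 := fun r hr => by
    by_contra h
    exact h1 r (Finset.mem_univ r) (by rw [Pi.single_eq_of_ne hr, zero_pow h])
  refine hsingle m (mem_support_iff.1 hm) j h2 (fun r hr hrj => ?_) ?_
  · have := h3 r hr
    rwa [Finsupp.tsub_apply, Finsupp.single_eq_of_ne hrj, Nat.sub_zero] at this
  · by_cases hjσ : j = S.σ k
    · exact Or.inr hjσ
    · left
      have := h3 j hjσ
      rw [Finsupp.tsub_apply, Finsupp.single_eq_same] at this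
      omega

theorem eval_aeval_line (g : MvPolynomial (Fin (N + 1)) ℂ) (y v : Fin (N + 1) → ℂ) (s : ℂ) :
    (aeval (fun i => Polynomial.C (y i) + Polynomial.C (v i) * Polynomial.X) g :
      Polynomial ℂ).eval s = eval (y + s • v) g := by
  change Polynomial.aeval s (aeval _ g) = aeval _ g
  rw [← AlgHom.comp_apply, comp_aeval]
  congr 2
  funext i
  simp only [map_add, map_mul, Polynomial.aeval_C, Polynomial.aeval_X, Pi.add_apply,
    Pi.smul_apply, smul_eq_mul, Algebra.algebraMap_self_apply]
  ring

/-- A form of positive degree has a nontrivial zero on every plane. -/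
theorem exists_zero_on_plane {n : ℕ} (g : Form N n) (hn : n ≠ 0) {a b : Fin (N + 1)}
    (hab : a ≠ b) :
    ∃ x : Fin (N + 1) → ℂ, x ≠ 0 ∧ (∀ j, j ≠ a → j ≠ b → x j = 0) ∧ eval x g.1 = 0 := by
  let ea : Fin (N + 1) → ℂ := Pi.single a 1
  let eb : Fin (N + 1) → ℂ := Pi.single b 1
  let p : Polynomial ℂ :=
    aeval (fun i => Polynomial.C (eb i) + Polynomial.C (ea i) * Polynomial.X) g.1
  let q : Polynomial ℂ :=
    aeval (fun i => Polynomial.C (ea i) + Polynomial.C (eb i) * Polynomial.X) g.1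
  have hp : ∀ s, p.eval s = eval (eb + s • ea) g.1 := eval_aeval_line _ _ _
  have hq : ∀ s, q.eval s = eval (ea + s • eb) g.1 := eval_aeval_line _ _ _
  -- If `g` is constant along the line `eb + s • ea`, homogeneity makes it a multiple of the `n`-th
  -- power of the `b`-coordinate on the plane, and it vanishes at `ea`. Otherwise the polynomial has
  -- a root.
  by_cases hdeg : p.degree = 0
  · obtain ⟨c, hc⟩ : ∃ c, p = Polynomial.C c := ⟨_, Polynomial.eq_C_of_degree_eq_zero hdeg⟩
    have hXq : Polynomial.X * q = Polynomial.X * (Polynomial.C c * Polynomial.X ^ n) := by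
      refine Polynomial.funext fun t => ?_
      rw [Polynomial.eval_mul, Polynomial.eval_mul, Polynomial.eval_X]
      by_cases ht : t = 0
      · rw [ht, zero_mul, zero_mul]
      · have h1 : ea + t • eb = t • (eb + t⁻¹ • ea) := by
          rw [smul_add, smul_smul, mul_inv_cancel₀ ht, one_smul, add_comm ea]
        rw [hq, h1, eval_smul_form, ← hp, hc]
        simp only [Polynomial.eval_mul, Polynomial.eval_C, Polynomial.eval_pow, Polynomial.eval_X]
        ring
    have hqc := mul_left_cancel₀ Polynomial.X_ne_zero hXq
    refine ⟨ea, fun h => by simpa [ea] using congrFun h a,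
      fun j hj _ => Pi.single_eq_of_ne hj _, ?_⟩
    have := hq 0
    rw [zero_smul, add_zero] at this
    rw [← this, hqc]
    simp [hn]
  · obtain ⟨s, hs⟩ := IsAlgClosed.exists_root p hdeg
    refine ⟨eb + s • ea, fun h => ?_, fun j hja hjb => ?_, (hp s).symm.trans hs⟩
    · have := congrFun h b
      simp [ea, eb, hab.symm] at this
    · simp [ea, eb, Pi.single_eq_of_ne hja, Pi.single_eq_of_ne hjb]

/-- Without a monomial free of both `ρ`-variables, `F` would vanish on `Π_0 ∩ Π_1`. At its points
the cone `C_0` would then be singular wherever the derivative by `X_{ρ 1}` vanishes. That derivative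
is a form of positive degree, and for `N ≥ 4` there is a plane in the linear cone over the
intersection avoiding `P_0` on which it has a zero. -/
theorem exists_pivot_posW (hN : 4 ≤ N) (hd : 3 ≤ d) {F : Form N d}
    (hF : (posW (by omega : 3 ≤ N)).StdGood F) :
    ∃ m, (posW (by omega : 3 ≤ N)).IsPivot d (fun _ => m) ∧ coeff m F.1 ≠ 0 := by
  have hN' : 3 ≤ N := by omega
  set S := posW hN' with hS
  have hne := posW_ρ_ne_σ hN'
  rw [← hS] at hne
  by_cases h : ∃ m, coeff m F.1 ≠ 0 ∧ ∀ i, m (S.ρ i) = 0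
  · obtain ⟨m, hm, hmρ⟩ := h
    exact ⟨m, ⟨fun _ => degree_eq_of_mem_support F (mem_support_iff.2 hm),
      fun _ => hF.adapted m hm, hmρ, Or.inl rfl⟩, hm⟩
  exfalso
  push Not at h
  have hvan : ∀ x : Fin (N + 1) → ℂ, (∀ i, x (S.ρ i) = 0) → eval x F.1 = 0 := fun x hx => by
    by_contra hx0
    obtain ⟨m, hm, hm0⟩ := exists_coeff_ne hx0
    obtain ⟨i, hi⟩ := h m hm
    exact hi (hm0 _ (hx i))
  let e4 : Fin (N + 1) := ⟨4, by omega⟩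
  have h4σ : ∀ i, e4 ≠ S.σ i := fun i hi => by
    have h1 := congrArg Fin.val hi
    have h2 : (S.σ i).1 = i + 2 := posW_σ_val hN' i
    rw [h2] at h1
    simp only [e4] at h1
    omega
  have h4ρ : ∀ i, S.ρ i ≠ e4 := fun i hi => by
    have h1 := congrArg Fin.val hi
    have h2 : (S.ρ i).1 = i := posW_ρ_val hN' i
    rw [h2] at h1
    simp only [e4] at h1
    omega
  have hF' : F.1.IsHomogeneous d := F.2
  obtain ⟨x, hx0, hx, hxg⟩ := exists_zero_on_plane (n := d - 1)
    ⟨pderiv (S.ρ 1) F.1, hF'.pderiv⟩ (by omega) (h4σ 1)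
  have hxρ : ∀ i, x (S.ρ i) = 0 := fun i => hx _ (h4ρ i) (hne i 1)
  obtain ⟨v, hv, hv0⟩ := hF.smooth 0 x (hxρ 0) (fun s hs => by
    have h1 : x (S.σ 0) = 0 := hx _ (h4σ 0).symm (S.σ_inj.ne (by simp))
    rw [hs] at h1
    apply hx0
    rw [hs]
    simp at h1
    rw [h1, zero_smul]) (hvan x hxρ)
  apply hv0
  refine dirDeriv_eq_zero_of_pderiv hv fun j hj => ?_
  by_cases hj1 : j = S.ρ 1
  · rw [hj1]; exact hxg
  · rw [eval_pderiv]
    refine dirDeriv_eq_zero_of_const _ fun s => ?_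
    rw [hvan x hxρ]
    refine hvan _ fun i => ?_
    have : S.ρ i ≠ j := by
      fin_cases i
      · exact hj.symm
      · exact Ne.symm hj1
    simp [hxρ i, Pi.single_eq_of_ne this]

/-- For `N = 3` there are only the `ρ`- and `σ`-variables. A monomial free of both `ρ`-variables and
allowed would be constant, so the two cones have independent scalars and separate pivots are
consistent. -/
theorem isPivot_posW_three (hd : 3 ≤ d) :
    (posW le_rfl : Pos 3).IsPivot d (fun i => Finsupp.single ((posW le_rfl).ρ (1 - i)) 1 +
      Finsupp.single ((posW le_rfl).σ (1 - i)) (d - 1)) := by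
  set S : Pos 3 := posW le_rfl with hS
  have hne := posW_ρ_ne_σ (N := 3) le_rfl
  rw [← hS] at hne
  have h1i : ∀ i : Fin 2, i ≠ 1 - i := by decide
  have hvis : ∀ i, (Finsupp.single (S.ρ (1 - i)) 1 + Finsupp.single (S.σ (1 - i)) (d - 1) :
      Fin (3 + 1) →₀ ℕ) (S.ρ i) = 0 := fun i => by
    rw [Finsupp.add_apply, Finsupp.single_eq_of_ne (S.ρ_inj.ne (h1i i)),
      Finsupp.single_eq_of_ne (hne _ _), add_zero]
  refine ⟨fun i => ?_, fun i => ⟨⟨i, hvis i⟩, fun l hl => ?_⟩, hvis, Or.inr fun m hm hal => ?_⟩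
  · rw [map_add, Finsupp.degree_single, Finsupp.degree_single]
    omega
  · have hl' : l ≠ 1 - i := by
      rintro rfl
      simp at hl
    rw [Finsupp.add_apply, Finsupp.single_eq_of_ne (hne _ _).symm,
      Finsupp.single_eq_of_ne (S.σ_inj.ne hl'), add_zero]
  · by_contra! hcon
    have : m = 0 := by
      ext j
      rcases eq_ρ_or_σ_of_lt (N := 3) le_rfl (j := j) (by omega) with ⟨l, hl⟩ | ⟨l, hl⟩
      · rw [hl]; exact hcon l
      · rw [hl]; exact hal.2 l (hcon l)
    rw [this] at hm
    simp at hm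
    omega

end StandardForms

end StarPoints

end

noncomputable section

namespace StarPoints

open Module MvPolynomial Topology

/-! ### Dimensions -/

section Counting

variable {N d : ℕ}

/-- Two rows and two columns of a square matrix of size `N + 1` have `4 * N` entries in all, after
removing their 4 intersections from the sum. The diagonal entries among them are fixed, one for each
index in the union of the two ranges. -/
theorem card_free (S : Pos N) {k : ℕ}
    (hk : (Finset.univ.image S.ρ ∪ Finset.univ.image S.σ).card = k) :
    Nat.card S.Free = 4 * N - k := by
  classical
  set A := Finset.univ.image S.ρ with hA
  set B := Finset.univ.image S.σ with hB
  have hcA : A.card = 2 := by simp [hA, Finset.card_image_of_injective _ S.ρ_inj]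
  have hcB : B.card = 2 := by simp [hB, Finset.card_image_of_injective _ S.σ_inj]
  let T : Finset (Fin (N + 1) × Fin (N + 1)) := A ×ˢ Finset.univ ∪ Finset.univ ×ˢ B
  have hT : T.card = 4 * N := by
    have h := Finset.card_union_add_card_inter (A ×ˢ (Finset.univ : Finset (Fin (N + 1))))
      ((Finset.univ : Finset (Fin (N + 1))) ×ˢ B)
    rw [Finset.product_inter_product, Finset.inter_univ, Finset.univ_inter,
      Finset.card_product, Finset.card_product, Finset.card_product, hcA, hcB,
      Finset.card_univ, Fintype.card_fin] at h
    change T.card + _ = _ at h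
    omega
  let E : Finset (Fin (N + 1) × Fin (N + 1)) := (A ∪ B).image fun r => (r, r)
  have hE : E.card = k := by
    rw [Finset.card_image_of_injective _ fun a b h => (Prod.ext_iff.1 h).1, hk]
  have hET : E ⊆ T := by
    intro q hq
    obtain ⟨r, hr, rfl⟩ := Finset.mem_image.1 hq
    simpa [T] using hr
  rw [Nat.subtype_card (T \ E), Finset.card_sdiff_of_subset hET, hT, hE]
  rintro ⟨r, j⟩
  have h1 : ∀ r, r ∈ A ↔ r ∈ Set.range S.ρ := fun r => by simp [hA]
  have h2 : ∀ r, r ∈ B ↔ r ∈ Set.range S.σ := fun r => by simp [hB]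
  rw [← h1, ← h2]
  simp only [T, E, Finset.mem_sdiff, Finset.mem_union, Finset.mem_product, Finset.mem_univ,
    and_true, true_and, Finset.mem_image, Prod.mk.injEq, not_exists, not_and]
  constructor
  · rintro ⟨h, h'⟩
    refine ⟨fun hrj => ?_, h⟩
    subst hrj
    exact h' r h rfl rfl
  · rintro ⟨h, h'⟩
    exact ⟨h', fun a _ ha hb => h (ha.symm.trans hb)⟩

theorem card_free_posV (hN : 3 ≤ N) : Nat.card (posV hN).Free = 2 * N + 2 * (N - 1) := by
  have h : (Finset.univ.image (posV hN).ρ ∪ Finset.univ.image (posV hN).σ).card = 2 := by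
    have h0 : (posV hN).σ 0 = (posV hN).ρ 1 := Fin.ext (by simp)
    have h1 : (posV hN).σ 1 = (posV hN).ρ 0 := Fin.ext (by simp)
    have : Finset.univ.image (posV hN).σ = Finset.univ.image (posV hN).ρ := by
      ext r
      simp only [Finset.mem_image, Finset.mem_univ, true_and, Fin.exists_fin_two, h0, h1]
      tauto
    rw [this, Finset.union_self, Finset.card_image_of_injective _ (posV hN).ρ_inj]
    simp
  rw [card_free _ h]
  omega

theorem card_free_posW (hN : 3 ≤ N) : Nat.card (posW hN).Free = 2 * N + 2 * (N - 2) := by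
  have h : (Finset.univ.image (posW hN).ρ ∪ Finset.univ.image (posW hN).σ).card = 4 := by
    rw [Finset.card_union_of_disjoint, Finset.card_image_of_injective _ (posW hN).ρ_inj,
      Finset.card_image_of_injective _ (posW hN).σ_inj]
    · simp
    · rw [Finset.disjoint_left]
      intro r hr hr'
      obtain ⟨i, -, rfl⟩ := Finset.mem_image.1 hr
      obtain ⟨j, -, hj⟩ := Finset.mem_image.1 hr'
      exact posW_ρ_ne_σ hN i j hj.symm
  rw [card_free _ h]
  omega

theorem card_coeffIndex (S : Pos N) {T P : Finset (Fin (N + 1) →₀ ℕ)}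
    (hT : ∀ m, m ∈ T ↔ m.degree = d ∧ S.Allowed m) (hP : P ⊆ T) :
    Nat.card (S.CoeffIndex d P) = T.card - P.card := by
  classical
  rw [Nat.subtype_card (T \ P), Finset.card_sdiff_of_subset hP]
  intro m
  rw [Finset.mem_sdiff, hT, and_assoc]

theorem mem_finsuppAntidiag_iff {s : Finset (Fin (N + 1))} {m : Fin (N + 1) →₀ ℕ} :
    m ∈ s.finsuppAntidiag d ↔ m.degree = d ∧ ∀ j, j ∉ s → m j = 0 := by
  rw [Finset.mem_finsuppAntidiag]
  have hsub : m.support ⊆ s ↔ ∀ j, j ∉ s → m j = 0 := by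
    constructor
    · intro h j hj
      by_contra h0
      exact hj (h (Finsupp.mem_support_iff.2 h0))
    · intro h j hj
      by_contra h0
      exact Finsupp.mem_support_iff.1 hj (h j h0)
  rw [hsub]
  refine and_congr_left fun h => ?_
  rw [Finsupp.degree_eq_sum, Finset.sum_subset (Finset.subset_univ s) fun j _ hj => h j hj]

theorem card_filter_le_val (a : ℕ) (ha : a ≤ N + 1) :
    (Finset.univ.filter fun j : Fin (N + 1) => a ≤ j.1).card = N + 1 - a := by
  have h : (Finset.univ.filter fun j : Fin (N + 1) => a ≤ j.1).card +
      (Finset.univ.filter fun j : Fin (N + 1) => j.1 < a).card = N + 1 := by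
    have := Finset.card_filter_add_card_filter_not (s := (Finset.univ : Finset (Fin (N + 1))))
      (fun j => a ≤ j.1)
    simpa using this
  rw [Fin.card_filter_val_lt] at h
  rw [Nat.min_eq_right ha] at h
  omega

theorem exists_allowed_posV (hN : 3 ≤ N) : ∃ T : Finset (Fin (N + 1) →₀ ℕ),
    (∀ m, m ∈ T ↔ m.degree = d ∧ (posV hN).Allowed m) ∧
      T.card = (N + d - 2).choose (N - 2) := by
  refine ⟨(Finset.univ.filter fun j : Fin (N + 1) => 2 ≤ j.1).finsuppAntidiag d, fun m => ?_, ?_⟩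
  · rw [mem_finsuppAntidiag_iff, posV_allowed_iff]
    refine and_congr_right fun _ => ⟨fun h i => h _ ?_, fun h j hj => ?_⟩
    · simp only [Finset.mem_filter, Finset.mem_univ, true_and, posV_ρ_val]
      omega
    · have hj : j.1 < 2 := by simpa using hj
      exact h ⟨j.1, hj⟩
  · rw [Finset.card_finsuppAntidiag_nat_eq_choose, card_filter_le_val 2 (by omega),
      show N + 1 - 2 + d - 1 = N + d - 2 by omega]
    exact Nat.choose_symm_of_eq_add (by omega)

theorem topologicalKrullDim_V (hN : 3 ≤ N) (hd : 3 ≤ d) :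
    topologicalKrullDim (V N d 2) =
      ((2 * N + 2 * (N - 1) + (N + d - 2).choose (N - 2) - 1 : ℕ) : WithBot ℕ∞) := by
  rw [V_eq_frameConfigs hN (by omega)]
  refine topologicalKrullDim_frameConfigs (by omega) _ (stdGood_fermatV hN (by omega)) ?_
  intro F hF
  obtain ⟨m, hm, hne⟩ := exists_pivot_posV hN hF
  obtain ⟨T, hT, hcard⟩ := exists_allowed_posV (d := d) hN
  refine ⟨fun _ => m, hm, fun _ => hne, ?_⟩
  have hP : pivotSet (fun _ => m) = {m} := by simp [pivotSet]
  have hmT : ({m} : Finset _) ⊆ T := by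
    rw [Finset.singleton_subset_iff]
    exact (hT m).2 ⟨hm.degree 0, hm.allowed 0⟩
  rw [Nat.card_sum, card_free_posV, hP, card_coeffIndex _ hT hmT, hcard, Finset.card_singleton]
  have : 0 < (N + d - 2).choose (N - 2) := Nat.choose_pos (by omega)
  omega

/-- Split the allowed monomials into those visible on both hyperplanes, which involve only variables
of index at least 4, and for each `i` those visible only on `Π_i`. The latter are divisible by the
other `ρ`-variable, with quotient an arbitrary monomial of degree `d - 1` free of `ρ i` and `σ i`.
-/
theorem exists_allowed_posW (hN : 3 ≤ N) (hd : 3 ≤ d) : ∃ T : Finset (Fin (N + 1) →₀ ℕ),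
    (∀ m, m ∈ T ↔ m.degree = d ∧ (posW hN).Allowed m) ∧
      T.card = (N + d - 4).choose d + 2 * (N + d - 3).choose (N - 2) := by
  classical
  set S := posW hN with hS
  have hne := posW_ρ_ne_σ hN
  rw [← hS] at hne
  let A : Finset (Fin (N + 1) →₀ ℕ) :=
    (Finset.univ.filter fun j : Fin (N + 1) => 4 ≤ j.1).finsuppAntidiag d
  let B (i : Fin 2) : Finset (Fin (N + 1) →₀ ℕ) :=
    ((({S.ρ i, S.σ i} : Finset (Fin (N + 1)))ᶜ).finsuppAntidiag (d - 1)).map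
      (addRightEmbedding (Finsupp.single (S.ρ (1 - i)) 1))
  have h1i : ∀ i : Fin 2, 1 - i ≠ i := by decide
  have hcases : ∀ i l : Fin 2, l = i ∨ l = 1 - i := by decide
  have hA : ∀ m, m ∈ A ↔ m.degree = d ∧ S.Allowed m ∧ ∀ i, m (S.ρ i) = 0 := fun m => by
    rw [mem_finsuppAntidiag_iff]
    refine and_congr_right fun _ => ⟨fun h => ?_, fun h j hj => ?_⟩
    · have hρ : ∀ i, m (S.ρ i) = 0 := fun i => h _ (by
        have : (S.ρ i).1 = i := posW_ρ_val hN i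
        simp only [Finset.mem_filter, Finset.mem_univ, true_and, this]
        omega)
      have hσ : ∀ i, m (S.σ i) = 0 := fun i => h _ (by
        have : (S.σ i).1 = i + 2 := posW_σ_val hN i
        simp only [Finset.mem_filter, Finset.mem_univ, true_and, this]
        omega)
      exact ⟨⟨⟨0, hρ 0⟩, fun i _ => hσ i⟩, hρ⟩
    · rcases eq_ρ_or_σ_of_lt hN (by simpa using hj) with ⟨l, hl⟩ | ⟨l, hl⟩
      · rw [hl]; exact h.2 l
      · rw [hl]; exact h.1.2 l (h.2 l)
  have hB : ∀ i m, m ∈ B i ↔ m.degree = d ∧ S.Allowed m ∧ m (S.ρ i) = 0 ∧ m (S.ρ (1 - i)) ≠ 0 := by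
    intro i m
    have hρ1 : S.ρ i ≠ S.ρ (1 - i) := S.ρ_inj.ne (h1i i).symm
    rw [Finset.mem_map]
    constructor
    · rintro ⟨m', hm', rfl⟩
      obtain ⟨hdeg, h0⟩ := mem_finsuppAntidiag_iff.1 hm'
      have hρ0 : m' (S.ρ i) = 0 := h0 _ (by simp)
      have hσ0 : m' (S.σ i) = 0 := h0 _ (by simp)
      simp only [addRightEmbedding_apply, map_add, Finsupp.degree_single, Finsupp.add_apply]
      refine ⟨by omega, ⟨⟨i, ?_⟩, fun l hl => ?_⟩, ?_, ?_⟩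
      · rw [Finsupp.add_apply, Finsupp.single_eq_of_ne hρ1, hρ0, add_zero]
      · rcases hcases i l with rfl | rfl
        · rw [Finsupp.add_apply, Finsupp.single_eq_of_ne (hne _ _).symm, hσ0, add_zero]
        · simp at hl
      · rw [Finsupp.single_eq_of_ne hρ1, hρ0, add_zero]
      · simp
    · rintro ⟨hdeg, hal, h0, h1⟩
      have hle : Finsupp.single (S.ρ (1 - i)) 1 ≤ m := by
        rw [Finsupp.single_le_iff]; omega
      refine ⟨m - Finsupp.single (S.ρ (1 - i)) 1, mem_finsuppAntidiag_iff.2 ⟨?_, fun j hj => ?_⟩,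
        tsub_add_cancel_of_le hle⟩
      · have := congrArg Finsupp.degree (tsub_add_cancel_of_le hle)
        rw [map_add, Finsupp.degree_single, hdeg] at this
        omega
      · have : m j = 0 := by
          simp only [Finset.mem_compl, Finset.mem_insert, Finset.mem_singleton, not_not] at hj
          rcases hj with rfl | rfl
          exacts [h0, hal.2 i h0]
        rw [Finsupp.tsub_apply, this, Nat.zero_sub]
  have hcB : ∀ i, (B i).card = (N + d - 3).choose (N - 2) := fun i => by
    rw [Finset.card_map, Finset.card_finsuppAntidiag_nat_eq_choose, Finset.card_compl,
      Finset.card_pair (hne i i), Fintype.card_fin,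
      show N + 1 - 2 + (d - 1) - 1 = N + d - 3 by omega]
    exact Nat.choose_symm_of_eq_add (by omega)
  have hcA : A.card = (N + d - 4).choose d := by
    rw [Finset.card_finsuppAntidiag_nat_eq_choose, card_filter_le_val 4 (by omega)]
    congr 1
    omega
  refine ⟨A ∪ (B 0 ∪ B 1), fun m => ?_, ?_⟩
  · rw [Finset.mem_union, Finset.mem_union, hA, hB, hB, ← and_or_left, ← and_or_left,
      ← and_or_left, ← and_or_left]
    refine and_congr_right fun _ => ⟨fun h => h.1, fun h => ⟨h, ?_⟩⟩
    obtain ⟨i, hi⟩ := h.1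
    simp only [Fin.forall_fin_two, sub_zero, sub_self]
    fin_cases i
    · simp only [Fin.zero_eta] at hi
      tauto
    · simp only [Fin.mk_one] at hi
      tauto
  · rw [Finset.card_union_of_disjoint, Finset.card_union_of_disjoint, hcA, hcB, hcB]
    · ring
    · rw [Finset.disjoint_left]
      intro m h0 h1
      exact ((hB 0 m).1 h0).2.2.2 ((hB 1 m).1 h1).2.2.1
    · rw [Finset.disjoint_left]
      intro m h0 h1
      have h0 := ((hA m).1 h0).2.2
      rcases Finset.mem_union.1 h1 with h1 | h1
      · exact ((hB 0 m).1 h1).2.2.2 (h0 _)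
      · exact ((hB 1 m).1 h1).2.2.2 (h0 _)

theorem topologicalKrullDim_W (hN : 3 ≤ N) (hd : 3 ≤ d) :
    topologicalKrullDim (W N d) = (dimW N d : ℕ) := by
  rw [W_eq_frameConfigs hN (by omega)]
  refine topologicalKrullDim_frameConfigs (by omega) _ (stdGood_fermatW hN hd) ?_
  intro F hF
  obtain ⟨T, hT, hcard⟩ := exists_allowed_posW hN hd
  by_cases hN3 : N = 3
  -- Two different pivots are removed here, one for each cone; in the other case a common pivot
  -- removes a single coefficient.
  · subst hN3
    have hpiv := isPivot_posW_three hd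
    refine ⟨_, hpiv, fun i => coeff_ne_zero_posW hN hd hF (1 - i), ?_⟩
    have hP : ∀ i, (Finsupp.single ((posW le_rfl : Pos 3).ρ (1 - i)) 1 +
      Finsupp.single ((posW le_rfl : Pos 3).σ (1 - i)) (d - 1)) ∈ T :=
      fun i => (hT _).2 ⟨hpiv.degree i, hpiv.allowed i⟩
    have hdiff : (Finsupp.single ((posW le_rfl : Pos 3).ρ (1 - 0)) 1 +
        Finsupp.single ((posW le_rfl : Pos 3).σ (1 - 0)) (d - 1)) ≠
        (Finsupp.single ((posW le_rfl : Pos 3).ρ (1 - 1)) 1 +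
        Finsupp.single ((posW le_rfl : Pos 3).σ (1 - 1)) (d - 1)) := fun h => by
      have h1 := hpiv.vis 1
      rw [← h] at h1
      simp at h1
    rw [Nat.card_sum, card_free_posW, card_coeffIndex _ hT, hcard, Finset.card_pair hdiff, dimW,
      if_pos rfl, Nat.choose_eq_zero_of_lt (show 3 + d - 4 < d by omega)]
    · simp
      omega
    · intro m hm
      rcases Finset.mem_insert.1 hm with rfl | hm
      · exact hP 0
      · rw [Finset.mem_singleton.1 hm]; exact hP 1
  · obtain ⟨m, hm, hne⟩ := exists_pivot_posW (by omega) hd hF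
    refine ⟨fun _ => m, hm, fun _ => hne, ?_⟩
    have hP : pivotSet (fun _ => m) = {m} := by simp [pivotSet]
    have hmT : ({m} : Finset _) ⊆ T := by
      rw [Finset.singleton_subset_iff]
      exact (hT m).2 ⟨hm.degree 0, hm.allowed 0⟩
    rw [Nat.card_sum, card_free_posW, hP, card_coeffIndex _ hT hmT, hcard, Finset.card_singleton,
      dimW, if_neg hN3]
    have h1 : (N + d - 4).choose d = (N + d - 4).choose (N - 4) :=
      Nat.choose_symm_of_eq_add (by omega)
    have : 0 < (N + d - 3).choose (N - 2) := Nat.choose_pos (by omega)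
    rw [h1]
    omega

end Counting

end StarPoints

end

noncomputable section

namespace StarPoints

open Module MvPolynomial Topology

/-! ### The two families are open and closed -/

section Lines

variable {N d : ℕ}

/-- The restriction of a polynomial to the line `t ↦ y + t v`. -/
def onLine (g : MvPolynomial (Fin (N + 1)) ℂ) (y v : Fin (N + 1) → ℂ) : Polynomial ℂ :=
  aeval (fun i => Polynomial.C (y i) + Polynomial.C (v i) * Polynomial.X) g

theorem eval_onLine (g : MvPolynomial (Fin (N + 1)) ℂ) (y v : Fin (N + 1) → ℂ) (s : ℂ) :
    (onLine g y v).eval s = eval (y + s • v) g := eval_aeval_line g y v s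

theorem natDegree_onLine_le (F : Form N d) (y v : Fin (N + 1) → ℂ) :
    (onLine F.1 y v).natDegree ≤ d := by
  have hF : F.1.IsHomogeneous d := F.2
  have := aeval_natDegree_le (n := 1) F.1 hF.totalDegree_le
    (fun i => Polynomial.C (y i) + Polynomial.C (v i) * Polynomial.X) fun i => by
      compute_degree
  rwa [mul_one] at this

theorem coeff_one_onLine (g : MvPolynomial (Fin (N + 1)) ℂ) (y v : Fin (N + 1) → ℂ) :
    (onLine g y v).coeff 1 = dirDeriv g y v := by
  have h1 := (onLine g y v).hasDerivAt 0
  rw [← Polynomial.coeff_zero_eq_eval_zero, Polynomial.coeff_derivative] at h1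
  simp only [zero_add, Nat.cast_zero, mul_one, eval_onLine] at h1
  exact h1.unique (hasDerivAt_eval_line g y v)

/-- By homogeneity `F (y + t v) = t ^ d F (v + t⁻¹ y)`, which reverses the order of the
coefficients. -/
theorem onLine_swap (F : Form N d) (y v : Fin (N + 1) → ℂ) :
    onLine F.1 y v = Polynomial.reflect d (onLine F.1 v y) := by
  -- After multiplication by the variable the identity is trivial at `t = 0`, so `t` can be
  -- inverted.
  refine mul_left_cancel₀ Polynomial.X_ne_zero (Polynomial.funext fun t => ?_)
  rw [Polynomial.eval_mul, Polynomial.eval_mul, Polynomial.eval_X]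
  by_cases ht : t = 0
  · rw [ht, zero_mul, zero_mul]
  · congr 1
    let := invertibleOfNonzero (inv_ne_zero ht)
    have := Polynomial.eval₂_reflect_mul_pow (RingHom.id ℂ) t⁻¹ d (onLine F.1 v y)
      (natDegree_onLine_le F v y)
    rw [invOf_eq_inv, inv_inv, ← Polynomial.eval, ← Polynomial.eval, eval_onLine] at this
    have h1 : y + t • v = t • (v + t⁻¹ • y) := by
      rw [smul_add, smul_smul, mul_inv_cancel₀ ht, one_smul, add_comm y]
    rw [eval_onLine, h1, eval_smul_form, ← this]
    rw [mul_left_comm, ← mul_pow, mul_inv_cancel₀ ht, one_pow, mul_one]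

theorem coeff_onLine_swap (F : Form N d) (y v : Fin (N + 1) → ℂ) {k : ℕ} (hk : k ≤ d) :
    (onLine F.1 y v).coeff k = (onLine F.1 v y).coeff (d - k) := by
  rw [onLine_swap, Polynomial.coeff_reflect, Polynomial.revAt_le hk]

theorem coeff_onLine_eq {F G : MvPolynomial (Fin (N + 1)) ℂ} {y v y' v' : Fin (N + 1) → ℂ}
    {c r : ℂ} (h : ∀ s : ℂ, eval (y + s • v) F = c * eval (y' + (r * s) • v') G) (k : ℕ) :
    (onLine F y v).coeff k = c * (r ^ k * (onLine G y' v').coeff k) := by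
  have : onLine F y v =
      Polynomial.C c * (onLine G y' v').comp (Polynomial.C r * Polynomial.X) := by
    refine Polynomial.funext fun s => ?_
    rw [eval_onLine, h, Polynomial.eval_mul, Polynomial.eval_C, Polynomial.eval_comp,
      eval_onLine]
    simp
  rw [this, Polynomial.coeff_C_mul, Polynomial.comp_C_mul_X_coeff]
  ring

/-- Families of polynomials in one variable with regular coefficients form a subalgebra, and the
restriction to a line is built inside it. -/
theorem coeff_onLine_mem_reg {X ι : Type*} {c : X → ι → ℂ} {D : Set X} {F : X → Form N d}
    {y v : X → Fin (N + 1) → ℂ}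
    (hF : ∀ m : {m : Fin (N + 1) →₀ ℕ // m.degree = d}, (fun x => coeff m.1 (F x).1) ∈ Reg c D)
    (hy : ∀ i, (fun x => y x i) ∈ Reg c D) (hv : ∀ i, (fun x => v x i) ∈ Reg c D) (k : ℕ) :
    (fun x => (onLine (F x).1 (y x) (v x)).coeff k) ∈ Reg c D := by
  let A : Subalgebra ℂ (X → Polynomial ℂ) :=
    { carrier := {p | ∀ k, (fun x => (p x).coeff k) ∈ Reg c D}
      mul_mem' := fun {p q} hp hq k => by
        have := (Reg c D).sum_mem (t := Finset.HasAntidiagonal.antidiagonal k) fun a _ =>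
          (Reg c D).mul_mem (hp a.1) (hq a.2)
        convert this using 1
        funext x
        rw [Pi.mul_apply, Polynomial.coeff_mul, Finset.sum_apply]
        rfl
      add_mem' := fun {p q} hp hq k => by
        have := (Reg c D).add_mem (hp k) (hq k)
        convert this using 1
        funext x
        rw [Pi.add_apply, Polynomial.coeff_add]
        rfl
      algebraMap_mem' := fun a k => by
        have : (fun x => (algebraMap ℂ (X → Polynomial ℂ) a x).coeff k) =
            fun _ => (Polynomial.C a).coeff k := rfl
        rw [this]
        exact const_mem_reg c D _ }
  have hC : ∀ {f : X → ℂ}, f ∈ Reg c D → (fun x => Polynomial.C (f x)) ∈ A := fun hf k => by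
    simp only [Polynomial.coeff_C]
    split_ifs
    · exact hf
    · exact const_mem_reg c D 0
  have hX : (fun _ => Polynomial.X : X → Polynomial ℂ) ∈ A := fun k => const_mem_reg c D _
  have key : (fun x => onLine (F x).1 (y x) (v x)) ∈ A := by
    have h := A.sum_mem (t := (monos N d).attach) fun m _ => A.mul_mem
      (hC (hF ⟨m.1, mem_monos.1 m.2⟩)) (A.prod_mem (t := Finset.univ) fun i _ =>
        A.pow_mem (A.add_mem (hC (hy i)) (A.mul_mem (hC (hv i)) hX)) (m.1 i))
    convert h using 1
    funext x
    refine Polynomial.funext fun s => ?_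
    rw [eval_onLine, eval_form, Finset.sum_apply, Polynomial.eval_finsetSum,
      ← Finset.sum_attach]
    refine Finset.sum_congr rfl fun m _ => ?_
    simp only [Pi.mul_apply, Finset.prod_apply, Pi.pow_apply, Pi.add_apply, Pi.smul_apply,
      Polynomial.eval_mul, Polynomial.eval_C, Polynomial.eval_prod, Polynomial.eval_pow,
      Polynomial.eval_add, Polynomial.eval_X, smul_eq_mul, mul_comm s]
  exact key k

end Lines

/-! ### Separating the two families by a polynomial relation -/

section Separation

variable {N d : ℕ}

theorem dot_mem_reg {X ι : Type*} {c : X → ι → ℂ} {D : Set X} {a b : X → Fin (N + 1) → ℂ}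
    (ha : ∀ j, (fun x => a x j) ∈ Reg c D) (hb : ∀ j, (fun x => b x j) ∈ Reg c D) :
    (fun x => a x ⬝ᵥ b x) ∈ Reg c D := by
  have := (Reg c D).sum_mem (t := Finset.univ) fun j _ => (Reg c D).mul_mem (ha j) (hb j)
  convert this using 1
  funext x
  simp [dotProduct]

/-- A combination of coefficients of the two cones along lines in the two hyperplanes; it vanishes
on the configurations with `P_0 ∉ Π_1` and `P_1 ∉ Π_0`. -/
def separator (u₀ v₀ : Fin (N + 1) → ℂ) (R : RawConfig N d 2) : ℂ :=
  let u := (R.eqn 1 ⬝ᵥ v₀) • u₀ - (R.eqn 1 ⬝ᵥ u₀) • v₀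
  let v := (R.eqn 0 ⬝ᵥ u₀) • v₀ - (R.eqn 0 ⬝ᵥ v₀) • u₀
  let q₁ := (R.eqn 0 ⬝ᵥ u) • R.vec 1 - (R.eqn 0 ⬝ᵥ R.vec 1) • u
  let q₀ := (R.eqn 1 ⬝ᵥ v) • R.vec 0 - (R.eqn 1 ⬝ᵥ R.vec 0) • v
  (onLine (R.form 0).1 q₁ v).coeff 1 * (onLine (R.form 1).1 q₀ u).coeff 1 -
    (onLine (R.form 0).1 q₁ v).coeff (d - 1) * (onLine (R.form 1).1 q₀ u).coeff (d - 1) *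
      ((R.eqn 0 ⬝ᵥ R.vec 1) * (R.eqn 1 ⬝ᵥ R.vec 0)) ^ (d - 2)

theorem isOpen_separator_ne (u₀ v₀ : Fin (N + 1) → ℂ) :
    IsOpen {R : RawConfig N d 2 | separator u₀ v₀ R ≠ 0} := by
  let A := Reg (RawConfig.coord (N := N) (d := d) (e := 2)) Set.univ
  have he := eqn_mem_reg (N := N) (d := d) (e := 2) Set.univ
  have hp := vec_mem_reg (N := N) (d := d) (e := 2) Set.univ
  have hc : ∀ w : Fin (N + 1) → ℂ, ∀ j, (fun _ : RawConfig N d 2 => w j) ∈ A :=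
    fun w j => const_mem_reg _ _ _
  have hcomb : ∀ {f g : RawConfig N d 2 → ℂ} {y z : RawConfig N d 2 → Fin (N + 1) → ℂ},
      f ∈ A → g ∈ A → (∀ j, (fun R => y R j) ∈ A) → (∀ j, (fun R => z R j) ∈ A) →
      ∀ j, (fun R => (f R • y R - g R • z R) j) ∈ A := fun hf hg hy hz j =>
    A.sub_mem (A.mul_mem hf (hy j)) (A.mul_mem hg (hz j))
  have hu : ∀ j, (fun R : RawConfig N d 2 =>
      ((R.eqn 1 ⬝ᵥ v₀) • u₀ - (R.eqn 1 ⬝ᵥ u₀) • v₀) j) ∈ A :=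
    hcomb (dot_mem_reg (he 1) (hc v₀)) (dot_mem_reg (he 1) (hc u₀)) (hc u₀) (hc v₀)
  have hv : ∀ j, (fun R : RawConfig N d 2 =>
      ((R.eqn 0 ⬝ᵥ u₀) • v₀ - (R.eqn 0 ⬝ᵥ v₀) • u₀) j) ∈ A :=
    hcomb (dot_mem_reg (he 0) (hc u₀)) (dot_mem_reg (he 0) (hc v₀)) (hc v₀) (hc u₀)
  have hA := coeff_onLine_mem_reg (F := fun R : RawConfig N d 2 => R.form 0)
    (coeff_form_mem_reg Set.univ 0)
    (hcomb (dot_mem_reg (he 0) hu) (dot_mem_reg (he 0) (hp 1)) (hp 1) hu) hv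
  have hB := coeff_onLine_mem_reg (F := fun R : RawConfig N d 2 => R.form 1)
    (coeff_form_mem_reg Set.univ 1)
    (hcomb (dot_mem_reg (he 1) hv) (dot_mem_reg (he 1) (hp 0)) (hp 0) hv) hu
  have key : separator u₀ v₀ ∈ A := A.sub_mem (A.mul_mem (hA 1) (hB 1))
    (A.mul_mem (A.mul_mem (hA (d - 1)) (hB (d - 1)))
      (A.pow_mem (A.mul_mem (dot_mem_reg (he 0) (hp 1)) (dot_mem_reg (he 1) (hp 0))) (d - 2)))
  have := isCoord_raw.isOpen_reg isOpen_univ key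
  simpa using this

/-- The vectors `q₁`, `q₀` lie in both hyperplanes. Modulo the vertex `P_0`, the direction `v` is a
multiple of `q₀`; modulo `P_1`, the direction `u` is a multiple of `q₁`. So both restrictions to
lines come from the same binary form `F` on the span of `q₁` and `q₀`, read from opposite ends. The
coefficients of index `1` and `d - 1` are exchanged, and the unknown scalars cancel in the products.
-/
theorem separator_eq_zero (hN : 3 ≤ N) (hd : 3 ≤ d) (u₀ v₀ : Fin (N + 1) → ℂ)
    {R : RawConfig N d 2} (hR : R.toConfig ∈ V N d 2) : separator u₀ v₀ R = 0 := by
  have hs := V_subset_suited hN (by omega) hR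
  obtain ⟨hgood, hdot⟩ := (mem_general_iff R).1 hR.1
  obtain ⟨-, -, F, hF⟩ := (mem_suited_iff R).1 hs
  have hgF := goodAt_of_realizes hgood hF
  obtain ⟨k, hk, hkF⟩ := (cutsOut_iff R 0 F).1 (hF 0)
  obtain ⟨l, hl, hlF⟩ := (cutsOut_iff R 1 F).1 (hF 1)
  have hβ := hdot 0 1 (by simp)
  have hα := hdot 1 0 (by simp)
  have hp0 := R.dot_eq_zero 0
  have hp1 := R.dot_eq_zero 1
  unfold separator
  set u := (R.eqn 1 ⬝ᵥ v₀) • u₀ - (R.eqn 1 ⬝ᵥ u₀) • v₀ with hu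
  set v := (R.eqn 0 ⬝ᵥ u₀) • v₀ - (R.eqn 0 ⬝ᵥ v₀) • u₀ with hv
  have hu1 : R.eqn 1 ⬝ᵥ u = 0 := by
    simp only [hu, dotProduct_sub, dotProduct_smul, smul_eq_mul]; ring
  have hv0 : R.eqn 0 ⬝ᵥ v = 0 := by
    simp only [hv, dotProduct_sub, dotProduct_smul, smul_eq_mul]; ring
  have huv : R.eqn 1 ⬝ᵥ v = R.eqn 0 ⬝ᵥ u := by
    simp only [hu, hv, dotProduct_sub, dotProduct_smul, smul_eq_mul]; ring
  simp only [huv]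
  set Δ := R.eqn 0 ⬝ᵥ u with hΔ
  set α := R.eqn 0 ⬝ᵥ R.vec 1 with hαdef
  set β := R.eqn 1 ⬝ᵥ R.vec 0 with hβdef
  set q₁ := Δ • R.vec 1 - α • u with hq₁
  set q₀ := Δ • R.vec 0 - β • v with hq₀
  have h01 : R.eqn 0 ⬝ᵥ q₁ = 0 := by
    simp only [hq₁, dotProduct_sub, dotProduct_smul, smul_eq_mul, ← hαdef, ← hΔ]; ring
  have h11 : R.eqn 1 ⬝ᵥ q₁ = 0 := by
    simp only [hq₁, dotProduct_sub, dotProduct_smul, smul_eq_mul, hp1, hu1]; ring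
  have h00 : R.eqn 0 ⬝ᵥ q₀ = 0 := by
    simp only [hq₀, dotProduct_sub, dotProduct_smul, smul_eq_mul, hp0, hv0]; ring
  have h10 : R.eqn 1 ⬝ᵥ q₀ = 0 := by
    simp only [hq₀, dotProduct_sub, dotProduct_smul, smul_eq_mul, ← hβdef, huv]; ring
  have hA : ∀ n, (onLine (R.form 0).1 q₁ v).coeff n =
      k⁻¹ * ((-β⁻¹) ^ n * (onLine F.1 q₁ q₀).coeff n) := fun n => by
    refine coeff_onLine_eq (fun s => ?_) n
    have h1 : q₁ + s • v = (q₁ + (-β⁻¹ * s) • q₀) + (s * Δ * β⁻¹) • R.vec 0 := by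
      rw [hq₀]
      funext j
      simp only [Pi.add_apply, Pi.smul_apply, Pi.sub_apply, smul_eq_mul]
      field_simp
      ring
    have h2 : R.eqn 0 ⬝ᵥ (q₁ + s • v) = 0 := by simp [h01, hv0]
    rw [eq_inv_mul_iff_mul_eq₀ hk, ← hkF _ h2, h1]
    exact (hgF 0).1 _ (by simp [h01, h00]) _
  have hB : ∀ n, (onLine (R.form 1).1 q₀ u).coeff n =
      l⁻¹ * ((-α⁻¹) ^ n * (onLine F.1 q₀ q₁).coeff n) := fun n => by
    refine coeff_onLine_eq (fun s => ?_) n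
    have h1 : q₀ + s • u = (q₀ + (-α⁻¹ * s) • q₁) + (s * Δ * α⁻¹) • R.vec 1 := by
      rw [hq₁]
      funext j
      simp only [Pi.add_apply, Pi.smul_apply, Pi.sub_apply, smul_eq_mul]
      field_simp
      ring
    have h2 : R.eqn 1 ⬝ᵥ (q₀ + s • u) = 0 := by simp [h10, hu1]
    rw [eq_inv_mul_iff_mul_eq₀ hl, ← hlF _ h2, h1]
    exact (hgF 1).1 _ (by simp [h11, h10]) _
  rw [hA, hA, hB, hB, coeff_onLine_swap F q₀ q₁ (show 1 ≤ d by omega),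
    coeff_onLine_swap F q₀ q₁ (show d - 1 ≤ d by omega), show d - (d - 1) = 1 by omega]
  obtain ⟨n, rfl⟩ : ∃ n, d = n + 2 := ⟨d - 2, by omega⟩
  simp only [show n + 2 - 1 = n + 1 by omega, show n + 2 - 2 = n by omega]
  -- The rescalings of the line parameter enter with exponent 1 in one product and `d - 1` in the
  -- other; the power `d - 2` of `α * β` compensates exactly.
  have h3 : (-β⁻¹) ^ (n + 1) * (-α⁻¹) ^ (n + 1) * (α * β) ^ n = (-β⁻¹) * (-α⁻¹) := by
    rw [← mul_pow, pow_succ', mul_assoc, ← mul_pow]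
    have : -β⁻¹ * -α⁻¹ * (α * β) = 1 := by field_simp
    rw [this, one_pow, mul_one]
  linear_combination (-(k⁻¹ * l⁻¹ * (onLine F.1 q₁ q₀).coeff 1 *
    (onLine F.1 q₁ q₀).coeff (n + 1))) * h3

/-- `P_k` is a point of the other cone off its vertex, so some derivative of `F` there is nonzero.
Those along `Π_k` vanish because `P_k` is the vertex of `C_k`, and the transversal one must survive.
-/
theorem dirDeriv_ne_zero_posW (hN : 3 ≤ N) (hd : 3 ≤ d) {F : Form N d} (hF : (posW hN).StdGood F)
    (k : Fin 2) :
    dirDeriv F.1 (Pi.single ((posW hN).σ k) 1) (Pi.single ((posW hN).ρ k) 1) ≠ 0 := by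
  set S := posW hN with hS
  have hne := posW_ρ_ne_σ hN
  rw [← hS] at hne
  obtain ⟨i, hik⟩ : ∃ i : Fin 2, i ≠ k := ⟨1 - k, by fin_cases k <;> simp⟩
  have hzero : ∀ v : Fin (N + 1) → ℂ, v (S.ρ k) = 0 →
      dirDeriv F.1 (Pi.single (S.σ k) 1) v = 0 := fun v hv => by
    refine dirDeriv_eq_zero_of_cone F (by omega) fun s => ?_
    have := hF.adapted.invariant k (x := s • v) (by simp [hv]) 1
    rwa [one_smul, add_comm (s • v)] at this
  have hx : eval (Pi.single (S.σ k) 1) F.1 = 0 := by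
    have h1 := hF.adapted.invariant k (x := 0) rfl 1
    rw [one_smul, zero_add] at h1
    rw [h1, ← zero_smul ℂ (0 : Fin (N + 1) → ℂ), eval_smul_form, zero_pow (by omega), zero_mul]
  obtain ⟨v, -, hv⟩ := hF.smooth i (Pi.single (S.σ k) 1) (Pi.single_eq_of_ne (hne i k) _)
    (fun s hs => by
      have := congrFun hs (S.σ k)
      simp [S.σ_inj.eq_iff, hik.symm] at this) hx
  intro h0
  apply hv
  have hsplit : v = (v - v (S.ρ k) • Pi.single (S.ρ k) 1) + v (S.ρ k) • Pi.single (S.ρ k) 1 := by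
    rw [sub_add_cancel]
  rw [hsplit, dirDeriv_add, dirDeriv_smul, h0, hzero _ (by simp), mul_zero, add_zero]

/-- With this choice of `u₀`, `v₀` the auxiliary points become `P_1` and `P_0` themselves. The
second product contains a positive power of the vanishing incidences, since `d ≥ 3`, and the first
is a product of two transversal derivatives. -/
theorem separator_conf_ne_zero (hN : 3 ≤ N) (hd : 3 ≤ d) (D : Frame (posW hN) d) :
    separator (D.h⁻¹.mulVec (Pi.single ((posW hN).ρ 0) 1))
      (D.h⁻¹.mulVec (Pi.single ((posW hN).ρ 1) 1)) D.conf ≠ 0 := by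
  have hne := posW_ρ_ne_σ hN
  set u₀ := D.h⁻¹.mulVec (Pi.single ((posW hN).ρ 0) 1) with hu₀
  set v₀ := D.h⁻¹.mulVec (Pi.single ((posW hN).ρ 1) 1) with hv₀
  have hinv : ∀ y, D.h.mulVec (D.h⁻¹.mulVec y) = y := fun y => by
    rw [Matrix.mulVec_mulVec, Matrix.mul_nonsing_inv _ D.unit, Matrix.one_mulVec]
  have h10 : (posW hN).ρ 1 ≠ (posW hN).ρ 0 := (posW hN).ρ_inj.ne (by simp)
  have e1 : D.conf.eqn 0 ⬝ᵥ u₀ = 1 := by rw [D.conf_eqn_dot, hu₀, hinv]; simp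
  have e2 : D.conf.eqn 1 ⬝ᵥ u₀ = 0 := by rw [D.conf_eqn_dot, hu₀, hinv]; simp [h10]
  have e3 : D.conf.eqn 0 ⬝ᵥ v₀ = 0 := by rw [D.conf_eqn_dot, hv₀, hinv]; simp [h10.symm]
  have e4 : D.conf.eqn 1 ⬝ᵥ v₀ = 1 := by rw [D.conf_eqn_dot, hv₀, hinv]; simp
  have e5 : D.conf.eqn 0 ⬝ᵥ D.conf.vec 1 = 0 := by
    rw [eqn_dot_vec_conf, if_neg (hne _ _)]
  have e6 : D.conf.eqn 1 ⬝ᵥ D.conf.vec 0 = 0 := by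
    rw [eqn_dot_vec_conf, if_neg (hne _ _)]
  have hz : (0 : ℂ) ^ (d - 2) = 0 := zero_pow (by omega)
  unfold separator
  simp only [e1, e2, e3, e4, e5, e6, one_smul, zero_smul, sub_zero, mul_zero, hz,
    coeff_one_onLine]
  refine mul_ne_zero ?_ ?_
  · change dirDeriv (comp D.F D.h).1 _ _ ≠ 0
    rw [dirDeriv_comp, D.mulVec_conf_vec, hv₀, hinv]
    exact dirDeriv_ne_zero_posW hN hd D.good 1
  · change dirDeriv (comp D.F D.h).1 _ _ ≠ 0
    rw [dirDeriv_comp, D.mulVec_conf_vec, hu₀, hinv]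
    exact dirDeriv_ne_zero_posW hN hd D.good 0

/-- Each configuration in `W` has a neighbourhood that does not meet `V`. -/
theorem exists_isOpen_of_mem_W (hN : 3 ≤ N) (hd : 3 ≤ d) {L : Config N d 2} (hL : L ∈ W N d) :
    ∃ U : Set (Config N d 2), IsOpen U ∧ L ∈ U ∧ Disjoint U (V N d 2) := by
  rw [W_eq_frameConfigs hN (by omega)] at hL
  obtain ⟨D, rfl⟩ := hL
  refine ⟨_, isOpenMap_toConfig _ (isOpen_separator_ne _ _),
    ⟨D.conf, separator_conf_ne_zero hN hd D, rfl⟩, ?_⟩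
  rw [Set.disjoint_left]
  rintro _ ⟨R, hR, rfl⟩ hV
  exact hR (separator_eq_zero hN hd _ _ hV)

/-- Each configuration in `V` has a neighbourhood that does not meet `W`. -/
theorem exists_isOpen_of_mem_V (hN : 3 ≤ N) (hd : 3 ≤ d) {L : Config N d 2}
    (hL : L ∈ V N d 2) : ∃ U : Set (Config N d 2), IsOpen U ∧ L ∈ U ∧ Disjoint U (W N d) := by
  obtain ⟨R, rfl⟩ := toConfig_surjective L
  have hopen := isCoord_raw.isOpen_reg isOpen_univ (dot_mem_reg
    (eqn_mem_reg (N := N) (d := d) (e := 2) Set.univ 1) (vec_mem_reg Set.univ 0))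
  refine ⟨_, isOpenMap_toConfig _ hopen,
    ⟨R, ⟨trivial, ((mem_general_iff R).1 hL.1).2 0 1 (by simp)⟩, rfl⟩, ?_⟩
  rw [Set.disjoint_left]
  rintro _ ⟨R', hR', rfl⟩ hW
  apply hR'.2
  rw [W_eq_frameConfigs hN (by omega)] at hW
  obtain ⟨D, hD⟩ := hW
  rw [← pt_le_hyp_iff, ← hD, pt_le_hyp_iff, eqn_dot_vec_conf, if_neg (posW_ρ_ne_σ hN _ _)]

theorem disjoint_V_W : Disjoint (V N d 2) (W N d) :=
  Set.disjoint_left.2 fun _ h h' => h'.2 h.1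

end Separation

/-- A space that is the disjoint union of two irreducible open subsets has these as its irreducible
components. -/
theorem image_irreducibleComponents_eq {X : Type*} [TopologicalSpace X] {S A B : Set X}
    (hS : S = A ∪ B) (hA : IsIrreducible A) (hB : IsIrreducible B) (hAB : Disjoint A B)
    (hAo : ∀ x ∈ A, ∃ U, IsOpen U ∧ x ∈ U ∧ Disjoint U B)
    (hBo : ∀ x ∈ B, ∃ U, IsOpen U ∧ x ∈ U ∧ Disjoint U A) :
    (fun Z : Set S => Subtype.val '' Z) '' irreducibleComponents S = {A, B} := by
  have hclosed : ∀ {A B : Set X}, S = A ∪ B → Disjoint A B →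
      (∀ x ∈ A, ∃ U, IsOpen U ∧ x ∈ U ∧ Disjoint U B) →
      IsClosed ((Subtype.val : S → X) ⁻¹' B) := fun {A B} hS hAB hAo => by
    rw [← isOpen_compl_iff, isOpen_iff_mem_nhds]
    intro x hx
    have hxA : x.1 ∈ A := (hS.subset x.2).resolve_right hx
    obtain ⟨U, hU, hxU, hUB⟩ := hAo x hxA
    exact Filter.mem_of_superset ((hU.preimage continuous_subtype_val).mem_nhds hxU)
      fun y hy hyB => Set.disjoint_left.1 hUB hy hyB
  have hirr : ∀ {A : Set X}, A ⊆ S → IsIrreducible A →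
      IsIrreducible ((Subtype.val : S → X) ⁻¹' A) := fun {A} hAS hA => by
    have := isIrreducible_iff_irreducibleSpace.1 hA
    have h := (IrreducibleSpace.isIrreducible_univ A).image (Set.inclusion hAS)
      (continuous_inclusion hAS).continuousOn
    convert h using 1
    rw [Set.image_univ, Set.range_inclusion]
    rfl
  have hAS : A ⊆ S := hS ▸ Set.subset_union_left
  have hBS : B ⊆ S := hS ▸ Set.subset_union_right
  have hcA := hclosed (A := B) (B := A) (by rw [hS, Set.union_comm]) hAB.symm hBo
  have hcB := hclosed hS hAB hAo
  have hle : ∀ Z : Set S, IsIrreducible Z → Z ⊆ Subtype.val ⁻¹' A ∨ Z ⊆ Subtype.val ⁻¹' B :=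
    fun Z hZ => isPreirreducible_iff_isClosed_union_isClosed.1 hZ.isPreirreducible _ _ hcA hcB
      fun x _ => hS.subset x.2
  have hmax : ∀ {A B : Set X}, A ⊆ S → IsIrreducible A → Disjoint A B →
      (∀ Z : Set S, IsIrreducible Z → Z ⊆ Subtype.val ⁻¹' A ∨ Z ⊆ Subtype.val ⁻¹' B) →
      Maximal IsIrreducible ((Subtype.val : S → X) ⁻¹' A) := fun {A B} hAS hA hAB hle => by
    refine ⟨hirr hAS hA, fun Z hZ hAZ => (hle Z hZ).resolve_right fun hZB => ?_⟩
    obtain ⟨a, ha⟩ := hA.nonempty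
    exact Set.disjoint_left.1 hAB ha (hZB (hAZ (show (⟨a, hAS ha⟩ : S) ∈ _ from ha)))
  have hcomp : irreducibleComponents S = {Subtype.val ⁻¹' A, Subtype.val ⁻¹' B} := by
    ext Z
    constructor
    · intro hZ
      rcases hle Z hZ.1 with h | h
      · exact Or.inl (hZ.eq_of_le (hirr hAS hA) h)
      · exact Or.inr (hZ.eq_of_le (hirr hBS hB) h)
    · rintro (rfl | rfl)
      · exact hmax hAS hA hAB hle
      · exact hmax hBS hB hAB.symm fun Z hZ => (hle Z hZ).symm
  rw [hcomp, Set.image_pair, Subtype.image_preimage_coe, Subtype.image_preimage_coe,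
    Set.inter_eq_right.2 hAS, Set.inter_eq_right.2 hBS]

end StarPoints

end

noncomputable section

namespace StarPoints

open Module MvPolynomial Topology

/-! ### Star points -/

section Star

variable {N d : ℕ}

theorem dirDeriv_smul_point (F : Form N d) (c : ℂ) (x v : Fin (N + 1) → ℂ) :
    dirDeriv F.1 (c • x) v = c ^ (d - 1) * dirDeriv F.1 x v := by
  have hF : F.1.IsHomogeneous d := F.2
  rw [dirDeriv, dirDeriv, Finset.mul_sum]
  refine Finset.sum_congr rfl fun j _ => ?_
  have := eval_smul_form (d := d - 1) ⟨pderiv j F.1, hF.pderiv⟩ c x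
  rw [this]
  ring

/-- At a smooth vertex, the derivative vanishes only in the directions of the hyperplane. -/
theorem GoodAt.dirDeriv_vertex_ne {a p : Fin (N + 1) → ℂ} {F : Form N d} (h : GoodAt a p F)
    (hd : 2 ≤ d) {c : ℂ} (hs : ∃ v, dirDeriv F.1 (c • p) v ≠ 0) {w : Fin (N + 1) → ℂ}
    (hw : a ⬝ᵥ w ≠ 0) : dirDeriv F.1 (c • p) w ≠ 0 := by
  obtain ⟨v, hv⟩ := hs
  intro h0
  apply hv
  have hsplit : v = (v - ((a ⬝ᵥ v) / (a ⬝ᵥ w)) • w) + ((a ⬝ᵥ v) / (a ⬝ᵥ w)) • w := by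
    rw [sub_add_cancel]
  rw [hsplit, dirDeriv_add, dirDeriv_smul, h0, mul_zero, add_zero]
  refine h.dirDeriv_vertex hd ?_ c
  rw [dotProduct_sub, dotProduct_smul, smul_eq_mul, div_mul_cancel₀ _ hw, sub_self]

theorem exists_rep_eq (R : RawConfig N d 2) (i : Fin 2) :
    ∃ c : ℂ, c ≠ 0 ∧ (R.toConfig i).pt.rep = c • R.vec i := by
  obtain ⟨c, hc⟩ := (mem_pt_iff R i _).1 (rep_mem_submodule (R.toConfig i).pt)
  refine ⟨c, ?_, hc⟩
  rintro rfl
  exact (R.toConfig i).pt.rep_nonzero (by rw [hc, zero_smul])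

/-- Smoothness identifies the tangent space at the vertex with the hyperplane. There the cone
property reduces the equation along a line through the vertex to `s ^ d` times a constant. -/
theorem isStarPoint_of_goodAt (hd : 2 ≤ d) {R : RawConfig N d 2} {i : Fin 2} {F : Form N d}
    (hF : CutsOut F (R.toConfig i)) (hg : GoodAt (R.eqn i) (R.vec i) F)
    (hs : ∃ v, dirDeriv F.1 (R.vec i) v ≠ 0) : IsStarPoint F (R.toConfig i).pt := by
  obtain ⟨c, hc, hrep⟩ := exists_rep_eq R i
  have hs' : ∃ v, dirDeriv F.1 (c • R.vec i) v ≠ 0 := by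
    obtain ⟨v, hv⟩ := hs
    exact ⟨v, by rw [dirDeriv_smul_point]; exact mul_ne_zero (pow_ne_zero _ hc) hv⟩
  obtain ⟨k, hk, hkF⟩ := (cutsOut_iff R i F).1 hF
  obtain ⟨x, hx, hne⟩ := R.exists_eval_ne i
  rw [IsStarPoint, hrep]
  refine ⟨hg.eval_vertex (by omega) c, hs', ⟨x, hg.dirDeriv_vertex hd hx c, ?_⟩, fun v hv => ?_⟩
  · rw [hkF x hx]
    exact mul_ne_zero hk hne
  · have hav : R.eqn i ⬝ᵥ v = 0 := by
      by_contra h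
      exact hg.dirDeriv_vertex_ne hd hs' h hv
    have : onLine F.1 (c • R.vec i) v =
        Polynomial.X ^ d * Polynomial.C (eval v F.1) := by
      refine Polynomial.funext fun s => ?_
      rw [eval_onLine, add_comm (c • R.vec i), hg.1 (s • v) (by simp [hav]), eval_smul_form]
      simp only [Polynomial.eval_mul, Polynomial.eval_pow, Polynomial.eval_X, Polynomial.eval_C]
    exact ⟨_, this⟩

/-- The form `∑ X_{ρ i} X_{σ i}^(d-1)`. -/
def tangentForm (S : Pos N) (hd : 1 ≤ d) : Form N d :=
  ⟨∑ i : Fin 2, X (S.ρ i) * X (S.σ i) ^ (d - 1), by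
    refine IsHomogeneous.sum _ _ _ fun i _ => ?_
    have := (isHomogeneous_X ℂ (S.ρ i)).mul (isHomogeneous_X_pow (S.σ i) (d - 1))
    rwa [show 1 + (d - 1) = d by omega] at this⟩

theorem posV_σ_eq (hN : 3 ≤ N) (i : Fin 2) : (posV hN).σ i = (posV hN).ρ (1 - i) := by
  fin_cases i <;> rfl

theorem posV_eval_eq_zero (hN : 3 ≤ N) (hd : d ≠ 0) {F : Form N d} (hF : (posV hN).Adapted F)
    {x : Fin (N + 1) → ℂ} (hx : ∀ j, j ∉ Set.range (posV hN).ρ → x j = 0) : eval x F.1 = 0 := by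
  by_contra h
  obtain ⟨m, hm, hm0⟩ := exists_coeff_ne h
  have hdeg := degree_eq_of_mem_support F (mem_support_iff.2 hm)
  have : m = 0 := by
    ext j
    by_cases hj : j ∈ Set.range (posV hN).ρ
    · obtain ⟨i, rfl⟩ := hj
      exact (posV_allowed_iff hN m).1 (hF m hm) i
    · exact hm0 j (hx j hj)
  rw [this, map_zero] at hdeg
  exact hd hdeg.symm

/-- Only smoothness at the two vertices is at stake. In position `posW` the adapted form is already
smooth there; in position `posV` it is singular there, and a form vanishing on both hyperplanes is
added to correct this. -/
theorem exists_star_realization (hN : 3 ≤ N) (hd : 3 ≤ d) {L : Config N d 2}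
    (hL : L ∈ suitedConfigs N d 2) :
    ∃ F : Form N d, Realizes F L ∧ ∀ i, IsStarPoint F (L i).pt := by
  have hinv : ∀ {S : Pos N} (D : Frame S d) y, D.h.mulVec (D.h⁻¹.mulVec y) = y := fun D y => by
    rw [Matrix.mulVec_mulVec, Matrix.mul_nonsing_inv _ D.unit, Matrix.one_mulVec]
  have key : ∀ {S : Pos N} (D : Frame S d) (G : Form N d),
      (∀ i (x : Fin (N + 1) → ℂ), x (S.ρ i) = 0 → eval x G.1 = eval x D.F.1) →
      (∀ i, dirDeriv G.1 (Pi.single (S.σ i) 1) (Pi.single (S.ρ i) 1) ≠ 0) →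
      ∃ F : Form N d, Realizes F D.conf.toConfig ∧ ∀ i, IsStarPoint F (D.conf.toConfig i).pt := by
    intro S D G hG hne
    have hreal : Realizes (comp G D.h) D.conf.toConfig := D.cutsOut_comp G hG
    refine ⟨_, hreal, fun i => isStarPoint_of_goodAt (by omega) (hreal i)
      (goodAt_of_realizes D.goodAt hreal i) ⟨D.h⁻¹.mulVec (Pi.single (S.ρ i) 1), ?_⟩⟩
    rw [dirDeriv_comp, D.mulVec_conf_vec, hinv]
    exact hne i
  rw [suited_eq_union hN (by omega), V_eq_frameConfigs hN (by omega),
    W_eq_frameConfigs hN (by omega)] at hL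
  rcases hL with ⟨D, rfl⟩ | ⟨D, rfl⟩
  -- In this position each term of `tangentForm` contains both `ρ`-variables, so the cones do not
  -- change, while its derivative at `P_k` transversal to `Π_k` is 1.
  · refine key D (D.F + tangentForm (posV hN) (by omega)) (fun i x hx => ?_) fun k => ?_
    · have h0 : ∀ j, x ((posV hN).ρ j) * x ((posV hN).σ j) ^ (d - 1) = 0 := fun j => by
        by_cases hj : j = i
        · rw [hj, hx, zero_mul]
        · rw [posV_σ_eq, show 1 - j = i by omega, hx, zero_pow (by omega), mul_zero]
      rw [Submodule.coe_add, map_add, tangentForm]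
      simp [h0]
    · have h1 : dirDeriv D.F.1 (Pi.single ((posV hN).σ k) 1) (Pi.single ((posV hN).ρ k) 1) = 0 := by
        have hz : ∀ s : ℂ, eval (Pi.single ((posV hN).σ k) 1 +
            s • Pi.single ((posV hN).ρ k) 1 : Fin (N + 1) → ℂ) D.F.1 = 0 := fun s => by
          refine posV_eval_eq_zero hN (by omega) D.good.adapted fun j hj => ?_
          have hjρ : ∀ i, j ≠ (posV hN).ρ i := fun i h => hj ⟨i, h.symm⟩
          rw [posV_σ_eq]
          simp [Pi.single_eq_of_ne (hjρ _)]
        refine dirDeriv_eq_zero_of_const _ fun s => ?_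
        rw [hz s]
        have := hz 0
        rwa [zero_smul, add_zero, eq_comm] at this
      have h2 : dirDeriv (D.F + tangentForm (posV hN) (by omega : 1 ≤ d)).1
          (Pi.single ((posV hN).σ k) 1) (Pi.single ((posV hN).ρ k) 1) = 1 := by
        rw [← eval_pderiv, Submodule.coe_add, map_add, map_add, eval_pderiv, h1, zero_add]
        have hk : (1 - k : Fin 2) ≠ k := by omega
        have hρ : (posV hN).ρ (1 - k) ≠ (posV hN).ρ k := (posV hN).ρ_inj.ne hk
        simp only [tangentForm, map_sum, Derivation.leibniz, Derivation.leibniz_pow, pderiv_X,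
          posV_σ_eq]
        rw [Finset.sum_eq_single k]
        · simp [Pi.single_eq_of_ne hρ]
        · intro i _ hik
          obtain rfl : i = 1 - k := by omega
          simp [hρ.symm, show d - 1 - 1 ≠ 0 by omega]
        · simp
      rw [h2]
      exact one_ne_zero
  · exact key D D.F (fun _ _ _ => rfl) (dirDeriv_ne_zero_posW hN hd D.good)

/-- If `P_1` lies on `Π_0`, invariance along `P_0` reduces `F` on the line to its value at a
multiple of `P_1`, which is zero. If `P_1` is off `Π_0`, smoothness at `P_0` makes the derivative
towards `P_1` nonzero, so the line cannot lie on `X`; the star condition at `P_0` is enough. -/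
theorem mem_W_iff_lineOn (hN : 3 ≤ N) (hd : 3 ≤ d) {L : Config N d 2}
    (hL : L ∈ suitedConfigs N d 2) {F : Form N d} (hF : Realizes F L)
    (hs : IsStarPoint F (L 0).pt) : L ∈ W N d ↔ LineOn F (L 0).pt (L 1).pt := by
  obtain ⟨R, rfl⟩ := toConfig_surjective L
  obtain ⟨hgood, -, -⟩ := (mem_suited_iff R).1 hL
  have hgF := goodAt_of_realizes hgood hF
  constructor
  · intro hW x hx
    rw [W_eq_frameConfigs hN (by omega)] at hW
    obtain ⟨D, hD⟩ := hW
    have h01 : R.eqn 0 ⬝ᵥ R.vec 1 = 0 := by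
      rw [← pt_le_hyp_iff, ← hD, pt_le_hyp_iff, eqn_dot_vec_conf, if_neg (posW_ρ_ne_σ hN _ _)]
    obtain ⟨y, hy, z, hz, rfl⟩ := Submodule.mem_sup.1 hx
    obtain ⟨s, rfl⟩ := (mem_pt_iff R 0 y).1 hy
    obtain ⟨t, rfl⟩ := (mem_pt_iff R 1 z).1 hz
    rw [add_comm (s • R.vec 0), (hgF 0).1 _ (by simp [h01]), (hgF 1).eval_vertex (by omega)]
  · intro hline
    refine ⟨hL, fun hgen => ?_⟩
    have h01 := ((mem_general_iff R).1 hgen).2 1 0 (by simp)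
    obtain ⟨c, hc, hrep⟩ := exists_rep_eq R 0
    have hsm := hs.2.1
    rw [hrep] at hsm
    refine (hgF 0).dirDeriv_vertex_ne (by omega) hsm h01 ?_
    have hz : ∀ s : ℂ, eval (c • R.vec 0 + s • R.vec 1) F.1 = 0 := fun s =>
      hline _ (Submodule.add_mem_sup ((mem_pt_iff R 0 _).2 ⟨c, rfl⟩)
        ((mem_pt_iff R 1 _).2 ⟨s, rfl⟩))
    refine dirDeriv_eq_zero_of_const _ fun s => ?_
    rw [hz s]
    have := hz 0
    rwa [zero_smul, add_zero, eq_comm] at this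

end Star

/-! ### Binomial identities for the dimensions -/

section Numerics

/-- By Pascal's rule the expected codimension is `binom(N+d-2, N-2) - 1`. -/
theorem expectedDim_two {N d : ℕ} (hN : 3 ≤ N) (hd : 3 ≤ d) :
    ((2 * N + 2 * (N - 1) + (N + d - 2).choose (N - 2) - 1 : ℕ) : ℤ) = expectedDim N d 2 := by
  obtain ⟨M, rfl⟩ : ∃ M, N = M + 3 := ⟨N - 3, by omega⟩
  obtain ⟨n, rfl⟩ : ∃ n, d = n + 3 := ⟨d - 3, by omega⟩
  have h := Nat.choose_succ_succ (M + n + 4) (M + 1)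
  have hpos : 0 < (M + n + 4).choose (M + 1) := Nat.choose_pos (by omega)
  rw [expectedDim, dimTriples, Finset.Icc_self, Finset.sum_singleton, if_pos (by omega)]
  rw [show M + 3 + (n + 3) - 2 = M + n + 4 by omega, show M + 3 - 2 = M + 1 by omega,
    show M + 3 + (n + 3) - 1 = M + n + 4 + 1 by omega, show M + 3 - 1 = M + 1 + 1 by omega, h,
    Nat.cast_sub (by omega)]
  simp only [Nat.succ_eq_add_one]
  push_cast
  ring

/-- For `N = 3` the comparison is `d + 10 < 2 * d + 6`. For `N ≥ 4`, Pascal's rule gives the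
difference `binom(N+d-4, N-2) - 2`, and this binomial coefficient is at least `N - 1`. -/
theorem dim_lt_dimW_iff {N d : ℕ} (hN : 3 ≤ N) (hd : 3 ≤ d) :
    2 * N + 2 * (N - 1) + (N + d - 2).choose (N - 2) - 1 < dimW N d ↔ 4 ≤ N ∨ 5 ≤ d := by
  unfold dimW
  by_cases h3 : N = 3
  · subst h3
    rw [if_pos rfl]
    simp
    omega
  · rw [if_neg h3]
    obtain ⟨M, rfl⟩ : ∃ M, N = M + 4 := ⟨N - 4, by omega⟩
    obtain ⟨n, rfl⟩ : ∃ n, d = n + 3 := ⟨d - 3, by omega⟩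
    have h1 := Nat.choose_succ_succ (M + n + 4) (M + 1)
    have h2 := Nat.choose_succ_succ (M + n + 3) M
    have h4 := Nat.choose_succ_succ (M + n + 3) (M + 1)
    have h5 : 2 < (M + n + 3).choose (M + 2) := by
      refine lt_of_lt_of_le ?_ (Nat.choose_le_choose (M + 2) (show M + 3 ≤ M + n + 3 by omega))
      rw [Nat.choose_succ_self_right]
      omega
    simp only [Nat.succ_eq_add_one, add_assoc, Nat.reduceAdd] at h1 h2 h4
    rw [show M + 4 + (n + 3) - 2 = M + (n + 5) by omega, show M + 4 - 2 = M + 2 by omega,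
      show M + 4 + (n + 3) - 4 = M + (n + 3) by omega, show M + 4 - 4 = M by omega,
      show M + 4 + (n + 3) - 3 = M + (n + 4) by omega]
    rw [add_assoc] at h5
    omega

end Numerics

end StarPoints

end

theorem mainTheorem9 (N d : ℕ) (hN : 3 ≤ N) (hd : 3 ≤ d) :
    -- `𝒮` has exactly two irreducible components, one of which is `𝒱_{d,2}`
    (fun Z : Set (StarPoints.suitedConfigs N d 2) => Subtype.val '' Z) ''
        irreducibleComponents (StarPoints.suitedConfigs N d 2) =
      {StarPoints.V N d 2, StarPoints.W N d} ∧
    StarPoints.V N d 2 ≠ StarPoints.W N d ∧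
    -- `𝒱_{d,2}` has the expected dimension
    (∃ n : ℕ, topologicalKrullDim (StarPoints.V N d 2) = n ∧
      (n : ℤ) = StarPoints.expectedDim N d 2 ∧
      n = 2 * N + 2 * (N - 1) + (N + d - 2).choose (N - 2) - 1) ∧
    -- the dimension of the other component, and when it is larger
    topologicalKrullDim (StarPoints.W N d) = (StarPoints.dimW N d : ℕ) ∧
    (topologicalKrullDim (StarPoints.V N d 2) < topologicalKrullDim (StarPoints.W N d) ↔
      4 ≤ N ∨ 5 ≤ d) ∧
    -- the other component is the case where the line through the star points lies on `X`
    ∀ L ∈ StarPoints.suitedConfigs N d 2,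
      (∃ F : StarPoints.Form N d, StarPoints.Realizes F L ∧
        StarPoints.IsStarPoint F (L 0).pt ∧ StarPoints.IsStarPoint F (L 1).pt) ∧
      ∀ F : StarPoints.Form N d, StarPoints.Realizes F L →
        StarPoints.IsStarPoint F (L 0).pt → StarPoints.IsStarPoint F (L 1).pt →
        (L ∈ StarPoints.W N d ↔ StarPoints.LineOn F (L 0).pt (L 1).pt) := by
  have hV := StarPoints.topologicalKrullDim_V hN hd
  have hW := StarPoints.topologicalKrullDim_W hN hd
  have hd2 : 2 ≤ d := by omega
  have hVirr : IsIrreducible (StarPoints.V N d 2) := by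
    rw [StarPoints.V_eq_frameConfigs hN hd2]
    exact StarPoints.isIrreducible_frameConfigs _ (by omega)
      (StarPoints.stdGood_fermatV hN (by omega))
  have hWirr : IsIrreducible (StarPoints.W N d) := by
    rw [StarPoints.W_eq_frameConfigs hN hd2]
    exact StarPoints.isIrreducible_frameConfigs _ (by omega) (StarPoints.stdGood_fermatW hN hd)
  refine ⟨StarPoints.image_irreducibleComponents_eq (StarPoints.suited_eq_union hN hd2) hVirr hWirr
      StarPoints.disjoint_V_W (fun _ => StarPoints.exists_isOpen_of_mem_V hN hd)
      (fun _ => StarPoints.exists_isOpen_of_mem_W hN hd),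
    fun h => ?_, ⟨_, hV, StarPoints.expectedDim_two hN hd, rfl⟩, hW, ?_, fun L hL => ⟨?_, ?_⟩⟩
  · obtain ⟨L, hL⟩ := hVirr.nonempty
    exact Set.disjoint_left.1 StarPoints.disjoint_V_W hL (h ▸ hL)
  · rw [hV, hW, ← StarPoints.dim_lt_dimW_iff hN hd]
    exact_mod_cast Iff.rfl
  · obtain ⟨F, hF, hs⟩ := StarPoints.exists_star_realization hN hd hL
    exact ⟨F, hF, hs 0, hs 1⟩
  · exact fun F hF h0 _ => StarPoints.mem_W_iff_lineOn hN hd hL hF h0
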